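/- Fix $m$ and let $M_N(\mathbb C)_{sa}^m$ be the space of $m$-tuples of self-adjoint $N\times N$ matrices, a Euclidean space for $\langle x,y\rangle=\sum_j \mathrm{Tr}(x_jy_j)$, with Lebesgue measure $dx$. Put $\tau_N=\frac1N\mathrm{Tr}$, $\|x\|_2=(\sum_j\tau_N(x_j^*x_j))^{1/2}$, $\|x\|_\infty=\max_j\|x_j\|$ (operator norm), and $Du=N\nabla u$, where $\nabla$ is the gradient for $\langle\cdot,\cdot\rangle$. Scalar-valued trace polynomials are the elements of the symmetric algebra over $\mathbb C\langle X_1,\dots,X_m\rangle/\mathrm{Span}(pq-qp)$ (the class of $p$ is written $\tau(p)$), and operator-valued ones are the elements of its tensor product with $\mathbb C\langle X_1,\dots,X_m\rangle$; they are evaluated at $N\times N$ matrices with $\tau=\tau_N$. A sequence $\phi_N:M_N(\mathbb C)_{sa}^m\to M_N(\mathbb C)^m$ is asymptotically approximable by trace polynomials if for all $\epsilon,R>0$ there is an $m$-tuple $f$ of operator-valued trace polynomials with $$\limsup_{N\to\infty}\ \sup_{\|x\|_\infty\le R}\|\phi_N(x)-f(x)\|_2\le\epsilon .$$ Let $d\sigma_{t,N}(x)=Z_{N,t}^{-1}\exp(-N\sum_j\mathrm{Tr}(x_j^2)/2t)\,dx$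 be the law of $m$ independent GUE matrices of normalized variance $t$, and define $$P_tu(x)=\int u(x+y)\,d\sigma_{t,N}(y),\qquad Q_tu(x)=\inf_y\Bigl[u(x+y)+\tfrac1{2t}\|y\|_2^2\Bigr],$$ $R_su=\lim_{\ell\to\infty}(P_{2^{-\ell}}Q_{2^{-\ell}})^{2^\ell s}u$ (pointwise) for nonnegative dyadic rationals $s$, and $R_tu=\lim_{s\to t,\ s\text{ dyadic}}R_su$ (pointwise) for real $t>0$. Let $C\in\mathbb R$ and let $V_N:M_N(\mathbb C)_{sa}^m\to\mathbb R$ be functions such that, for every $N\ge1$, $V_N$ is convex and $V_N(x)-\frac C2\|x\|_2^2$ is concave, and such that $\{DV_N\}$ is asymptotically approximable by trace polynomials. Then for every $t>0$ the functions $P_tV_N$, $Q_tV_N$, $R_tV_N$ are well defined (the integral, the infimum and the limits exist and are finite) and differentiable for all $N\ge1$, and the sequences $\{D(P_tV_N)\}$, $\{D(Q_tV_N)\}$ and $\{D(R_tV_N)\}$ are asymptotically approximable by trace polynomials. Moreover, let $V_{N,t}$ be defined by $\exp(-N^2V_{N,t}(x))=\int\exp(-N^2V_N(x+y))\,d\sigma_{t,N}(y)$.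 Then for all $N\ge1$ this integral is finite and $V_{N,t}$ is differentiable, and $\{DV_{N,t}\}$ is asymptotically approximable by trace polynomials. Whenever $Z_N=\int\exp(-N^2V_N)\,dx<\infty$ and $d\mu_N=Z_N^{-1}\exp(-N^2V_N)\,dx$, the function $V_{N,t}$ is the potential of $\mu_N*\sigma_{t,N}$, that is, $\mu_N*\sigma_{t,N}$ has density proportional to $\exp(-N^2V_{N,t})$. -/

import Mathlib

open MeasureTheory Filter Topology Set

noncomputable section

/-! ### The Euclidean space of `m`-tuples of self-adjoint matrices -/

/-- `M_N(ℂ)_{sa}^m`: the `m`-tuples of self-adjoint complex `N × N` matrices. -/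
def SATuple (m N : ℕ) : Type := Fin m → selfAdjoint (Matrix (Fin N) (Fin N) ℂ)

namespace SATuple

variable {m N : ℕ}

instance : AddCommGroup (SATuple m N) :=
  inferInstanceAs (AddCommGroup (Fin m → selfAdjoint (Matrix (Fin N) (Fin N) ℂ)))

instance : Module ℝ (SATuple m N) :=
  inferInstanceAs (Module ℝ (Fin m → selfAdjoint (Matrix (Fin N) (Fin N) ℂ)))

/-- The underlying tuple of matrices. -/
def mat (x : SATuple m N) : Fin m → Matrix (Fin N) (Fin N) ℂ := fun j => (x j : Matrix _ _ ℂ)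

theorem mat_add (x y : SATuple m N) (j : Fin m) : (x + y).mat j = x.mat j + y.mat j := rfl

theorem mat_smul (c : ℝ) (x : SATuple m N) (j : Fin m) : (c • x).mat j = c • x.mat j := rfl

theorem mat_conjTranspose (x : SATuple m N) (j : Fin m) : (x.mat j).conjTranspose = x.mat j :=
  (x j).2

theorem mat_injective : Function.Injective (mat : SATuple m N → _) := fun _ _ h =>
  funext fun j => Subtype.ext (congrFun h j)

/-- `mat` as an `ℝ`-linear map. -/
def matLin : SATuple m N →ₗ[ℝ] (Fin m → Matrix (Fin N) (Fin N) ℂ) where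
  toFun := mat
  map_add' _ _ := rfl
  map_smul' _ _ := rfl

instance : FiniteDimensional ℝ (SATuple m N) :=
  have : FiniteDimensional ℝ (Matrix (Fin N) (Fin N) ℂ) :=
    inferInstanceAs (FiniteDimensional ℝ (Fin N → Fin N → ℂ))
  FiniteDimensional.of_injective (matLin (m := m) (N := N)) mat_injective

/-- The (non-normalized) trace inner product `∑ⱼ Tr (xⱼ yⱼ)`; this number is real, so taking the
real part only changes its type. -/
def traceInner (x y : SATuple m N) : ℝ := ∑ j, (Matrix.trace (x.mat j * y.mat j)).re

theorem re_trace_conjTranspose_mul (A : Matrix (Fin N) (Fin N) ℂ) :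
    (Matrix.trace (A.conjTranspose * A)).re = ∑ i, ∑ k, Complex.normSq (A k i) := by
  simp [Matrix.trace, Matrix.mul_apply, Complex.normSq_apply]

theorem traceInner_self (x : SATuple m N) :
    traceInner x x = ∑ j, ∑ i, ∑ k, Complex.normSq (x.mat j k i) := by
  refine Finset.sum_congr rfl fun j _ => ?_
  rw [← re_trace_conjTranspose_mul, mat_conjTranspose]

/-- The trace inner product makes `M_N(ℂ)_{sa}^m` a Euclidean space. -/
@[reducible]
def core : InnerProductSpace.Core ℝ (SATuple m N) where
  inner := traceInner
  conj_inner_symm x y := by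
    simp only [traceInner, conj_trivial]
    exact Finset.sum_congr rfl fun j _ => by rw [Matrix.trace_mul_comm]
  re_inner_nonneg x := by
    change 0 ≤ traceInner x x
    rw [traceInner_self]
    exact Finset.sum_nonneg fun _ _ => Finset.sum_nonneg fun _ _ => Finset.sum_nonneg fun _ _ =>
      Complex.normSq_nonneg _
  add_left x y z := by
    simp [traceInner, mat_add, add_mul, Finset.sum_add_distrib]
  smul_left x y r := by
    simp [traceInner, mat_smul, Finset.mul_sum]
  definite x h := by
    apply mat_injective
    have h' : traceInner x x = 0 := h
    rw [traceInner_self] at h'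
    funext j
    ext k i
    have h1 := (Finset.sum_eq_zero_iff_of_nonneg (fun j _ => Finset.sum_nonneg fun _ _ =>
      Finset.sum_nonneg fun _ _ => Complex.normSq_nonneg _)).1 h' j (Finset.mem_univ _)
    have h2 := (Finset.sum_eq_zero_iff_of_nonneg (fun _ _ =>
      Finset.sum_nonneg fun _ _ => Complex.normSq_nonneg _)).1 h1 i (Finset.mem_univ _)
    have h3 := (Finset.sum_eq_zero_iff_of_nonneg (fun _ _ =>
      Complex.normSq_nonneg _)).1 h2 k (Finset.mem_univ _)
    exact Complex.normSq_eq_zero.1 h3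

/-- The norm `|x| = (∑ⱼ Tr (xⱼ²))^{1/2}`. -/
instance : NormedAddCommGroup (SATuple m N) := core.toNormedAddCommGroup

instance : InnerProductSpace ℝ (SATuple m N) := InnerProductSpace.ofCore core.toCore

instance : CompleteSpace (SATuple m N) := FiniteDimensional.complete ℝ _

instance : MeasurableSpace (SATuple m N) := borel _

instance : BorelSpace (SATuple m N) := ⟨rfl⟩

theorem inner_def (x y : SATuple m N) :
    inner ℝ x y = ∑ j, (Matrix.trace (x.mat j * y.mat j)).re := rfl

end SATuple

/-- The normalized norm `‖A‖₂ = (∑ⱼ τ_N (Aⱼ* Aⱼ))^{1/2}` of a tuple of matrices, where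
`τ_N = (1/N) Tr`. -/
def norm2 {m N : ℕ} (A : Fin m → Matrix (Fin N) (Fin N) ℂ) : ℝ :=
  √(∑ j, (1 / (N : ℝ)) * (Matrix.trace ((A j).conjTranspose * A j)).re)

/-- The operator norm of a complex matrix acting on the Hilbert space `ℂ^N`. -/
def opNorm {N : ℕ} (A : Matrix (Fin N) (Fin N) ℂ) : ℝ :=
  ‖Matrix.toEuclideanCLM (n := Fin N) (𝕜 := ℂ) A‖

/-- The operator-norm ball `{x : max_j ‖xⱼ‖ ≤ R}`. -/
def opBall (m N : ℕ) (R : ℝ) : Set (SATuple m N) := {x | ∀ j, opNorm (x.mat j) ≤ R}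

/-- The normalized gradient `D u = N ∇ u`. -/
def normGrad {m N : ℕ} (u : SATuple m N → ℝ) (x : SATuple m N) : SATuple m N :=
  (N : ℝ) • gradient u x

/-! ### Trace polynomials -/

/-- Non-commutative polynomials `ℂ⟨X₁, …, X_m⟩`. -/
abbrev NCPoly (m : ℕ) : Type := FreeAlgebra ℂ (Fin m)

/-- The span of the commutators `pq - qp`. -/
def commSpan (m : ℕ) : Submodule ℂ (NCPoly m) :=
  Submodule.span ℂ {r | ∃ p q : NCPoly m, r = p * q - q * p}

/-- Scalar-valued trace polynomials: the symmetric algebra over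
`ℂ⟨X₁, …, X_m⟩ / Span (pq - qp)`. The class of `p` in degree one is the symbol `τ(p)`. -/
abbrev TrP0 (m : ℕ) : Type := SymmetricAlgebra ℂ (NCPoly m ⧸ commSpan m)

/-- Operator-valued trace polynomials. -/
abbrev TrP1 (m : ℕ) : Type := TensorProduct ℂ (TrP0 m) (NCPoly m)

/-- Evaluation `p ↦ p(x)` of non-commutative polynomials at a tuple of matrices. -/
def evalNC {m N : ℕ} (x : Fin m → Matrix (Fin N) (Fin N) ℂ) :
    NCPoly m →ₐ[ℂ] Matrix (Fin N) (Fin N) ℂ :=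
  FreeAlgebra.lift ℂ x

/-- `p ↦ τ_N(p(x))` with `τ_N = (1/N) Tr`. -/
def traceNC {m N : ℕ} (x : Fin m → Matrix (Fin N) (Fin N) ℂ) : NCPoly m →ₗ[ℂ] ℂ :=
  (1 / (N : ℂ)) • (Matrix.traceLinearMap (Fin N) ℂ ℂ ∘ₗ (evalNC x).toLinearMap)

theorem commSpan_le_ker_traceNC {m N : ℕ} (x : Fin m → Matrix (Fin N) (Fin N) ℂ) :
    commSpan m ≤ LinearMap.ker (traceNC x) := by
  refine Submodule.span_le.2 ?_
  rintro r ⟨p, q, rfl⟩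
  simp [traceNC, Matrix.trace_mul_comm (evalNC x p) (evalNC x q)]

/-- Evaluation of scalar-valued trace polynomials at a tuple of matrices, `τ` being `τ_N`. -/
def evalTrP0 {m N : ℕ} (x : Fin m → Matrix (Fin N) (Fin N) ℂ) : TrP0 m →ₐ[ℂ] ℂ :=
  SymmetricAlgebra.lift ((commSpan m).liftQ (traceNC x) (commSpan_le_ker_traceNC x))

/-- Evaluation of operator-valued trace polynomials at a tuple of matrices:
`f ⊗ p ↦ f(x) p(x)`. -/
def evalTrP1 {m N : ℕ} (x : Fin m → Matrix (Fin N) (Fin N) ℂ) :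
    TrP1 m →ₗ[ℂ] Matrix (Fin N) (Fin N) ℂ :=
  TensorProduct.lift
    ((LinearMap.lsmul ℂ (Matrix (Fin N) (Fin N) ℂ)).compl₁₂
      (evalTrP0 x).toLinearMap (evalNC x).toLinearMap)

/-- A sequence of maps `φ_N : M_N(ℂ)_{sa}^m → M_N(ℂ)^m` is asymptotically approximable by trace
polynomials: for all `ε, R > 0` there is an `m`-tuple `f` of operator-valued trace polynomials with
`limsup_N sup_{‖x‖_∞ ≤ R} ‖φ_N(x) - f(x)‖₂ ≤ ε`. -/
def AsympApprox {m : ℕ}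
    (φ : ∀ N : ℕ, SATuple m N → (Fin m → Matrix (Fin N) (Fin N) ℂ)) : Prop :=
  ∀ ε : ℝ, 0 < ε → ∀ R : ℝ, 0 < R → ∃ f : Fin m → TrP1 m,
    limsup (fun N : ℕ => ⨆ x ∈ opBall m N R,
      ENNReal.ofReal (norm2 (fun j => φ N x j - evalTrP1 x.mat (f j)))) atTop
      ≤ ENNReal.ofReal ε

/-- Asymptotic approximability of the sequence of normalized gradients `D u_N`. -/
def GradAsympApprox {m : ℕ} (u : ∀ N : ℕ, SATuple m N → ℝ) : Prop :=
  AsympApprox (fun N x => (normGrad (u N) x).mat)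

/-! ### Gaussian measure and Gibbs measures -/

/-- The law `σ_{t,N}` of `m` independent GUE matrices of normalized variance `t`:
`dσ_{t,N}(x) = Z⁻¹ exp (-N ∑ⱼ Tr (xⱼ²) / 2t) dx`. -/
def gue (m N : ℕ) (t : ℝ) : Measure (SATuple m N) :=
  (∫⁻ x : SATuple m N,
      ENNReal.ofReal (Real.exp (-(N * ∑ j, (Matrix.trace (x.mat j * x.mat j)).re / (2 * t)))))⁻¹ •
    (volume : Measure (SATuple m N)).withDensity fun x =>
      ENNReal.ofReal (Real.exp (-(N * ∑ j, (Matrix.trace (x.mat j * x.mat j)).re / (2 * t))))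

/-- The measure with potential `V`: `dμ(x) = Z⁻¹ exp (-N² V(x)) dx`, where
`Z = ∫ exp (-N² V(x)) dx`. -/
def gibbs {m N : ℕ} (V : SATuple m N → ℝ) : Measure (SATuple m N) :=
  (∫⁻ x, ENNReal.ofReal (Real.exp (-((N : ℝ) ^ 2 * V x))))⁻¹ •
    (volume : Measure (SATuple m N)).withDensity fun x =>
      ENNReal.ofReal (Real.exp (-((N : ℝ) ^ 2 * V x)))

/-- The function `V_t` with `exp (-N² V_t(x)) = ∫ exp (-N² V(x + y)) dσ_{t,N}(y)`. -/
def gaussPotential {m N : ℕ} (t : ℝ) (V : SATuple m N → ℝ) (x : SATuple m N) : ℝ :=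
  -(1 / (N : ℝ) ^ 2) * Real.log (∫ y, Real.exp (-((N : ℝ) ^ 2 * V (x + y))) ∂(gue m N t))

/-! ### The operators `P_t`, `Q_t` and `R_t` -/

/-- The heat semigroup `P_t u (x) = ∫ u(x + y) dσ_{t,N}(y)`. -/
def heatOp {m N : ℕ} (t : ℝ) (u : SATuple m N → ℝ) (x : SATuple m N) : ℝ :=
  ∫ y, u (x + y) ∂(gue m N t)

/-- The Hopf-Lax semigroup `Q_t u (x) = inf_y [u(x + y) + ‖y‖₂² / 2t]`. -/
def hopfLax {m N : ℕ} (t : ℝ) (u : SATuple m N → ℝ) (x : SATuple m N) : ℝ :=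
  ⨅ y : SATuple m N, (u (x + y) + 1 / (2 * t) * norm2 y.mat ^ 2)

/-- `R_{t,ℓ} u = (P_{2^{-ℓ}} Q_{2^{-ℓ}})^n u` for `t = n 2^{-ℓ}`. -/
def trotter {m N : ℕ} (ℓ n : ℕ) (u : SATuple m N → ℝ) : SATuple m N → ℝ :=
  (fun v => heatOp ((2 : ℝ)⁻¹ ^ ℓ) (hopfLax ((2 : ℝ)⁻¹ ^ ℓ) v))^[n] u

/-- The nonnegative dyadic rationals. -/
def dyadics : Set ℝ := {s | ∃ n k : ℕ, s = n / 2 ^ k}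

/-- `R_s u = lim_{ℓ → ∞} R_{s,ℓ} u` for a nonnegative dyadic `s`; for all large `ℓ` the number
`2^ℓ s` is a natural number, so that the floor does nothing. -/
def evolDyadic {m N : ℕ} (s : ℝ) (u : SATuple m N → ℝ) (x : SATuple m N) : ℝ :=
  limUnder atTop (fun ℓ : ℕ => trotter ℓ ⌊(2 : ℝ) ^ ℓ * s⌋₊ u x)

/-- `R_t u = lim R_s u`, where `s` tends to `t` through the dyadic rationals. -/
def evol {m N : ℕ} (t : ℝ) (u : SATuple m N → ℝ) (x : SATuple m N) : ℝ :=
  limUnder (𝓝[dyadics] t) (fun s => evolDyadic s u x)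

end

/-! Since `‖x‖ ^ 2 = N ‖x‖₂ ^ 2` for the Euclidean norm, each potential is convex with `C /
N`-Lipschitz gradient after enlarging `C` to be positive (`IsConvexSmooth`), GUE noise of variance
`t` is an isotropic Gaussian of covariance `t / N`, and `Q_t` is inf-convolution with parameter `N
t`. Hence `DV_N` is monotone and `C`-Lipschitz, uniformly in `N`. All the operations preserve this
with the same constant, because it amounts to having at each point a slope with a two-sided
quadratic bound, and such bounds can be averaged and passed through an infimum.

On gradients the heat semigroup acts by averaging, `D(P_t u) = P_t(Du)`, and Hopf-Lax by a
resolvent, `D(Q_t u) = Du ∘ (1 + t Du)⁻¹`. So two closure properties of approximable, uniformly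
Lipschitz sequences are needed. For averages (`SAApprox.integral_add`), Gaussian integration by
parts shows that the expectation of a trace polynomial in `x + y` is a trace polynomial in `x` up to
`O(N⁻²)`, and exponential moments of the operator norm at scale `N` make large `y` negligible. For
resolvents (`SAApprox.resolvent`), a damped fixed point iteration contracts at a rate independent of
`N`, and each step is a composition. Compositions are harmless (`SAApprox.comp`): trace polynomials
send operator-norm balls to operator-norm balls of `N`-independent radius, and errors in the 2-norm
pass through Lipschitz maps.

Finally `R_t V_N` and `V_{N,t}` coincide (`evol_eq_gaussPotential`): alternating inf-convolution and
Gaussian averaging is a splitting scheme for a viscous Hamilton-Jacobi equation, which the Hopf-Cole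
transform `logLaplace` solves. Two error estimates play different roles. Comparing one step with
`logLaplace` (`logLaplace_local`) costs a fourth moment, hence the square of the dimension; it
identifies the limit for each fixed `N`, but not uniformly in `N`. Halving the step costs only the
defect in commuting the two semigroups (`trotterStep_trotterStep`), which is linear in the
dimension; as the dimension is `O(N ^ 2)`, the scaling makes this bounded in `N`. Thus dyadic
refinement converges uniformly in `N`, and since uniformly close convex smooth functions have close
gradients (`norm_gradient_sub_sq_le`), `DV_{N,t}` is a uniform limit of gradients of finitely
iterated steps, which are approximable. -/

/-! ### Convex functions with Lipschitz gradient -/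

section ConvexSmooth

variable {E : Type*} [NormedAddCommGroup E] [InnerProductSpace ℝ E]

/-- `u` is convex and `u - (c / 2) ‖·‖²` is concave. -/
def IsConvexSmooth (c : ℝ) (u : E → ℝ) : Prop :=
  ConvexOn ℝ univ u ∧ ConvexOn ℝ univ fun x => c / 2 * ‖x‖ ^ 2 - u x

/-- `p` is the slope of an affine minorant of `u` touching at `x`, up to a quadratic error. -/
def IsSlope (c : ℝ) (u : E → ℝ) (x p : E) : Prop :=
  ∀ h, inner ℝ p h ≤ u (x + h) - u x ∧ u (x + h) - u x ≤ inner ℝ p h + c / 2 * ‖h‖ ^ 2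

theorem convexOn_of_exists_support {u : E → ℝ}
    (h : ∀ x, ∃ p, ∀ y, u x + inner ℝ p (y - x) ≤ u y) : ConvexOn ℝ univ u := by
  refine ⟨convex_univ, fun x _ y _ a b ha hb hab => ?_⟩
  obtain ⟨p, hp⟩ := h (a • x + b • y)
  have h1 := mul_le_mul_of_nonneg_left (hp x) ha
  have h2 := mul_le_mul_of_nonneg_left (hp y) hb
  have h3 : a * inner ℝ p (x - (a • x + b • y)) + b * inner ℝ p (y - (a • x + b • y)) = 0 := by
    rw [← real_inner_smul_right, ← real_inner_smul_right, ← inner_add_right]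
    have : a • (x - (a • x + b • y)) + b • (y - (a • x + b • y)) = 0 := by
      obtain rfl : b = 1 - a := by linarith
      module
    rw [this, inner_zero_right]
  have h4 : a * u (a • x + b • y) + b * u (a • x + b • y) = u (a • x + b • y) := by
    rw [← add_mul, hab, one_mul]
  simp only [smul_eq_mul]
  linarith

theorem norm_add_sq_expand (x h : E) : ‖x + h‖ ^ 2 = ‖x‖ ^ 2 + 2 * inner ℝ x h + ‖h‖ ^ 2 :=
  norm_add_sq_real x h

/-- A slope `p` at `x` supports `u`, and `c • x - p` then supports the quadratic minus `u`. Together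
with the converse `isSlope_gradient`, this reduces preservation of convex smoothness under an
operation to exhibiting a slope of the new function. -/
theorem isConvexSmooth_of_exists_slope {c : ℝ} {u : E → ℝ} (h : ∀ x, ∃ p, IsSlope c u x p) :
    IsConvexSmooth c u := by
  constructor
  · refine convexOn_of_exists_support fun x => ?_
    obtain ⟨p, hp⟩ := h x
    refine ⟨p, fun y => ?_⟩
    have := (hp (y - x)).1
    rw [add_sub_cancel] at this
    linarith
  · refine convexOn_of_exists_support fun x => ?_
    obtain ⟨p, hp⟩ := h x
    refine ⟨c • x - p, fun y => ?_⟩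
    have h1 := (hp (y - x)).2
    have h2 := norm_add_sq_expand x (y - x)
    rw [add_sub_cancel] at h1 h2
    rw [inner_sub_left, real_inner_smul_left]
    have h3 : c / 2 * ‖y‖ ^ 2 = c / 2 * (‖x‖ ^ 2 + 2 * inner ℝ x (y - x) + ‖y - x‖ ^ 2) := by
      rw [h2]
    linarith

theorem IsSlope.hasGradientAt [CompleteSpace E] {c : ℝ} {u : E → ℝ} {x p : E}
    (h : IsSlope c u x p) : HasGradientAt u p x := by
  rw [hasGradientAt_iff_isLittleO_nhds_zero]
  refine Asymptotics.IsBigO.trans_isLittleO (g := fun h : E => ‖h‖ ^ 2) ?_ ?_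
  · refine Asymptotics.IsBigO.of_bound (|c| / 2) (Eventually.of_forall fun y => ?_)
    obtain ⟨h1, h2⟩ := h y
    rw [Real.norm_eq_abs, Real.norm_eq_abs, abs_of_nonneg (sq_nonneg ‖y‖), abs_le]
    have h3 : c / 2 * ‖y‖ ^ 2 ≤ |c| / 2 * ‖y‖ ^ 2 := by
      gcongr
      exact le_abs_self c
    have h4 : 0 ≤ |c| / 2 * ‖y‖ ^ 2 := by positivity
    constructor <;> linarith
  · exact Asymptotics.isLittleO_norm_pow_id one_lt_two

theorem IsSlope.gradient_eq [CompleteSpace E] {c : ℝ} {u : E → ℝ} {x p : E}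
    (h : IsSlope c u x p) : gradient u x = p :=
  h.hasGradientAt.gradient

namespace IsConvexSmooth

theorem of_tendsto {ι : Type*} {l : Filter ι} [l.NeBot] {U : ι → E → ℝ} {c : ℝ} {u : E → ℝ}
    (hU : ∀ᶠ i in l, IsConvexSmooth c (U i)) (h : ∀ x, Tendsto (fun i => U i x) l (𝓝 (u x))) :
    IsConvexSmooth c u := by
  have key : ∀ {W : ι → E → ℝ} {w : E → ℝ}, (∀ᶠ i in l, ConvexOn ℝ univ (W i)) →
      (∀ x, Tendsto (fun i => W i x) l (𝓝 (w x))) → ConvexOn ℝ univ w := by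
    intro W w hW hw
    refine ⟨convex_univ, fun x _ y _ a b ha hb hab => ?_⟩
    exact le_of_tendsto_of_tendsto (hw _) (((hw x).const_smul a).add ((hw y).const_smul b))
      (hW.mono fun i hi => hi.2 (mem_univ x) (mem_univ y) ha hb hab)
  exact ⟨key (hU.mono fun _ hi => hi.1) h,
    key (hU.mono fun _ hi => hi.2) fun x => (tendsto_const_nhds).sub (h x)⟩

theorem mono_const {c c' : ℝ} {u : E → ℝ} (hu : IsConvexSmooth c u) (hcc : c ≤ c') :
    IsConvexSmooth c' u := by
  refine ⟨hu.1, ?_⟩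
  have h1 : ConvexOn ℝ univ fun x : E => ‖x‖ ^ 2 := by
    refine (convexOn_norm convex_univ).pow (fun x _ => norm_nonneg x) 2
  have h2 := hu.2.add (h1.smul (c := (c' - c) / 2) (by linarith))
  refine h2.congr fun x _ => ?_
  simp only [Pi.add_apply, smul_eq_mul]
  ring

end IsConvexSmooth

/-! ### Existence of slopes and inequalities for gradients. -/

variable [FiniteDimensional ℝ E] [CompleteSpace E]

/-- Hahn-Banach separates `(x, u x)` from the open strict epigraph; the vertical coefficient of the
functional is positive and is divided out. Finite dimension enters through the continuity of `u`. -/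
theorem ConvexOn.exists_support {u : E → ℝ} (hu : ConvexOn ℝ univ u) (x : E) :
    ∃ p, ∀ y, u x + inner ℝ p (y - x) ≤ u y := by
  have hc : Continuous u := by
    rw [← continuousOn_univ]
    exact hu.continuousOn isOpen_univ
  have hs : IsOpen {q : E × ℝ | u q.1 < q.2} :=
    isOpen_lt (hc.comp continuous_fst) continuous_snd
  have hcv : Convex ℝ {q : E × ℝ | u q.1 < q.2} := by
    simpa using hu.convex_strict_epigraph
  obtain ⟨f, hf⟩ := geometric_hahn_banach_point_open (x := (x, u x)) hcv hs (by simp)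
  have hsplit : ∀ y r, f (y, r) = f (y, 0) + r * f (0, 1) := fun y r => by
    rw [← smul_eq_mul, ← map_smul, ← map_add]
    simp
  have hβ : 0 < f (0, 1) := by
    have := hf (x, u x + 1) (by simp)
    rw [hsplit x (u x), hsplit x (u x + 1)] at this
    linarith
  let g : StrongDual ℝ E := f.comp (ContinuousLinearMap.inl ℝ E ℝ)
  have hg : ∀ y, g y = f (y, 0) := fun y => by simp [g]
  refine ⟨(InnerProductSpace.toDual ℝ E).symm (-(f (0, 1))⁻¹ • g), fun y => ?_⟩
  rw [InnerProductSpace.toDual_symm_apply]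
  refine le_of_forall_pos_lt_add fun ε hε => ?_
  have h1 := hf (y, u y + ε) (by simp [hε])
  rw [hsplit x, hsplit y, ← hg, ← hg] at h1
  have h2 : (-(f (0, 1))⁻¹ • g) (y - x) = (g x - g y) / f (0, 1) := by
    simp [map_sub]
    field_simp
    ring
  rw [h2, ← lt_sub_iff_add_lt', div_lt_iff₀ hβ]
  linarith

namespace IsConvexSmooth

variable {c : ℝ} {u v : E → ℝ}

/-- Supporting slopes of `u` and of the quadratic minus `u` squeeze `u` between two functions
touching it at `x`. Comparing these along the difference `z` of the two slopes, at scale `s → 0`,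
forces `z = 0`. -/
theorem isSlope_gradient (hu : IsConvexSmooth c u) (x : E) : IsSlope c u x (gradient u x) := by
  suffices ∃ p, IsSlope c u x p by
    obtain ⟨p, hp⟩ := this
    rwa [hp.gradient_eq]
  obtain ⟨p, hp⟩ := hu.1.exists_support x
  obtain ⟨q, hq⟩ := hu.2.exists_support x
  have hp' : ∀ h, inner ℝ p h ≤ u (x + h) - u x := fun h => by
    have := hp (x + h)
    rw [add_sub_cancel_left] at this
    linarith
  have hq' : ∀ h, u (x + h) - u x ≤ inner ℝ (c • x - q) h + c / 2 * ‖h‖ ^ 2 := fun h => by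
    have h1 := hq (x + h)
    rw [add_sub_cancel_left] at h1
    rw [inner_sub_left, real_inner_smul_left]
    have h3 : c / 2 * ‖x + h‖ ^ 2 = c / 2 * (‖x‖ ^ 2 + 2 * inner ℝ x h + ‖h‖ ^ 2) := by
      rw [norm_add_sq_expand]
    linarith
  refine ⟨p, fun h => ⟨hp' h, ?_⟩⟩
  have key : p = c • x - q := by
    set z := p - (c • x - q) with hz
    have h1 : ∀ s : ℝ, 0 < s → ‖z‖ ^ 2 ≤ c / 2 * ‖z‖ ^ 2 * s := fun s hs => by
      have h2 := (hp' (s • z)).trans (hq' (s • z))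
      rw [← sub_le_iff_le_add', ← inner_sub_left, ← hz, real_inner_smul_right,
        real_inner_self_eq_norm_sq, norm_smul, mul_pow, Real.norm_eq_abs, sq_abs] at h2
      have h3 : s * ‖z‖ ^ 2 ≤ s * (c / 2 * ‖z‖ ^ 2 * s) := by
        calc _ ≤ _ := h2
          _ = _ := by ring
      exact le_of_mul_le_mul_left h3 hs
    have h2 : ‖z‖ ^ 2 ≤ 0 := by
      have : Tendsto (fun s : ℝ => c / 2 * ‖z‖ ^ 2 * s) (𝓝[>] 0) (𝓝 (c / 2 * ‖z‖ ^ 2 * 0)) :=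
        ((continuous_const.mul continuous_id).tendsto 0).mono_left nhdsWithin_le_nhds
      rw [mul_zero] at this
      exact ge_of_tendsto this (eventually_mem_nhdsWithin.mono fun s hs => h1 s hs)
    have h3 : z = 0 := by
      have : ‖z‖ = 0 := by nlinarith [norm_nonneg z]
      exact norm_eq_zero.1 this
    exact sub_eq_zero.1 h3
  rw [key]
  exact hq' h

theorem le_add (hu : IsConvexSmooth c u) (x h : E) :
    u x + inner ℝ (gradient u x) h ≤ u (x + h) := by
  have := (hu.isSlope_gradient x h).1
  linarith

theorem add_le (hu : IsConvexSmooth c u) (x h : E) :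
    u (x + h) ≤ u x + inner ℝ (gradient u x) h + c / 2 * ‖h‖ ^ 2 := by
  have := (hu.isSlope_gradient x h).2
  linarith

theorem differentiable (hu : IsConvexSmooth c u) : Differentiable ℝ u := fun x =>
  (hu.isSlope_gradient x).hasGradientAt.differentiableAt

theorem continuous (hu : IsConvexSmooth c u) : Continuous u := hu.differentiable.continuous

/-- The point `y - (1 / c) • g` is a gradient step from `y` for `u` tilted by its slope at `x`;
convexity from `x` bounds `u` there from below, smoothness from `y` from above. -/
theorem gradient_sub_sq_le (hu : IsConvexSmooth c u) (hc : 0 < c) (x y : E) :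
    ‖gradient u y - gradient u x‖ ^ 2 / (2 * c) ≤
      u y - u x - inner ℝ (gradient u x) (y - x) := by
  set g := gradient u y - gradient u x with hg
  have h1 := hu.le_add x (y - x - (1 / c) • g)
  have h2 := hu.add_le y (-((1 / c) • g))
  have e : x + (y - x - (1 / c) • g) = y + -((1 / c) • g) := by abel
  rw [e] at h1
  rw [inner_sub_right, real_inner_smul_right] at h1
  rw [inner_neg_right, real_inner_smul_right, norm_neg, norm_smul, mul_pow, Real.norm_eq_abs,
    sq_abs] at h2
  have h3 : inner ℝ (gradient u y) g - inner ℝ (gradient u x) g = ‖g‖ ^ 2 := by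
    rw [← inner_sub_left, ← hg, real_inner_self_eq_norm_sq]
  have h4 : 1 / c * inner ℝ (gradient u y) g - 1 / c * inner ℝ (gradient u x) g
      = ‖g‖ ^ 2 / c := by
    rw [← mul_sub, h3]; ring
  have h5 : c / 2 * ((1 / c) ^ 2 * ‖g‖ ^ 2) = ‖g‖ ^ 2 / (2 * c) := by field_simp
  have h6 : ‖g‖ ^ 2 / c = 2 * (‖g‖ ^ 2 / (2 * c)) := by field_simp
  linarith

theorem gradient_monotone (hu : IsConvexSmooth c u) (x y : E) :
    0 ≤ inner ℝ (gradient u y - gradient u x) (y - x) := by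
  have h1 := hu.le_add x (y - x)
  have h2 := hu.le_add y (-(y - x))
  rw [add_sub_cancel] at h1
  rw [show y + -(y - x) = x by abel, inner_neg_right] at h2
  rw [inner_sub_left]
  linarith

theorem gradient_lipschitz (hu : IsConvexSmooth c u) (hc : 0 < c) (x y : E) :
    ‖gradient u y - gradient u x‖ ≤ c * ‖y - x‖ := by
  have h1 := hu.gradient_sub_sq_le hc x y
  have h2 := hu.gradient_sub_sq_le hc y x
  rw [← neg_sub y x, inner_neg_right, norm_sub_rev] at h2
  have h3 : ‖gradient u y - gradient u x‖ ^ 2 / c ≤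
      inner ℝ (gradient u y - gradient u x) (y - x) := by
    rw [inner_sub_left]
    have : ‖gradient u y - gradient u x‖ ^ 2 / c =
      2 * (‖gradient u y - gradient u x‖ ^ 2 / (2 * c)) := by field_simp
    linarith
  have h4 := h3.trans (real_inner_le_norm _ _)
  rw [div_le_iff₀ hc] at h4
  by_contra! hlt
  have h5 : 0 < ‖gradient u y - gradient u x‖ := lt_of_le_of_lt (by positivity) hlt
  nlinarith

theorem continuous_gradient (hu : IsConvexSmooth c u) (hc : 0 < c) : Continuous (gradient u) := by
  have : LipschitzWith c.toNNReal (gradient u) := LipschitzWith.of_dist_le_mul fun x y => by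
    rw [dist_eq_norm, dist_eq_norm, Real.coe_toNNReal c hc.le]
    exact hu.gradient_lipschitz hc y x
  exact this.continuous

/-- At `x + (1 / c) • g` convexity of `u` and smoothness of `v` separate the two functions by `‖g‖ ^
2 / (2 * c)` more than at `x`, while the total change is at most `2 * ε`. This turns uniform
convergence of potentials into convergence of gradients. -/
theorem norm_gradient_sub_sq_le (hu : IsConvexSmooth c u) (hv : IsConvexSmooth c v) (hc : 0 < c)
    {ε : ℝ} (huv : ∀ x, |u x - v x| ≤ ε) (x : E) :
    ‖gradient u x - gradient v x‖ ^ 2 ≤ 4 * c * ε := by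
  set g := gradient u x - gradient v x with hg
  have h1 := hu.le_add x ((1 / c) • g)
  have h2 := hv.add_le x ((1 / c) • g)
  have h3 := (abs_le.1 (huv x)).1
  have h4 := (abs_le.1 (huv (x + (1 / c) • g))).2
  rw [real_inner_smul_right] at h1 h2
  rw [norm_smul, mul_pow, Real.norm_eq_abs, sq_abs] at h2
  have h5 : inner ℝ (gradient u x) g - inner ℝ (gradient v x) g = ‖g‖ ^ 2 := by
    rw [← inner_sub_left, ← hg, real_inner_self_eq_norm_sq]
  have h6 : 1 / c * inner ℝ (gradient u x) g - 1 / c * inner ℝ (gradient v x) g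
      = ‖g‖ ^ 2 / c := by
    rw [← mul_sub, h5]; ring
  have h7 : c / 2 * ((1 / c) ^ 2 * ‖g‖ ^ 2) = ‖g‖ ^ 2 / c / 2 := by field_simp
  have h8 : ‖g‖ ^ 2 / c ≤ 4 * ε := by linarith
  rw [div_le_iff₀ hc] at h8
  linarith

end IsConvexSmooth

end ConvexSmooth

/-! ### The Hopf-Lax semigroup -/

section HopfLax

variable {E : Type*} [NormedAddCommGroup E] [InnerProductSpace ℝ E]

/-- The Hopf-Lax operator `u ↦ inf_y [u(x + y) + ‖y‖² / 2a]` for the Euclidean norm. -/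
noncomputable def infConv (a : ℝ) (u : E → ℝ) (x : E) : ℝ :=
  ⨅ y : E, (u (x + y) + 1 / (2 * a) * ‖y‖ ^ 2)

theorem eq_zero_of_sq_le_mul {E : Type*} [NormedAddCommGroup E] {z : E} {K : ℝ} (h : ∀ s : ℝ, 0 < s → ‖z‖ ^ 2 ≤ K * s) : z = 0 := by
  have h2 : ‖z‖ ^ 2 ≤ 0 := by
    have : Tendsto (fun s : ℝ => K * s) (𝓝[>] 0) (𝓝 (K * 0)) :=
      ((continuous_const.mul continuous_id).tendsto 0).mono_left nhdsWithin_le_nhds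
    rw [mul_zero] at this
    exact ge_of_tendsto this (eventually_mem_nhdsWithin.mono fun s hs => h s hs)
  have : ‖z‖ = 0 := by nlinarith [norm_nonneg z]
  exact norm_eq_zero.1 this

variable [FiniteDimensional ℝ E] [CompleteSpace E]

namespace IsConvexSmooth

variable {a c : ℝ} {u v : E → ℝ}

/-- The difference of the two sides is a convexity gap plus the square `1 / (2 * a) * ‖a • g + y‖ ^
2`, so a solution `g` of the fixed point equation yields the minimizer `-(a • g)`. -/
theorem infConv_bound (hu : IsConvexSmooth c u) (ha : 0 < a) {x g : E}
    (hg : gradient u (x - a • g) = g) (y : E) :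
    u (x - a • g) + a / 2 * ‖g‖ ^ 2 ≤ u (x + y) + 1 / (2 * a) * ‖y‖ ^ 2 := by
  have h1 := hu.le_add (x - a • g) (a • g + y)
  rw [hg, show x - a • g + (a • g + y) = x + y by abel, inner_add_right, real_inner_smul_right,
    real_inner_self_eq_norm_sq] at h1
  have h2 : 0 ≤ 1 / (2 * a) * ‖a • g + y‖ ^ 2 := by positivity
  rw [norm_add_sq_expand, norm_smul, mul_pow, Real.norm_eq_abs, sq_abs,
    real_inner_smul_left] at h2
  have h3 : 1 / (2 * a) * (a ^ 2 * ‖g‖ ^ 2 + 2 * (a * inner ℝ g y) + ‖y‖ ^ 2) =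
      a / 2 * ‖g‖ ^ 2 + inner ℝ g y + 1 / (2 * a) * ‖y‖ ^ 2 := by
    field_simp
  linarith

/-- An affine minorant of `u` makes the penalized function coercive, so a minimizer `y` exists; its
first-order condition is the claim with `g = -y / a`. -/
theorem exists_infConv_slope (hu : IsConvexSmooth c u) (ha : 0 < a) (x : E) :
    ∃ g, gradient u (x - a • g) = g := by
  have hcont : Continuous fun y => u (x + y) + 1 / (2 * a) * ‖y‖ ^ 2 := by
    have := hu.continuous
    fun_prop
  have hcoer : Tendsto (fun y => u (x + y) + 1 / (2 * a) * ‖y‖ ^ 2) (cocompact E) atTop := by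
    have h1 : Tendsto (fun r : ℝ => u x + r * (1 / (2 * a) * r - ‖gradient u x‖)) atTop atTop := by
      refine tendsto_atTop_add_const_left _ _ (tendsto_id.atTop_mul_atTop₀ ?_)
      exact tendsto_atTop_add_const_right _ _ (tendsto_id.const_mul_atTop (by positivity))
    refine tendsto_atTop_mono (fun y => ?_) (h1.comp (tendsto_norm_cocompact_atTop (E := E)))
    have h2 := hu.le_add x y
    have h3 := neg_le_of_abs_le (abs_real_inner_le_norm (gradient u x) y)
    simp only [Function.comp_apply]
    nlinarith
  obtain ⟨y, hy⟩ := hcont.exists_forall_le hcoer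
  set z := gradient u (x + y) + (1 / a) • y with hz
  have hz0 : z = 0 := by
    -- Moving from the minimizer along `-s • z` gains `s * ‖z‖ ^ 2` to first order, so minimality
    -- bounds `‖z‖ ^ 2` by a multiple of `s`.
    refine eq_zero_of_sq_le_mul (K := (c / 2 + 1 / (2 * a)) * ‖z‖ ^ 2) fun s hs => ?_
    have h1 := hy (y + (-s) • z)
    have h2 := hu.add_le (x + y) ((-s) • z)
    rw [← add_assoc, norm_add_sq_expand] at h1
    have h3 : inner ℝ (gradient u (x + y)) z + 1 / a * inner ℝ y z = ‖z‖ ^ 2 := by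
      rw [← real_inner_smul_left, ← inner_add_left, ← hz, real_inner_self_eq_norm_sq]
    rw [real_inner_smul_right, norm_smul, mul_pow, Real.norm_eq_abs, sq_abs, neg_sq] at h1 h2
    have h4 : 1 / (2 * a) * (‖y‖ ^ 2 + 2 * (-s * inner ℝ y z) + s ^ 2 * ‖z‖ ^ 2) =
        1 / (2 * a) * ‖y‖ ^ 2 - s * (1 / a * inner ℝ y z) + 1 / (2 * a) * (s ^ 2 * ‖z‖ ^ 2) := by
      field_simp
      ring
    have h5 : s * ‖z‖ ^ 2 ≤ s * ((c / 2 + 1 / (2 * a)) * ‖z‖ ^ 2 * s) := by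
      rw [h4] at h1
      have h6 : s * (inner ℝ (gradient u (x + y)) z + 1 / a * inner ℝ y z) = s * ‖z‖ ^ 2 := by
        rw [h3]
      linarith
    exact le_of_mul_le_mul_left h5 hs
  refine ⟨-((1 / a) • y), ?_⟩
  have e : a • -((1 / a) • y) = -y := by
    rw [smul_neg, smul_smul, mul_one_div_cancel ha.ne', one_smul]
  rw [e, sub_neg_eq_add]
  exact eq_neg_of_add_eq_zero_left hz0

theorem infConv_eq_of_slope (hu : IsConvexSmooth c u) (ha : 0 < a) {x g : E}
    (hg : gradient u (x - a • g) = g) : infConv a u x = u (x - a • g) + a / 2 * ‖g‖ ^ 2 := by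
  refine le_antisymm ?_ (le_ciInf fun y => hu.infConv_bound ha hg y)
  refine (ciInf_le ⟨_, forall_mem_range.2 (hu.infConv_bound ha hg)⟩ (-(a • g))).trans_eq ?_
  rw [← sub_eq_add_neg, norm_neg, norm_smul, mul_pow, Real.norm_eq_abs, sq_abs]
  field_simp

theorem bddBelow_infConv (hu : IsConvexSmooth c u) (ha : 0 < a) (x : E) :
    BddBelow (range fun y => u (x + y) + 1 / (2 * a) * ‖y‖ ^ 2) := by
  obtain ⟨g, hg⟩ := hu.exists_infConv_slope ha x
  exact ⟨_, forall_mem_range.2 (hu.infConv_bound ha hg)⟩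

theorem infConv_le (hu : IsConvexSmooth c u) (ha : 0 < a) (x y : E) :
    infConv a u x ≤ u (x + y) + 1 / (2 * a) * ‖y‖ ^ 2 :=
  ciInf_le (hu.bddBelow_infConv ha x) y

/-- The lower bound uses the tangent of `u` at `x - a • g` and completes a square. The upper bound
keeps the minimizer of `x` as competitor at `x + h`, so only the smoothness of `u` enters and the
constant `c` does not deteriorate. -/
theorem isSlope_infConv (hu : IsConvexSmooth c u) (ha : 0 < a) {x g : E}
    (hg : gradient u (x - a • g) = g) : IsSlope c (infConv a u) x g := by
  intro h
  rw [hu.infConv_eq_of_slope ha hg]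
  constructor
  · suffices u (x - a • g) + a / 2 * ‖g‖ ^ 2 + inner ℝ g h ≤ infConv a u (x + h) by linarith
    refine le_ciInf fun y => ?_
    have h1 := hu.le_add (x - a • g) (a • g + h + y)
    rw [hg, show x - a • g + (a • g + h + y) = x + h + y by abel, inner_add_right,
      inner_add_right, real_inner_smul_right, real_inner_self_eq_norm_sq] at h1
    have h2 : 0 ≤ 1 / (2 * a) * ‖a • g + y‖ ^ 2 := by positivity
    rw [norm_add_sq_expand, norm_smul, mul_pow, Real.norm_eq_abs, sq_abs,
      real_inner_smul_left] at h2
    have h3 : 1 / (2 * a) * (a ^ 2 * ‖g‖ ^ 2 + 2 * (a * inner ℝ g y) + ‖y‖ ^ 2) =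
        a / 2 * ‖g‖ ^ 2 + inner ℝ g y + 1 / (2 * a) * ‖y‖ ^ 2 := by
      field_simp
    linarith
  · have h1 := hu.infConv_le ha (x + h) (-(a • g))
    have h2 := hu.add_le (x - a • g) h
    rw [norm_neg, norm_smul, mul_pow, Real.norm_eq_abs, sq_abs,
      show x + h + -(a • g) = x - a • g + h by abel] at h1
    rw [hg] at h2
    have h3 : 1 / (2 * a) * (a ^ 2 * ‖g‖ ^ 2) = a / 2 * ‖g‖ ^ 2 := by field_simp
    linarith

theorem infConv (hu : IsConvexSmooth c u) (ha : 0 < a) : IsConvexSmooth c (infConv a u) :=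
  isConvexSmooth_of_exists_slope fun x =>
    (hu.exists_infConv_slope ha x).imp fun _ hg => hu.isSlope_infConv ha hg

theorem gradient_infConv (hu : IsConvexSmooth c u) (ha : 0 < a) (x : E) :
    gradient u (x - a • gradient (_root_.infConv a u) x) = gradient (_root_.infConv a u) x := by
  obtain ⟨g, hg⟩ := hu.exists_infConv_slope ha x
  rw [(hu.isSlope_infConv ha hg).gradient_eq, hg]

theorem infConv_eq (hu : IsConvexSmooth c u) (ha : 0 < a) (x : E) :
    _root_.infConv a u x = u (x - a • gradient (_root_.infConv a u) x) +
      a / 2 * ‖gradient (_root_.infConv a u) x‖ ^ 2 :=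
  hu.infConv_eq_of_slope ha (hu.gradient_infConv ha x)

theorem infConv_mono (hu : IsConvexSmooth c u) (hv : IsConvexSmooth c v) (ha : 0 < a) {ε : ℝ}
    (huv : ∀ x, u x ≤ v x + ε) (x : E) :
    _root_.infConv a u x ≤ _root_.infConv a v x + ε := by
  set g := gradient (_root_.infConv a v) x with hg
  have h1 := hu.infConv_le ha x (-(a • g))
  have h2 := huv (x - a • g)
  rw [norm_neg, norm_smul, mul_pow, Real.norm_eq_abs, sq_abs, ← sub_eq_add_neg] at h1
  rw [hv.infConv_eq ha x, ← hg]
  have h3 : 1 / (2 * a) * (a ^ 2 * ‖g‖ ^ 2) = a / 2 * ‖g‖ ^ 2 := by field_simp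
  linarith

/-- The slope `g` optimal for time `a + b` solves the fixed point equation at both intermediate
stages: the minimizing path is a straight line. -/
theorem infConv_infConv (hu : IsConvexSmooth c u) {b : ℝ} (ha : 0 < a) (hb : 0 < b) :
    _root_.infConv a (_root_.infConv b u) = _root_.infConv (a + b) u := by
  funext x
  have hab : 0 < a + b := by positivity
  obtain ⟨g, hg⟩ := hu.exists_infConv_slope hab x
  have hg' : gradient u (x - a • g - b • g) = g := by
    rw [sub_sub, ← add_smul, hg]
  have h1 : gradient (_root_.infConv b u) (x - a • g) = g := (hu.isSlope_infConv hb hg').gradient_eq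
  rw [(hu.infConv hb).infConv_eq_of_slope ha h1, hu.infConv_eq_of_slope hb hg',
    hu.infConv_eq_of_slope hab hg, sub_sub, ← add_smul]
  ring

end IsConvexSmooth

end HopfLax

/-! ### Isotropic Gaussian measures -/

section Gaussian

variable {E : Type*} [NormedAddCommGroup E] [InnerProductSpace ℝ E] [FiniteDimensional ℝ E]
  [MeasurableSpace E] [BorelSpace E]

/-- The centered Gaussian measure on `E` with covariance `s • 1`. -/
noncomputable def isoGaussian (s : ℝ) : Measure E :=
  (∫⁻ x : E, ENNReal.ofReal (Real.exp (-(‖x‖ ^ 2 / (2 * s)))))⁻¹ •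
    (volume : Measure E).withDensity fun x => ENNReal.ofReal (Real.exp (-(‖x‖ ^ 2 / (2 * s))))

/-- The normalization constant of `isoGaussian`. -/
noncomputable def gaussConst (E : Type*) [NormedAddCommGroup E] [InnerProductSpace ℝ E]
    [FiniteDimensional ℝ E] [MeasurableSpace E] [BorelSpace E] (s : ℝ) : ℝ :=
  ∫ x : E, Real.exp (-(‖x‖ ^ 2 / (2 * s)))

theorem integrable_exp_neg_sq_add_inner {b : ℝ} (hb : 0 < b) (w : E) :
    Integrable fun y : E => Real.exp (-b * ‖y‖ ^ 2 + inner ℝ w y) := by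
  have h := (GaussianFourier.integrable_cexp_neg_mul_sq_norm_add (V := E) (b := (b : ℂ))
    (by simpa using hb) 1 w).re
  refine h.congr (Eventually.of_forall fun y => ?_)
  have : (-(b : ℂ) * (‖y‖ : ℂ) ^ 2 + 1 * ((inner ℝ w y : ℝ) : ℂ)) =
      ((-b * ‖y‖ ^ 2 + inner ℝ w y : ℝ) : ℂ) := by push_cast; ring
  simp only [this]
  rw [← Complex.ofReal_exp]
  exact Complex.ofReal_re _

theorem integrable_gaussDensity {s : ℝ} (hs : 0 < s) :
    Integrable fun x : E => Real.exp (-(‖x‖ ^ 2 / (2 * s))) := by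
  have := integrable_exp_neg_sq_add_inner (E := E) (b := 1 / (2 * s)) (by positivity) 0
  refine this.congr (Eventually.of_forall fun y => ?_)
  simp only [inner_zero_left, add_zero]
  congr 1
  ring

theorem gaussConst_pos {s : ℝ} (hs : 0 < s) : 0 < gaussConst E s :=
  integral_exp_pos (integrable_gaussDensity hs)

theorem isoGaussian_eq {s : ℝ} (hs : 0 < s) :
    (isoGaussian s : Measure E) = ENNReal.ofReal (gaussConst E s)⁻¹ •
      (volume : Measure E).withDensity
        fun x => ENNReal.ofReal (Real.exp (-(‖x‖ ^ 2 / (2 * s)))) := by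
  rw [isoGaussian, ENNReal.ofReal_inv_of_pos (gaussConst_pos hs), gaussConst,
    ofReal_integral_eq_lintegral_ofReal (integrable_gaussDensity hs)
      (Eventually.of_forall fun _ => (Real.exp_pos _).le)]

theorem measurable_gaussDensity (s : ℝ) :
    Measurable fun x : E => ENNReal.ofReal (Real.exp (-(‖x‖ ^ 2 / (2 * s)))) := by
  fun_prop

theorem isProbabilityMeasure_isoGaussian {s : ℝ} (hs : 0 < s) :
    IsProbabilityMeasure (isoGaussian s : Measure E) := by
  constructor
  rw [isoGaussian_eq hs, Measure.smul_apply, withDensity_apply _ MeasurableSet.univ,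
    Measure.restrict_univ, ← ofReal_integral_eq_lintegral_ofReal (integrable_gaussDensity hs)
      (Eventually.of_forall fun _ => (Real.exp_pos _).le), smul_eq_mul,
    ← ENNReal.ofReal_mul (inv_nonneg.2 (gaussConst_pos hs).le)]
  change ENNReal.ofReal ((gaussConst E s)⁻¹ * gaussConst E s) = 1
  rw [inv_mul_cancel₀ (gaussConst_pos hs).ne', ENNReal.ofReal_one]

/-! ### Integration by parts for isotropic Gaussians. -/

section Integral

variable {F : Type*} [NormedAddCommGroup F] [NormedSpace ℝ F]

theorem integrable_isoGaussian_iff {s : ℝ} (hs : 0 < s) {f : E → F} :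
    Integrable f (isoGaussian s) ↔
      Integrable fun x => Real.exp (-(‖x‖ ^ 2 / (2 * s))) • f x := by
  rw [isoGaussian_eq hs, integrable_smul_measure
    (by simpa using gaussConst_pos hs) ENNReal.ofReal_ne_top,
    integrable_withDensity_iff_integrable_smul' (measurable_gaussDensity s) (by simp)]
  simp only [ENNReal.toReal_ofReal (Real.exp_pos _).le]

theorem integral_isoGaussian {s : ℝ} (hs : 0 < s) (f : E → F) :
    ∫ x, f x ∂(isoGaussian s) =
      (gaussConst E s)⁻¹ • ∫ x, Real.exp (-(‖x‖ ^ 2 / (2 * s))) • f x := by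
  rw [isoGaussian_eq hs, integral_smul_measure,
    integral_withDensity_eq_integral_toReal_smul (measurable_gaussDensity s) (by simp)]
  simp only [ENNReal.toReal_ofReal (Real.exp_pos _).le,
    ENNReal.toReal_ofReal (inv_nonneg.2 (gaussConst_pos hs).le)]

/-- The line derivative of the Gaussian density is `-(inner ℝ v y) / s` times the density. A general
target `F` covers both the scalar moments here and the complex matrix entries later. -/
theorem isoGaussian_integral_by_parts {s : ℝ} (hs : 0 < s) (v : E) {g g' : E → F}
    (hg : ∀ y, HasLineDerivAt ℝ g (g' y) y v) (hgi : Integrable g (isoGaussian s))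
    (hgi' : Integrable g' (isoGaussian s))
    (hvg : Integrable (fun y => (inner ℝ v y : ℝ) • g y) (isoGaussian s)) :
    ∫ y, (inner ℝ v y : ℝ) • g y ∂(isoGaussian s) = s • ∫ y, g' y ∂(isoGaussian s) := by
  have hd : ∀ y : E, HasLineDerivAt ℝ (fun y : E => Real.exp (-(‖y‖ ^ 2 / (2 * s))))
      (-(1 / s * (Real.exp (-(‖y‖ ^ 2 / (2 * s))) * inner ℝ v y))) y v := fun y => by
    have h1 : HasDerivAt (fun t : ℝ => -(‖y + t • v‖ ^ 2 / (2 * s)))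
        (-(inner ℝ v y / s)) 0 := by
      have h2 : (fun t : ℝ => -(‖y + t • v‖ ^ 2 / (2 * s))) = fun t : ℝ =>
          -((‖y‖ ^ 2 + t * (2 * inner ℝ v y) + t ^ 2 * ‖v‖ ^ 2) / (2 * s)) := by
        funext t
        rw [norm_add_sq_expand, norm_smul, mul_pow, Real.norm_eq_abs, sq_abs,
          real_inner_smul_right, real_inner_comm]
        ring
      rw [h2]
      have h3 := ((((hasDerivAt_id (0 : ℝ)).mul_const (2 * inner ℝ v y)).const_add (‖y‖ ^ 2)).add
        (((hasDerivAt_id (0 : ℝ)).pow 2).mul_const (‖v‖ ^ 2))).div_const (2 * s) |>.neg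
      refine h3.congr_deriv ?_
      simp
      field_simp
    have := h1.exp
    rw [HasLineDerivAt]
    refine this.congr_deriv ?_
    simp only [zero_smul, add_zero]
    ring
  have hgi1 := (integrable_isoGaussian_iff hs).1 hgi
  have hgi2 := (integrable_isoGaussian_iff hs).1 hgi'
  have hgi3 := (integrable_isoGaussian_iff hs).1 hvg
  have key := integral_bilinear_hasLineDerivAt_right_eq_neg_left_of_integrable (μ := volume)
    (B := ContinuousLinearMap.lsmul ℝ ℝ (E := F)) (v := v)
    (f := fun y : E => Real.exp (-(‖y‖ ^ 2 / (2 * s))))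
    (f' := fun y : E => -(1 / s * (Real.exp (-(‖y‖ ^ 2 / (2 * s))) * inner ℝ v y)))
    (g := g) (g' := g')
    (by
      refine (hgi3.smul (-(1 / s))).congr (Eventually.of_forall fun y => ?_)
      simp [smul_smul])
    (by simpa using hgi2) (by simpa using hgi1) (fun y _ => hd y) (fun y _ => hg y)
  simp only [ContinuousLinearMap.lsmul_apply, neg_smul, integral_neg, neg_neg] at key
  rw [integral_isoGaussian hs, integral_isoGaussian hs, key, smul_comm]
  congr 1
  rw [← integral_smul]
  congr 1
  funext y
  rw [smul_smul, smul_smul]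
  congr 1
  field_simp

end Integral

theorem integrable_exp_mul_norm_isoGaussian {s : ℝ} (hs : 0 < s) (r : ℝ) :
    Integrable (fun y : E => Real.exp (r * ‖y‖)) (isoGaussian s) := by
  rw [integrable_isoGaussian_iff hs]
  have h1 := (integrable_exp_neg_sq_add_inner (E := E) (b := 1 / (4 * s))
    (by positivity) 0).const_mul (Real.exp (r ^ 2 * s))
  refine h1.mono' (by fun_prop) (Eventually.of_forall fun y => ?_)
  rw [smul_eq_mul, ← Real.exp_add, ← Real.exp_add, Real.norm_eq_abs, Real.abs_exp,
    Real.exp_le_exp, inner_zero_left]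
  have : 0 ≤ (r * (2 * s) - ‖y‖) ^ 2 / (4 * s) := by positivity
  have e : (r * (2 * s) - ‖y‖) ^ 2 / (4 * s) =
    r ^ 2 * s - r * ‖y‖ + ‖y‖ ^ 2 / (4 * s) := by field_simp; ring
  have e2 : ‖y‖ ^ 2 / (2 * s) = 2 * (‖y‖ ^ 2 / (4 * s)) := by field_simp; ring
  have e3 : -(1 / (4 * s)) * ‖y‖ ^ 2 = -(‖y‖ ^ 2 / (4 * s)) := by ring
  linarith

theorem integrable_pow_isoGaussian {s : ℝ} (hs : 0 < s) (n : ℕ) :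
    Integrable (fun y : E => (1 + ‖y‖) ^ n) (isoGaussian s) := by
  have h1 := (integrable_exp_mul_norm_isoGaussian (E := E) hs 1).const_mul
    (n.factorial * Real.exp 1)
  refine h1.mono' (by fun_prop) (Eventually.of_forall fun y => ?_)
  have h2 := Real.pow_div_factorial_le_exp (x := 1 + ‖y‖) (by positivity) n
  rw [div_le_iff₀ (by positivity), Real.exp_add] at h2
  rw [Real.norm_eq_abs, abs_of_nonneg (by positivity), one_mul]
  linarith

theorem integrable_of_pow_bound {F : Type*} [NormedAddCommGroup F] {s : ℝ} (hs : 0 < s)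
    {f : E → F} (hf : AEStronglyMeasurable f (isoGaussian s)) (K : ℝ) (n : ℕ)
    (hK : ∀ y, ‖f y‖ ≤ K * (1 + ‖y‖) ^ n) : Integrable f (isoGaussian s) :=
  ((integrable_pow_isoGaussian hs n).const_mul K).mono' hf (Eventually.of_forall hK)

theorem integral_inner_isoGaussian {s : ℝ} (hs : 0 < s) (v : E) :
    ∫ y, (inner ℝ v y : ℝ) ∂(isoGaussian s) = 0 := by
  have := isProbabilityMeasure_isoGaussian (E := E) hs
  have h := isoGaussian_integral_by_parts hs v (g := fun _ : E => (1 : ℝ)) (g' := fun _ => 0)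
    (fun y => hasDerivAt_const _ _) (integrable_const _) (integrable_const _) (by
      refine integrable_of_pow_bound hs (by fun_prop) ‖v‖ 1 fun y => ?_
      rw [smul_eq_mul, mul_one]
      refine (norm_inner_le_norm _ _).trans ?_
      nlinarith [norm_nonneg v, norm_nonneg y])
  simpa using h

theorem integrable_inner_isoGaussian {s : ℝ} (hs : 0 < s) (v : E) :
    Integrable (fun y : E => (inner ℝ v y : ℝ)) (isoGaussian s) := by
  refine integrable_of_pow_bound hs (by fun_prop) ‖v‖ 1 fun y => ?_
  refine (norm_inner_le_norm _ _).trans ?_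
  nlinarith [norm_nonneg v, norm_nonneg y]

theorem integrable_norm_pow_isoGaussian {s : ℝ} (hs : 0 < s) (n : ℕ) :
    Integrable (fun y : E => ‖y‖ ^ n) (isoGaussian s) := by
  refine integrable_of_pow_bound hs (by fun_prop) 1 n fun y => ?_
  rw [norm_pow, norm_norm, one_mul]
  gcongr
  linarith

theorem hasLineDerivAt_norm_sq_mul_inner (v y : E) :
    HasLineDerivAt ℝ (fun y : E => ‖y‖ ^ 2 * (inner ℝ v y : ℝ))
      (2 * (inner ℝ v y : ℝ) ^ 2 + ‖v‖ ^ 2 * ‖y‖ ^ 2) y v := by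
  have h2 : (fun t : ℝ => ‖y + t • v‖ ^ 2 * (inner ℝ v (y + t • v) : ℝ)) = fun t : ℝ =>
      (‖y‖ ^ 2 + t * (2 * inner ℝ v y) + t ^ 2 * ‖v‖ ^ 2) * (inner ℝ v y + t * ‖v‖ ^ 2) := by
    funext t
    rw [norm_add_sq_expand, norm_smul, mul_pow, Real.norm_eq_abs, sq_abs,
      real_inner_smul_right, real_inner_comm, inner_add_right, real_inner_smul_right,
      real_inner_self_eq_norm_sq]
    ring
  rw [HasLineDerivAt, h2]
  generalize (inner ℝ v y : ℝ) = p
  generalize ‖v‖ = q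
  generalize ‖y‖ = r
  have h3 := ((((hasDerivAt_id (0 : ℝ)).mul_const (2 * p)).const_add (r ^ 2)).add
    (((hasDerivAt_id (0 : ℝ)).pow 2).mul_const (q ^ 2))).mul
    (((hasDerivAt_id (0 : ℝ)).mul_const (q ^ 2)).const_add p)
  refine h3.congr_deriv ?_
  simp
  ring

theorem integrable_inner_pow_isoGaussian {s : ℝ} (hs : 0 < s) (v : E) (k n : ℕ) :
    Integrable (fun y : E => ‖y‖ ^ k * (inner ℝ v y : ℝ) ^ n) (isoGaussian s) := by
  refine integrable_of_pow_bound hs (by fun_prop) (‖v‖ ^ n) (k + n) fun y => ?_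
  rw [norm_mul, norm_pow, norm_pow, norm_norm, Real.norm_eq_abs]
  have h := abs_real_inner_le_norm v y
  calc ‖y‖ ^ k * |(inner ℝ v y : ℝ)| ^ n ≤ ‖y‖ ^ k * (‖v‖ * ‖y‖) ^ n := by gcongr
    _ = ‖v‖ ^ n * ‖y‖ ^ (k + n) := by ring
    _ ≤ _ := by gcongr; linarith

theorem integral_norm_pow_mul_inner_sq {s : ℝ} (hs : 0 < s) (v : E) :
    ∫ y, ‖y‖ ^ 2 * (inner ℝ v y : ℝ) ^ 2 ∂(isoGaussian s) =
      s * (2 * ∫ y, (inner ℝ v y : ℝ) ^ 2 ∂(isoGaussian s) +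
        ‖v‖ ^ 2 * ∫ y, ‖y‖ ^ 2 ∂(isoGaussian (E := E) s)) := by
  have i1 : Integrable (fun y : E => (inner ℝ v y : ℝ) ^ 2) (isoGaussian s) := by
    simpa using integrable_inner_pow_isoGaussian hs v 0 2
  have i2 : Integrable (fun y : E => ‖y‖ ^ 2 * (inner ℝ v y : ℝ)) (isoGaussian s) := by
    simpa using integrable_inner_pow_isoGaussian hs v 2 1
  have i3 : Integrable (fun y : E => (inner ℝ v y : ℝ) • (‖y‖ ^ 2 * (inner ℝ v y : ℝ)))
      (isoGaussian s) := by
    refine (integrable_inner_pow_isoGaussian hs v 2 2).congr (Eventually.of_forall fun y => ?_)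
    simp only [smul_eq_mul]
    ring
  have i4 := integrable_norm_pow_isoGaussian (E := E) hs 2
  have h := isoGaussian_integral_by_parts hs v (hasLineDerivAt_norm_sq_mul_inner v) i2
    ((i1.const_mul 2).add (i4.const_mul _)) i3
  rw [integral_add (i1.const_mul 2) (i4.const_mul _),
    integral_const_mul, integral_const_mul, smul_eq_mul] at h
  rw [← h]
  congr 1
  funext y
  rw [smul_eq_mul]
  ring

theorem integral_inner_sq_isoGaussian {s : ℝ} (hs : 0 < s) (v : E) :
    ∫ y, (inner ℝ v y : ℝ) ^ 2 ∂(isoGaussian s) = s * ‖v‖ ^ 2 := by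
  have := isProbabilityMeasure_isoGaussian (E := E) hs
  have hin : ∀ y : E, |(inner ℝ v y : ℝ)| ≤ ‖v‖ * ‖y‖ := fun y => abs_real_inner_le_norm v y
  have h := isoGaussian_integral_by_parts hs v (g := fun y : E => (inner ℝ v y : ℝ))
    (g' := fun y => ‖v‖ ^ 2)
    (fun y => by
      have h2 : (fun t : ℝ => (inner ℝ v (y + t • v) : ℝ)) = fun t : ℝ =>
          (inner ℝ v y + t * ‖v‖ ^ 2) := by
        funext t
        rw [inner_add_right, real_inner_smul_right, real_inner_self_eq_norm_sq]
      rw [HasLineDerivAt, h2]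
      have h3 := ((hasDerivAt_id (0 : ℝ)).mul_const (‖v‖ ^ 2)).const_add (inner ℝ v y : ℝ)
      refine h3.congr_deriv ?_
      simp)
    (integrable_inner_isoGaussian hs v) (integrable_const _)
    (by
      refine integrable_of_pow_bound hs (by fun_prop) (‖v‖ ^ 2) 2 fun y => ?_
      rw [norm_smul, Real.norm_eq_abs]
      calc |(inner ℝ v y : ℝ)| * |(inner ℝ v y : ℝ)|
          ≤ (‖v‖ * ‖y‖) * (‖v‖ * ‖y‖) := by gcongr <;> exact hin y
        _ = ‖v‖ ^ 2 * ‖y‖ ^ 2 := by ring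
        _ ≤ _ := by gcongr; linarith)
  rw [integral_const, probReal_univ, one_smul, smul_eq_mul] at h
  rw [← h]
  congr 1
  funext y
  rw [smul_eq_mul, sq]

theorem integral_norm_sq_isoGaussian {s : ℝ} (hs : 0 < s) :
    ∫ y, ‖y‖ ^ 2 ∂(isoGaussian (E := E) s) = s * Module.finrank ℝ E := by
  let e := stdOrthonormalBasis ℝ E
  have h1 : ∀ y : E, ‖y‖ ^ 2 = ∑ i, (inner ℝ (e i) y : ℝ) ^ 2 := fun y => by
    rw [← e.sum_sq_norm_inner_right y]
    simp
  simp_rw [h1]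
  rw [integral_finsetSum]
  · simp_rw [integral_inner_sq_isoGaussian hs, e.norm_eq_one]
    simp [mul_comm]
  · intro i _
    refine integrable_of_pow_bound hs (by fun_prop) 1 2 fun y => ?_
    rw [norm_pow, Real.norm_eq_abs, one_mul]
    gcongr
    refine (abs_real_inner_le_norm _ _).trans ?_
    rw [e.norm_eq_one, one_mul]
    linarith

/-- Integration by parts, one coordinate at a time. The square of the dimension appearing here is
why the local comparison with `logLaplace` is not uniform in `N`. -/
theorem integral_norm_pow_four_isoGaussian {s : ℝ} (hs : 0 < s) :
    ∫ y, ‖y‖ ^ 4 ∂(isoGaussian (E := E) s) =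
      s ^ 2 * (Module.finrank ℝ E * (Module.finrank ℝ E + 2)) := by
  let e := stdOrthonormalBasis ℝ E
  have h1 : ∀ y : E, ‖y‖ ^ 4 = ∑ i, ‖y‖ ^ 2 * (inner ℝ (e i) y : ℝ) ^ 2 := fun y => by
    rw [← Finset.mul_sum, show ∑ i, (inner ℝ (e i) y : ℝ) ^ 2 = ‖y‖ ^ 2 by
      rw [← e.sum_sq_norm_inner_right y]
      simp]
    ring
  simp_rw [h1]
  rw [integral_finsetSum]
  · simp_rw [integral_norm_pow_mul_inner_sq hs, integral_inner_sq_isoGaussian hs,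
      integral_norm_sq_isoGaussian hs, e.norm_eq_one]
    simp
    ring
  · intro i _
    refine integrable_of_pow_bound hs (by fun_prop) 1 4 fun y => ?_
    have h2 : |(inner ℝ (e i) y : ℝ)| ≤ ‖y‖ := by
      refine (abs_real_inner_le_norm _ _).trans ?_
      rw [e.norm_eq_one, one_mul]
    rw [norm_mul, norm_pow, norm_pow, norm_norm, Real.norm_eq_abs, one_mul]
    calc ‖y‖ ^ 2 * |(inner ℝ (e i) y : ℝ)| ^ 2 ≤ ‖y‖ ^ 2 * ‖y‖ ^ 2 := by gcongr
      _ = ‖y‖ ^ 4 := by ring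
      _ ≤ _ := by gcongr; linarith

theorem integral_exp_inner_isoGaussian {s : ℝ} (hs : 0 < s) (w : E) :
    ∫ y, Real.exp (inner ℝ w y) ∂(isoGaussian s) = Real.exp (s / 2 * ‖w‖ ^ 2) := by
  have hb : 0 < 1 / (2 * s) := by positivity
  have hval : ∀ w : E, (∫ y : E, Real.exp (-(1 / (2 * s)) * ‖y‖ ^ 2 + inner ℝ w y)) =
      gaussConst E s * Real.exp (s / 2 * ‖w‖ ^ 2) := by
    intro w
    have h1 := fun w : E => GaussianFourier.integral_cexp_neg_mul_sq_norm_add (V := E)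
      (b := ((1 / (2 * s) : ℝ) : ℂ)) (by simpa using hb) 1 w
    have h2 : ∀ w : E, (((∫ y : E, Real.exp (-(1 / (2 * s)) * ‖y‖ ^ 2 + inner ℝ w y) : ℝ)) : ℂ) =
        ∫ y : E, Complex.exp (-((1 / (2 * s) : ℝ) : ℂ) * (‖y‖ : ℂ) ^ 2 +
          1 * ((inner ℝ w y : ℝ) : ℂ)) := fun w => by
      rw [← integral_complex_ofReal]
      congr 1
      funext y
      push_cast
      simp
    have h3 : gaussConst E s = ∫ y : E, Real.exp (-(1 / (2 * s)) * ‖y‖ ^ 2 + inner ℝ (0 : E) y) := by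
      rw [gaussConst]
      congr 1
      funext y
      rw [inner_zero_left, add_zero]
      congr 1
      ring
    rw [← Complex.ofReal_inj, h3, Complex.ofReal_mul, h2, h2, h1, h1]
    simp only [norm_zero, Complex.ofReal_zero]
    have h4 : (1 : ℂ) ^ 2 * (‖w‖ : ℂ) ^ 2 / (4 * ((1 / (2 * s) : ℝ) : ℂ)) =
        ((s / 2 * ‖w‖ ^ 2 : ℝ) : ℂ) := by
      have : (s : ℂ) ≠ 0 := by exact_mod_cast hs.ne'
      push_cast
      field_simp
      ring
    rw [h4, Complex.ofReal_exp]
    simp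
  rw [integral_isoGaussian hs]
  have h5 : (fun y : E => Real.exp (-(‖y‖ ^ 2 / (2 * s))) • Real.exp (inner ℝ w y)) =
      fun y => Real.exp (-(1 / (2 * s)) * ‖y‖ ^ 2 + inner ℝ w y) := by
    funext y
    rw [smul_eq_mul, ← Real.exp_add]
    congr 1
    ring
  rw [h5, hval, smul_eq_mul, inv_mul_cancel_left₀ (gaussConst_pos hs).ne']

theorem charFun_isoGaussian {s : ℝ} (hs : 0 < s) (w : E) :
    charFun (isoGaussian s) w = Complex.exp (-(s / 2 * ‖w‖ ^ 2 : ℝ)) := by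
  have hb : 0 < 1 / (2 * s) := by positivity
  have h1 := fun c : ℂ => GaussianFourier.integral_cexp_neg_mul_sq_norm_add (V := E)
    (b := ((1 / (2 * s) : ℝ) : ℂ)) (by simpa using hb) c w
  have h3 : ((gaussConst E s : ℝ) : ℂ) = ∫ y : E, Complex.exp
      (-((1 / (2 * s) : ℝ) : ℂ) * (‖y‖ : ℂ) ^ 2 + 0 * ((inner ℝ w y : ℝ) : ℂ)) := by
    rw [gaussConst, ← integral_complex_ofReal]
    congr 1
    funext y
    push_cast
    congr 1
    ring
  have hne : ((gaussConst E s : ℝ) : ℂ) ≠ 0 := by exact_mod_cast (gaussConst_pos hs).ne'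
  have h5 : (fun y : E => Real.exp (-(‖y‖ ^ 2 / (2 * s))) •
      Complex.exp ((inner ℝ y w : ℝ) * Complex.I)) =
      fun y => Complex.exp (-((1 / (2 * s) : ℝ) : ℂ) * (‖y‖ : ℂ) ^ 2 +
        Complex.I * ((inner ℝ w y : ℝ) : ℂ)) := by
    funext y
    rw [Complex.real_smul, Complex.ofReal_exp, ← Complex.exp_add, real_inner_comm]
    congr 1
    push_cast
    ring
  rw [charFun_apply, integral_isoGaussian hs, h5, h1, Complex.real_smul, Complex.ofReal_inv,
    inv_mul_eq_iff_eq_mul₀ hne, h3, h1]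
  have h4 : (Complex.I) ^ 2 * (‖w‖ : ℂ) ^ 2 / (4 * ((1 / (2 * s) : ℝ) : ℂ)) =
      ((-(s / 2 * ‖w‖ ^ 2) : ℝ) : ℂ) := by
    have : (s : ℂ) ≠ 0 := by exact_mod_cast hs.ne'
    push_cast
    rw [Complex.I_sq]
    field_simp
    ring
  rw [h4]
  simp

theorem isoGaussian_conv {s t : ℝ} (hs : 0 < s) (ht : 0 < t) :
    (isoGaussian s : Measure E).conv (isoGaussian t) = isoGaussian (s + t) := by
  have := isProbabilityMeasure_isoGaussian (E := E) hs
  have := isProbabilityMeasure_isoGaussian (E := E) ht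
  have := isProbabilityMeasure_isoGaussian (E := E) (add_pos hs ht)
  refine Measure.ext_of_charFun (funext fun w => ?_)
  rw [charFun_conv, charFun_isoGaussian hs, charFun_isoGaussian ht,
    charFun_isoGaussian (add_pos hs ht), ← Complex.exp_add]
  congr 1
  push_cast
  ring

theorem isoGaussian_map_smul {s : ℝ} (hs : 0 < s) :
    (isoGaussian 1 : Measure E).map (fun y => √s • y) = isoGaussian s := by
  have := isProbabilityMeasure_isoGaussian (E := E) hs
  have := isProbabilityMeasure_isoGaussian (E := E) one_pos
  have hm : Measurable fun y : E => √s • y := by fun_prop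
  have := Measure.isProbabilityMeasure_map (μ := (isoGaussian 1 : Measure E)) hm.aemeasurable
  refine Measure.ext_of_charFun (funext fun w => ?_)
  rw [charFun_map_smul, charFun_isoGaussian one_pos, charFun_isoGaussian hs, norm_smul, mul_pow,
    Real.norm_eq_abs, sq_abs, Real.sq_sqrt hs.le]
  congr 2
  push_cast
  ring

end Gaussian

/-! ### Gaussian averages of convex functions -/

section GaussAvg

variable {E : Type*} [NormedAddCommGroup E] [InnerProductSpace ℝ E] [FiniteDimensional ℝ E]
  [MeasurableSpace E] [BorelSpace E]

/-- The convolution of `u` with `isoGaussian s`. -/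
noncomputable def gaussAvg (s : ℝ) (u : E → ℝ) (x : E) : ℝ := ∫ y, u (x + y) ∂(isoGaussian s)

/-- The function `w` with `exp (-κ w) = exp (-κ u) * isoGaussian s`. -/
noncomputable def logLaplace (κ s : ℝ) (u : E → ℝ) (x : E) : ℝ :=
  -(1 / κ) * Real.log (∫ y, Real.exp (-(κ * u (x + y))) ∂(isoGaussian s))

/-- One step of the splitting scheme: the Hopf-Lax operator followed by a Gaussian average. -/
noncomputable def trotterStep (κ b : ℝ) (u : E → ℝ) : E → ℝ := gaussAvg b (infConv (κ * b) u)

namespace IsConvexSmooth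

variable {a b c s t κ : ℝ} {u v : E → ℝ}

section

variable [CompleteSpace E]

theorem abs_add_le (hu : IsConvexSmooth c u) (hc : 0 ≤ c) (x y : E) :
    |u (x + y)| ≤ (|u x| + ‖gradient u x‖ + c / 2) * (1 + ‖y‖) ^ 2 := by
  have h1 := hu.le_add x y
  have h2 := hu.add_le x y
  have h3 := abs_le.1 (abs_real_inner_le_norm (gradient u x) y)
  have h4 : |u (x + y)| ≤ |u x| + ‖gradient u x‖ * ‖y‖ + c / 2 * ‖y‖ ^ 2 := by
    have h5 : 0 ≤ c / 2 * ‖y‖ ^ 2 := by positivity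
    rw [abs_le]
    constructor <;> linarith [neg_abs_le (u x), le_abs_self (u x)]
  refine h4.trans ?_
  have hy := norm_nonneg y
  have e1 : |u x| * 1 ≤ |u x| * (1 + ‖y‖) ^ 2 := by gcongr; nlinarith
  have e2 : ‖gradient u x‖ * ‖y‖ ≤ ‖gradient u x‖ * (1 + ‖y‖) ^ 2 := by gcongr; nlinarith
  have e3 : c / 2 * ‖y‖ ^ 2 ≤ c / 2 * (1 + ‖y‖) ^ 2 := by gcongr; linarith
  linarith

theorem integrable_add (hu : IsConvexSmooth c u) (hc : 0 ≤ c) (hs : 0 < s) (x : E) :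
    Integrable (fun y => u (x + y)) (isoGaussian s) := by
  have := hu.continuous
  exact integrable_of_pow_bound hs (by fun_prop) _ 2 (hu.abs_add_le hc x)

theorem integrable_gradient_add (hu : IsConvexSmooth c u) (hc : 0 < c) (hs : 0 < s) (x : E) :
    Integrable (fun y => gradient u (x + y)) (isoGaussian s) := by
  have h1 : Continuous fun y => gradient u (x + y) :=
    (hu.continuous_gradient hc).comp (continuous_const.add continuous_id)
  refine integrable_of_pow_bound hs h1.aestronglyMeasurable (‖gradient u x‖ + c) 1 fun y => ?_
  have h2 := hu.gradient_lipschitz hc x (x + y)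
  rw [add_sub_cancel_left] at h2
  have h3 := norm_add_le (gradient u (x + y) - gradient u x) (gradient u x)
  rw [sub_add_cancel] at h3
  have h4 : 0 ≤ ‖gradient u x‖ * ‖y‖ := by positivity
  rw [pow_one]
  nlinarith

/-- Both slope inequalities are linear in the function and its gradient, so they can be averaged;
this also yields the formula for the gradient. -/
theorem isSlope_gaussAvg (hu : IsConvexSmooth c u) (hc : 0 < c) (hs : 0 < s) (x : E) :
    IsSlope c (gaussAvg s u) x (∫ y, gradient u (x + y) ∂(isoGaussian s)) := by
  have := isProbabilityMeasure_isoGaussian (E := E) hs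
  intro h
  have hi := hu.integrable_gradient_add hc hs x
  have hi2 : Integrable (fun y => (inner ℝ (gradient u (x + y)) h : ℝ)) (isoGaussian s) :=
    hi.inner_const h
  have e : inner ℝ (∫ y, gradient u (x + y) ∂(isoGaussian s)) h =
      ∫ y, (inner ℝ (gradient u (x + y)) h : ℝ) ∂(isoGaussian s) := by
    rw [real_inner_comm, ← integral_inner hi]
    simp_rw [real_inner_comm]
  have j1 := hu.integrable_add hc.le hs x
  have j2 := hu.integrable_add hc.le hs (x + h)
  rw [e, gaussAvg, gaussAvg, ← integral_sub j2 j1]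
  have hp := fun y => hu.isSlope_gradient (x + y) h
  simp_rw [show ∀ y, x + y + h = x + h + y from fun y => by abel] at hp
  constructor
  · exact integral_mono hi2 (j2.sub j1) fun y => (hp y).1
  · have := integral_mono (j2.sub j1) (hi2.add (integrable_const (c / 2 * ‖h‖ ^ 2)))
      fun y => (hp y).2
    refine this.trans_eq ?_
    simp only [Pi.add_apply]
    rw [integral_add hi2 (integrable_const _)]
    simp

theorem gaussAvg (hu : IsConvexSmooth c u) (hc : 0 < c) (hs : 0 < s) :
    IsConvexSmooth c (gaussAvg s u) :=
  isConvexSmooth_of_exists_slope fun x => ⟨_, hu.isSlope_gaussAvg hc hs x⟩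

theorem gradient_gaussAvg (hu : IsConvexSmooth c u) (hc : 0 < c) (hs : 0 < s) (x : E) :
    gradient (_root_.gaussAvg s u) x = ∫ y, gradient u (x + y) ∂(isoGaussian s) :=
  (hu.isSlope_gaussAvg hc hs x).gradient_eq

theorem gaussAvg_mono (hu : IsConvexSmooth c u) (hv : IsConvexSmooth c v) (hc : 0 ≤ c)
    (hs : 0 < s) {ε : ℝ} (huv : ∀ x, u x ≤ v x + ε) (x : E) :
    _root_.gaussAvg s u x ≤ _root_.gaussAvg s v x + ε := by
  have := isProbabilityMeasure_isoGaussian (E := E) hs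
  have j1 := hu.integrable_add hc hs x
  have j2 := hv.integrable_add hc hs x
  have := integral_mono j1 (j2.add (integrable_const ε)) fun y => huv (x + y)
  refine this.trans_eq ?_
  simp only [Pi.add_apply]
  rw [integral_add j2 (integrable_const _)]
  simp [_root_.gaussAvg]

theorem gaussAvg_gaussAvg (hu : IsConvexSmooth c u) (hc : 0 ≤ c) (hs : 0 < s) (ht : 0 < t) :
    _root_.gaussAvg s (_root_.gaussAvg t u) = _root_.gaussAvg (s + t) u := by
  have := isProbabilityMeasure_isoGaussian (E := E) hs
  have := isProbabilityMeasure_isoGaussian (E := E) ht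
  funext x
  have j := hu.integrable_add hc (add_pos hs ht) x
  rw [← isoGaussian_conv hs ht] at j
  simp only [_root_.gaussAvg]
  rw [← isoGaussian_conv hs ht, integral_conv j]
  simp only [add_assoc]

theorem trotterStep (hu : IsConvexSmooth c u) (hc : 0 < c) (hκ : 0 < κ) (hb : 0 < b) :
    IsConvexSmooth c (trotterStep κ b u) :=
  (hu.infConv (mul_pos hκ hb)).gaussAvg hc hb

theorem trotterStep_iterate (hu : IsConvexSmooth c u) (hc : 0 < c) (hκ : 0 < κ) (hb : 0 < b)
    (n : ℕ) : IsConvexSmooth c ((_root_.trotterStep κ b)^[n] u) := by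
  induction n with
  | zero => exact hu
  | succ n ih =>
    rw [Function.iterate_succ_apply']
    exact ih.trotterStep hc hκ hb

theorem trotterStep_mono (hu : IsConvexSmooth c u) (hv : IsConvexSmooth c v) (hc : 0 < c)
    (hκ : 0 < κ) (hb : 0 < b) {ε : ℝ} (huv : ∀ x, u x ≤ v x + ε) (x : E) :
    _root_.trotterStep κ b u x ≤ _root_.trotterStep κ b v x + ε :=
  (hu.infConv (mul_pos hκ hb)).gaussAvg_mono (hv.infConv (mul_pos hκ hb)) hc.le hb
    (hu.infConv_mono hv (mul_pos hκ hb) huv) x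

/-! ### Commutation of the two semigroups -/

/-- A single competitor `y` is used for all values of the noise. Optimizing over `y` gives the free
half of the commutation of the two semigroups. -/
theorem gaussAvg_infConv_le (hu : IsConvexSmooth c u) (hc : 0 < c) (ha : 0 < a) (hb : 0 < b)
    (x y : E) : _root_.gaussAvg b (_root_.infConv a u) x ≤
      _root_.gaussAvg b u (x + y) + 1 / (2 * a) * ‖y‖ ^ 2 := by
  have := isProbabilityMeasure_isoGaussian (E := E) hb
  have j1 := (hu.infConv ha).integrable_add hc.le hb x
  have j2 := hu.integrable_add hc.le hb (x + y)
  have := integral_mono j1 (j2.add (integrable_const (1 / (2 * a) * ‖y‖ ^ 2))) fun z => by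
    have := hu.infConv_le ha (x + z) y
    rw [show x + z + y = x + y + z by abel] at this
    exact this
  refine this.trans_eq ?_
  simp only [Pi.add_apply]
  rw [integral_add j2 (integrable_const _)]
  simp [_root_.gaussAvg]

/-- The penalized function has smoothness constant `1 / a + c` and its minimum at `-(a • p)`, so the
competitor `-(a • g)` overshoots the infimum only quadratically in `p - g`. -/
theorem add_sq_le_infConv (hu : IsConvexSmooth c u) (ha : 0 < a) (x g : E) :
    u (x - a • g) + a / 2 * ‖g‖ ^ 2 ≤ _root_.infConv a u x +
      (1 / a + c) / 2 * (a ^ 2 * ‖gradient (_root_.infConv a u) x - g‖ ^ 2) := by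
  set p := gradient (_root_.infConv a u) x with hp
  have h1 := hu.add_le (x - a • p) (a • (p - g))
  rw [hu.gradient_infConv ha x, ← hp, real_inner_smul_right, norm_smul, mul_pow,
    Real.norm_eq_abs, sq_abs, show x - a • p + a • (p - g) = x - a • g by module] at h1
  rw [hu.infConv_eq ha x, ← hp]
  have h2 : ‖g‖ ^ 2 = ‖p‖ ^ 2 - 2 * inner ℝ p (p - g) + ‖p - g‖ ^ 2 := by
    rw [← norm_sub_sq_real, sub_sub_cancel]
  have h3 : (1 / a + c) / 2 * (a ^ 2 * ‖p - g‖ ^ 2) =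
      a / 2 * ‖p - g‖ ^ 2 + c / 2 * (a ^ 2 * ‖p - g‖ ^ 2) := by field_simp
  rw [h3, h2]
  linarith

end

/-- The defect in the commutation of the two semigroups. -/
noncomputable def _root_.commDefect (a b c d : ℝ) : ℝ := (1 / a + c) / 2 * (a ^ 2 * c ^ 2 * (b * d))

variable [CompleteSpace E]

/-- The competitor is frozen at the slope `g` of the center `x`. Under noise `z` the optimal slope
differs from `g` by at most `c * ‖z‖`, so averaging the overshoot costs the second moment, linear in
the dimension. -/
theorem le_gaussAvg_infConv (hu : IsConvexSmooth c u) (hc : 0 < c) (ha : 0 < a) (hb : 0 < b)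
    (x : E) :
    _root_.gaussAvg b u (x - a • gradient (_root_.infConv a u) x) +
        a / 2 * ‖gradient (_root_.infConv a u) x‖ ^ 2 ≤
      _root_.gaussAvg b (_root_.infConv a u) x + commDefect a b c (Module.finrank ℝ E) := by
  have := isProbabilityMeasure_isoGaussian (E := E) hb
  set g := gradient (_root_.infConv a u) x with hg
  have j1 := (hu.infConv ha).integrable_add hc.le hb x
  have j2 := hu.integrable_add hc.le hb (x - a • g)
  have j3 := integrable_norm_pow_isoGaussian (E := E) hb 2
  have := integral_mono (j2.add (integrable_const (a / 2 * ‖g‖ ^ 2)))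
    (j1.add (j3.const_mul ((1 / a + c) / 2 * (a ^ 2 * c ^ 2)))) fun z => by
    have h1 := hu.add_sq_le_infConv ha (x + z) g
    have h2 := (hu.infConv ha).gradient_lipschitz hc x (x + z)
    rw [add_sub_cancel_left, ← hg] at h2
    have h3 : ‖gradient (_root_.infConv a u) (x + z) - g‖ ^ 2 ≤ c ^ 2 * ‖z‖ ^ 2 := by
      rw [← mul_pow]
      gcongr
    have h4 : (1 / a + c) / 2 * (a ^ 2 * ‖gradient (_root_.infConv a u) (x + z) - g‖ ^ 2) ≤
        (1 / a + c) / 2 * (a ^ 2 * c ^ 2) * ‖z‖ ^ 2 := by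
      rw [mul_assoc, mul_assoc]
      gcongr
    rw [show x + z - a • g = x - a • g + z by abel] at h1
    exact h1.trans (add_le_add_right h4 _)
  simp only [Pi.add_apply] at this
  rw [integral_add j2 (integrable_const _), integral_add j1 (j3.const_mul _),
    integral_const, probReal_univ, one_smul, integral_const_mul,
    integral_norm_sq_isoGaussian hb] at this
  refine this.trans_eq ?_
  rw [_root_.gaussAvg, commDefect]
  ring

theorem gaussAvg_infConv_le_infConv_gaussAvg (hu : IsConvexSmooth c u) (hc : 0 < c) (ha : 0 < a)
    (hb : 0 < b) (x : E) : _root_.gaussAvg b (_root_.infConv a u) x ≤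
      _root_.infConv a (_root_.gaussAvg b u) x :=
  le_ciInf fun y => hu.gaussAvg_infConv_le hc ha hb x y

theorem infConv_gaussAvg_le (hu : IsConvexSmooth c u) (hc : 0 < c) (ha : 0 < a)
    (hb : 0 < b) (x : E) : _root_.infConv a (_root_.gaussAvg b u) x ≤
      _root_.gaussAvg b (_root_.infConv a u) x + commDefect a b c (Module.finrank ℝ E) := by
  refine le_trans ?_ (hu.le_gaussAvg_infConv hc ha hb x)
  have := (hu.gaussAvg hc hb).infConv_le ha x (-(a • gradient (_root_.infConv a u) x))
  rw [← sub_eq_add_neg, norm_neg, norm_smul, mul_pow, Real.norm_eq_abs, sq_abs] at this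
  refine this.trans_eq ?_
  congr 1
  field_simp

/-- By the two semigroup laws the long step factors as average, average, inf-convolution,
inf-convolution; two short steps differ from it only in the order of the middle pair. -/
theorem trotterStep_trotterStep (hu : IsConvexSmooth c u) (hc : 0 < c) (hκ : 0 < κ)
    (hb : 0 < b) (x : E) :
    _root_.trotterStep κ (2 * b) u x ≤ _root_.trotterStep κ b (_root_.trotterStep κ b u) x ∧
    _root_.trotterStep κ b (_root_.trotterStep κ b u) x ≤
      _root_.trotterStep κ (2 * b) u x + commDefect (κ * b) b c (Module.finrank ℝ E) := by
  have ha := mul_pos hκ hb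
  have hw := hu.infConv ha
  have e : _root_.trotterStep κ (2 * b) u =
      _root_.gaussAvg b (_root_.gaussAvg b (_root_.infConv (κ * b) (_root_.infConv (κ * b) u))) := by
    rw [(hw.infConv ha).gaussAvg_gaussAvg hc.le hb hb, hu.infConv_infConv ha ha,
      _root_.trotterStep]
    congr 2 <;> ring
  have h1 := (hw.infConv ha).gaussAvg hc hb
  have h2 := (hw.gaussAvg hc hb).infConv ha
  rw [e]
  constructor
  · have := h1.gaussAvg_mono h2 hc.le hb (ε := 0) (fun z => by
      rw [add_zero]; exact hw.gaussAvg_infConv_le_infConv_gaussAvg hc ha hb z) x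
    rwa [add_zero] at this
  · exact h2.gaussAvg_mono h1 hc.le hb (hw.infConv_gaussAvg_le hc ha hb) x

/-- `trotterStep_mono` transports a uniform error without amplifying it, so the defects of the
individual steps just add up. -/
theorem trotterStep_double_iterate (hu : IsConvexSmooth c u) (hc : 0 < c) (hκ : 0 < κ)
    (hb : 0 < b) (n : ℕ) (x : E) :
    (_root_.trotterStep κ (2 * b))^[n] u x ≤ (_root_.trotterStep κ b)^[2 * n] u x ∧
    (_root_.trotterStep κ b)^[2 * n] u x ≤ (_root_.trotterStep κ (2 * b))^[n] u x +
      n * commDefect (κ * b) b c (Module.finrank ℝ E) := by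
  have hb2 : 0 < 2 * b := by positivity
  induction n generalizing x with
  | zero => simp
  | succ n ih =>
    have hA := hu.trotterStep_iterate hc hκ hb2 n
    have hB := hu.trotterStep_iterate hc hκ hb (2 * n)
    rw [show 2 * (n + 1) = 2 * n + 1 + 1 by ring, Function.iterate_succ_apply',
      Function.iterate_succ_apply', Function.iterate_succ_apply']
    have h1 := hB.trotterStep_trotterStep hc hκ hb x
    have h2 := hA.trotterStep_mono hB hc hκ hb2 (ε := 0) (fun z => by
      rw [add_zero]; exact (ih z).1) x
    have h3 := hB.trotterStep_mono hA hc hκ hb2 (fun z => (ih z).2) x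
    rw [add_zero] at h2
    refine ⟨h2.trans h1.1, h1.2.trans ?_⟩
    push_cast
    linarith

end IsConvexSmooth

end GaussAvg

/-! ### The logarithmic Laplace transform and the splitting scheme -/

section LogLaplace

variable {E : Type*} [NormedAddCommGroup E] [InnerProductSpace ℝ E] [FiniteDimensional ℝ E]
  [MeasurableSpace E] [BorelSpace E]

theorem exp_neg_le_quadratic {x : ℝ} (hx : 0 ≤ x) : Real.exp (-x) ≤ 1 - x + x ^ 2 / 2 := by
  have h1 := Real.quadratic_le_exp_of_nonneg hx
  have h2 : Real.exp (-x) * Real.exp x = 1 := by rw [← Real.exp_add]; simp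
  have h3 : 0 < 1 - x + x ^ 2 / 2 := by nlinarith [sq_nonneg (x - 1)]
  have h4 : 1 ≤ (1 - x + x ^ 2 / 2) * Real.exp x := by
    refine le_trans ?_ (mul_le_mul_of_nonneg_left h1 h3.le)
    nlinarith [sq_nonneg (x ^ 2)]
  exact le_of_mul_le_mul_right (h2.le.trans h4) (Real.exp_pos x)

theorem exp_neg_mul_logLaplace {κ s : ℝ} (hκ : 0 < κ) (hs : 0 < s) {u : E → ℝ} {x : E}
    (hu : Integrable (fun y => Real.exp (-(κ * u (x + y)))) (isoGaussian s)) :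
    Real.exp (-(κ * logLaplace κ s u x)) =
      ∫ y, Real.exp (-(κ * u (x + y))) ∂(isoGaussian s) := by
  have := isProbabilityMeasure_isoGaussian (E := E) hs
  have hpos := integral_exp_pos hu
  rw [logLaplace, show -(κ * (-(1 / κ) * Real.log (∫ y, Real.exp (-(κ * u (x + y)))
    ∂(isoGaussian s)))) = Real.log (∫ y, Real.exp (-(κ * u (x + y))) ∂(isoGaussian s)) by
      field_simp, Real.exp_log hpos]

theorem logLaplace_mono {κ s : ℝ} (hκ : 0 < κ) (hs : 0 < s) {u v : E → ℝ} {x : E}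
    (hu : Integrable (fun y => Real.exp (-(κ * u (x + y)))) (isoGaussian s))
    (hv : Integrable (fun y => Real.exp (-(κ * v (x + y)))) (isoGaussian s)) {ε : ℝ}
    (huv : ∀ x, u x ≤ v x + ε) : logLaplace κ s u x ≤ logLaplace κ s v x + ε := by
  have h1 : ∫ y, Real.exp (-(κ * ε)) * Real.exp (-(κ * v (x + y))) ∂(isoGaussian s) ≤
      ∫ y, Real.exp (-(κ * u (x + y))) ∂(isoGaussian s) := by
    refine integral_mono (hv.const_mul _) hu fun y => ?_
    rw [← Real.exp_add, Real.exp_le_exp]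
    nlinarith [huv (x + y)]
  rw [integral_const_mul, ← exp_neg_mul_logLaplace hκ hs hu, ← exp_neg_mul_logLaplace hκ hs hv,
    ← Real.exp_add, Real.exp_le_exp] at h1
  have h2 : κ * logLaplace κ s u x ≤ κ * (logLaplace κ s v x + ε) := by linarith
  exact le_of_mul_le_mul_left h2 hκ

theorem integrable_exp_logLaplace {κ s t : ℝ} (hκ : 0 < κ) (hs : 0 < s) (ht : 0 < t)
    {u : E → ℝ} (hu : ∀ r, 0 < r → ∀ x,
      Integrable (fun y => Real.exp (-(κ * u (x + y)))) (isoGaussian r)) (x : E) :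
    Integrable (fun y => Real.exp (-(κ * logLaplace κ t u (x + y)))) (isoGaussian s) := by
  have := isProbabilityMeasure_isoGaussian (E := E) hs
  have := isProbabilityMeasure_isoGaussian (E := E) ht
  simp_rw [exp_neg_mul_logLaplace hκ ht (hu t ht _)]
  have h1 : Integrable (fun y => Real.exp (-(κ * u (x + y))))
      (((isoGaussian s).prod (isoGaussian t)).map fun p : E × E => p.1 + p.2) := by
    have := hu (s + t) (add_pos hs ht) x
    rwa [← isoGaussian_conv hs ht] at this
  have h2 := ((integrable_map_measure h1.aestronglyMeasurable (by fun_prop)).1 h1).integral_prod_left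
  simpa only [Function.comp_apply, add_assoc] using h2

theorem logLaplace_logLaplace {κ s t : ℝ} (hκ : 0 < κ) (hs : 0 < s) (ht : 0 < t)
    {u : E → ℝ} (hu : ∀ r, 0 < r → ∀ x,
      Integrable (fun y => Real.exp (-(κ * u (x + y)))) (isoGaussian r)) :
    logLaplace κ s (logLaplace κ t u) = logLaplace κ (s + t) u := by
  have := isProbabilityMeasure_isoGaussian (E := E) hs
  have := isProbabilityMeasure_isoGaussian (E := E) ht
  funext x
  have j := hu (s + t) (add_pos hs ht) x
  rw [← isoGaussian_conv hs ht] at j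
  rw [logLaplace]
  simp_rw [exp_neg_mul_logLaplace hκ ht (hu t ht _)]
  rw [logLaplace, ← isoGaussian_conv hs ht, integral_conv j]
  simp only [add_assoc]

namespace IsConvexSmooth

variable [CompleteSpace E] {a b c s t κ : ℝ} {u v : E → ℝ}

theorem exp_neg_le (hu : IsConvexSmooth c u) (hκ : 0 < κ) (x y : E) :
    Real.exp (-(κ * u (x + y))) ≤
      Real.exp (-(κ * u x)) * Real.exp (κ * ‖gradient u x‖ * ‖y‖) := by
  rw [← Real.exp_add, Real.exp_le_exp]
  have h1 := hu.le_add x y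
  have h2 := neg_le_of_abs_le (abs_real_inner_le_norm (gradient u x) y)
  have h3 : κ * (u x - ‖gradient u x‖ * ‖y‖) ≤ κ * u (x + y) := by
    gcongr
    linarith
  linarith

theorem integrable_exp (hu : IsConvexSmooth c u) (hκ : 0 < κ) (hs : 0 < s) (x : E) :
    Integrable (fun y => Real.exp (-(κ * u (x + y)))) (isoGaussian s) := by
  have := hu.continuous
  refine ((integrable_exp_mul_norm_isoGaussian hs (κ * ‖gradient u x‖)).const_mul
    (Real.exp (-(κ * u x)))).mono' (by fun_prop) (Eventually.of_forall fun y => ?_)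
  rw [Real.norm_eq_abs, Real.abs_exp]
  exact hu.exp_neg_le hκ x y

/-- Translation by `(κ * b) • g` and completion of the square in the Gaussian weight; the linear
term so produced subtracts the tangent of slope `g` from `u` at the new center. -/
theorem _root_.integral_exp_shift (κ : ℝ) (u : E → ℝ) (hb : 0 < b) (x g : E) :
    ∫ y, Real.exp (-(κ * u (x + y))) ∂(isoGaussian b) =
      Real.exp (-(κ * (u (x - (κ * b) • g) + κ * b / 2 * ‖g‖ ^ 2))) *
      ∫ y, Real.exp (-(κ * (u (x - (κ * b) • g + y) - u (x - (κ * b) • g) - inner ℝ g y)))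
        ∂(isoGaussian b) := by
  rw [integral_isoGaussian hb, integral_isoGaussian hb, smul_eq_mul, smul_eq_mul, mul_left_comm]
  congr 1
  rw [← integral_const_mul,
    ← integral_sub_right_eq_self (fun y => Real.exp (-(‖y‖ ^ 2 / (2 * b))) •
      Real.exp (-(κ * u (x + y)))) ((κ * b) • g)]
  congr 1
  funext y
  rw [smul_eq_mul, smul_eq_mul, ← Real.exp_add, ← Real.exp_add, ← Real.exp_add,
    show x + (y - (κ * b) • g) = x - (κ * b) • g + y by abel, norm_sub_sq_real, norm_smul, mul_pow,
    Real.norm_eq_abs, sq_abs, real_inner_smul_right, real_inner_comm g y]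
  congr 1
  field_simp
  ring

/-- The defect between one step of the splitting scheme and the logarithmic Laplace transform. -/
noncomputable def _root_.localDefect (κ b c d : ℝ) : ℝ := κ / 8 * c ^ 2 * (b ^ 2 * (d * (d + 2)))

/-- At `z = x - (κ * b) • g` the gradient of `u` is exactly `g`, so after the shift the exponent
contains only the remainder `r`, which lies between `0` and `c / 2 * ‖y‖ ^ 2`. Jensen gives one
inequality; expanding the exponential to second order, with the fourth moment, gives the other. -/
theorem logLaplace_local (hu : IsConvexSmooth c u) (hc : 0 < c) (hκ : 0 < κ) (hb : 0 < b)
    (x : E) :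
    logLaplace κ b u x ≤
      _root_.gaussAvg b u (x - (κ * b) • gradient (_root_.infConv (κ * b) u) x) +
        κ * b / 2 * ‖gradient (_root_.infConv (κ * b) u) x‖ ^ 2 ∧
    _root_.gaussAvg b u (x - (κ * b) • gradient (_root_.infConv (κ * b) u) x) +
        κ * b / 2 * ‖gradient (_root_.infConv (κ * b) u) x‖ ^ 2 ≤
      logLaplace κ b u x + localDefect κ b c (Module.finrank ℝ E) := by
  have := isProbabilityMeasure_isoGaussian (E := E) hb
  have ha := mul_pos hκ hb
  set g := gradient (_root_.infConv (κ * b) u) x with hg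
  have hgx : gradient u (x - (κ * b) • g) = g := hu.gradient_infConv ha x
  set z := x - (κ * b) • g with hz
  set r : E → ℝ := fun y => u (z + y) - u z - inner ℝ g y with hr
  have hcont := hu.continuous
  have hrc : Continuous r := by fun_prop
  have hr0 : ∀ y, 0 ≤ r y := fun y => by
    have := hu.le_add z y
    rw [hgx] at this
    simp only [hr]
    linarith
  have hr1 : ∀ y, r y ≤ c / 2 * ‖y‖ ^ 2 := fun y => by
    have := hu.add_le z y
    rw [hgx] at this
    simp only [hr]
    linarith
  have hui : Integrable (fun y => u (z + y) - u z) (isoGaussian b) :=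
    (hu.integrable_add hc.le hb z).sub (integrable_const _)
  have hri : Integrable r (isoGaussian b) := hui.sub (integrable_inner_isoGaussian hb g)
  have hr2 : ∀ y, r y ^ 2 ≤ c ^ 2 / 4 * ‖y‖ ^ 4 := fun y => by
    have := pow_le_pow_left₀ (hr0 y) (hr1 y) 2
    refine this.trans_eq ?_
    ring
  have hri2 : Integrable (fun y => r y ^ 2) (isoGaussian b) := by
    refine ((integrable_norm_pow_isoGaussian hb 4).const_mul (c ^ 2 / 4)).mono' (by fun_prop)
      (Eventually.of_forall fun y => ?_)
    rw [Real.norm_eq_abs, abs_of_nonneg (sq_nonneg _)]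
    exact hr2 y
  have hre : Integrable (fun y => Real.exp (-(κ * r y))) (isoGaussian b) := by
    refine (integrable_const (1 : ℝ)).mono' (by fun_prop) (Eventually.of_forall fun y => ?_)
    rw [Real.norm_eq_abs, Real.abs_exp, Real.exp_le_one_iff]
    have := mul_nonneg hκ.le (hr0 y)
    linarith
  set m := ∫ y, Real.exp (-(κ * r y)) ∂(isoGaussian b) with hm
  have hEr : ∫ y, r y ∂(isoGaussian b) = _root_.gaussAvg b u z - u z := by
    simp only [hr]
    rw [integral_sub hui (integrable_inner_isoGaussian hb g), integral_inner_isoGaussian hb,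
      integral_sub (hu.integrable_add hc.le hb z) (integrable_const _)]
    simp [_root_.gaussAvg]
  set e := ∫ y, r y ∂(isoGaussian b) with he
  -- Jensen's inequality, by integrating the tangent line of the exponential at the mean `e`.
  have hm1 : Real.exp (-(κ * e)) ≤ m := by
    have h1 : ∀ y, Real.exp (-(κ * e)) * (1 - κ * (r y - e)) ≤ Real.exp (-(κ * r y)) := fun y => by
      have h2 := Real.add_one_le_exp (-(κ * (r y - e)))
      have h3 : Real.exp (-(κ * r y)) = Real.exp (-(κ * e)) * Real.exp (-(κ * (r y - e))) := by
        rw [← Real.exp_add]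
        congr 1
        ring
      rw [h3]
      gcongr
      linarith
    have i1 : Integrable (fun y => κ * (r y - e)) (isoGaussian b) :=
      (hri.sub (integrable_const _)).const_mul _
    have h4 := integral_mono (((integrable_const (1 : ℝ)).sub i1).const_mul _) hre h1
    refine le_trans (le_of_eq ?_) h4
    simp only [Pi.sub_apply]
    rw [integral_const_mul, integral_sub (integrable_const _) i1, integral_const_mul,
      integral_sub hri (integrable_const _), ← he]
    simp
  -- The quadratic majorant of `exp (-x)` holds only for `x ≥ 0`, so convexity of `u`, through `0 ≤
  -- r`, is essential.
  have hm2 : m ≤ 1 - κ * e + κ ^ 2 / 2 * (c ^ 2 / 4 * (b ^ 2 *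
      (Module.finrank ℝ E * (Module.finrank ℝ E + 2)))) := by
    have h1 : ∀ y, Real.exp (-(κ * r y)) ≤
        1 - κ * r y + κ ^ 2 / 2 * (c ^ 2 / 4) * ‖y‖ ^ 4 := fun y => by
      refine (exp_neg_le_quadratic (mul_nonneg hκ.le (hr0 y))).trans ?_
      have := mul_le_mul_of_nonneg_left (hr2 y) (show 0 ≤ κ ^ 2 / 2 by positivity)
      nlinarith
    have i1 : Integrable (fun y => 1 - κ * r y) (isoGaussian b) :=
      (integrable_const (1 : ℝ)).sub (hri.const_mul κ)
    have h4 := integral_mono hre (i1.add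
      ((integrable_norm_pow_isoGaussian hb 4).const_mul _)) h1
    refine h4.trans_eq ?_
    simp only [Pi.add_apply]
    rw [integral_add i1
      ((integrable_norm_pow_isoGaussian hb 4).const_mul _),
      integral_sub (integrable_const _) (hri.const_mul κ), integral_const_mul,
      integral_const_mul, integral_norm_pow_four_isoGaussian hb, ← he]
    simp
    ring
  have hmpos : 0 < m := (Real.exp_pos _).trans_le hm1
  have hS : logLaplace κ b u x = u z + κ * b / 2 * ‖g‖ ^ 2 - 1 / κ * Real.log m := by
    rw [logLaplace, integral_exp_shift κ u hb x g, ← hz, ← hm,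
      Real.log_mul (Real.exp_pos _).ne' hmpos.ne', Real.log_exp]
    field_simp
    ring
  have hl1 : -(κ * e) ≤ Real.log m := (Real.le_log_iff_exp_le hmpos).2 hm1
  have hl2 : Real.log m ≤ m - 1 := Real.log_le_sub_one_of_pos hmpos
  have hk : 0 < 1 / κ := by positivity
  have hg1 : _root_.gaussAvg b u z = u z + e := by linarith
  rw [hS, hg1, localDefect]
  constructor
  · have := mul_le_mul_of_nonneg_left hl1 hk.le
    rw [show 1 / κ * -(κ * e) = -e by field_simp] at this
    linarith
  · have := mul_le_mul_of_nonneg_left (hl2.trans (sub_le_sub_right hm2 1)) hk.le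
    rw [show 1 / κ * (1 - κ * e + κ ^ 2 / 2 * (c ^ 2 / 4 * (b ^ 2 *
      (Module.finrank ℝ E * (Module.finrank ℝ E + 2)))) - 1) = -e + κ / 8 * c ^ 2 * (b ^ 2 *
      (Module.finrank ℝ E * (Module.finrank ℝ E + 2))) by field_simp; ring] at this
    linarith

/-- Both quantities lie within their own defect below the same value: the averaged potential at the
frozen competitor plus its cost. -/
theorem abs_trotterStep_sub_logLaplace_le (hu : IsConvexSmooth c u) (hc : 0 < c) (hκ : 0 < κ)
    (hb : 0 < b) (x : E) :
    |_root_.trotterStep κ b u x - logLaplace κ b u x| ≤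
      commDefect (κ * b) b c (Module.finrank ℝ E) + localDefect κ b c (Module.finrank ℝ E) := by
  have ha := mul_pos hκ hb
  have h1 := hu.logLaplace_local hc hκ hb x
  have h2 := hu.le_gaussAvg_infConv hc ha hb x
  have h3 := hu.gaussAvg_infConv_le hc ha hb x (-((κ * b) • gradient (_root_.infConv (κ * b) u) x))
  rw [← sub_eq_add_neg, norm_neg, norm_smul, mul_pow, Real.norm_eq_abs, sq_abs,
    show 1 / (2 * (κ * b)) * ((κ * b) ^ 2 * ‖gradient (_root_.infConv (κ * b) u) x‖ ^ 2) =
      κ * b / 2 * ‖gradient (_root_.infConv (κ * b) u) x‖ ^ 2 by field_simp] at h3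
  have h4 : 0 ≤ commDefect (κ * b) b c (Module.finrank ℝ E) := by
    rw [commDefect]; positivity
  have h5 : 0 ≤ localDefect κ b c (Module.finrank ℝ E) := by
    rw [localDefect]; positivity
  rw [_root_.trotterStep, abs_le]
  constructor <;> linarith

/-- Telescoping: one step at a time is exchanged for `logLaplace`, whose monotonicity carries the
previous error along. Starting the count at `n + 1` avoids variance zero, excluded from the
semigroup law of `logLaplace`. -/
theorem abs_trotterStep_iterate_sub_logLaplace_le (hu : IsConvexSmooth c u) (hc : 0 < c)
    (hκ : 0 < κ) (hb : 0 < b) (n : ℕ) (x : E) :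
    |(_root_.trotterStep κ b)^[n + 1] u x - logLaplace κ ((n + 1 : ℕ) * b) u x| ≤
      (n + 1 : ℕ) * (commDefect (κ * b) b c (Module.finrank ℝ E) +
        localDefect κ b c (Module.finrank ℝ E)) := by
  induction n generalizing x with
  | zero => simpa using hu.abs_trotterStep_sub_logLaplace_le hc hκ hb x
  | succ n ih =>
    have hn : 0 < ((n + 1 : ℕ) : ℝ) * b := by positivity
    have hw := hu.trotterStep_iterate hc hκ hb (n + 1)
    have hi := fun r (hr : 0 < r) x => hu.integrable_exp hκ hr x
    have e : logLaplace κ ((n + 1 + 1 : ℕ) * b) u =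
        logLaplace κ b (logLaplace κ ((n + 1 : ℕ) * b) u) := by
      rw [logLaplace_logLaplace hκ hb hn hi]
      congr 1
      push_cast
      ring
    have h1 := hw.abs_trotterStep_sub_logLaplace_le hc hκ hb x
    have i1 := hw.integrable_exp hκ hb x
    have i2 := integrable_exp_logLaplace hκ hb hn hi x
    have h2 := logLaplace_mono hκ hb i1 i2 (ε := (n + 1 : ℕ) * (commDefect (κ * b) b c
      (Module.finrank ℝ E) + localDefect κ b c (Module.finrank ℝ E)))
      (fun z => by linarith [(abs_le.1 (ih z)).2])
    have h3 := logLaplace_mono hκ hb i2 i1 (ε := (n + 1 : ℕ) * (commDefect (κ * b) b c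
      (Module.finrank ℝ E) + localDefect κ b c (Module.finrank ℝ E)))
      (fun z => by linarith [(abs_le.1 (ih z)).1])
    rw [e, Function.iterate_succ_apply']
    rw [abs_le] at h1 ⊢
    push_cast at h2 h3 ⊢
    constructor <;> linarith [h1.1, h1.2]

/-- With `a = κ * b` the factor `1 / a` cancels one power of `κ * b`, leaving order `b ^ 2` with a
coefficient linear in `d`. -/
theorem commDefect_le (hc : 0 < c) (hκ : 0 < κ) (hb : 0 < b) {B d : ℝ} (hbB : b ≤ B)
    (hd : 0 ≤ d) :
    commDefect (κ * b) b c d ≤ (1 + c * (κ * B)) / 2 * (κ * c ^ 2 * d) * b ^ 2 := by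
  have : commDefect (κ * b) b c d = (1 + c * (κ * b)) / 2 * (κ * c ^ 2 * d) * b ^ 2 := by
    rw [commDefect]
    field_simp
  rw [this]
  gcongr

/-- There are `n` errors of order `b ^ 2` with `n * b = s`, in total of order `b`. The constant is
quadratic in the dimension, which is harmless for a fixed space. -/
theorem tendsto_trotterStep_iterate (hu : IsConvexSmooth c u) (hc : 0 < c)
    (hκ : 0 < κ) (hs : 0 < s) {n : ℕ → ℕ} {b : ℕ → ℝ} (hb : ∀ᶠ k in atTop, 0 < b k)
    (hnb : ∀ᶠ k in atTop, n k * b k = s) (hlim : Tendsto b atTop (𝓝 0)) (x : E) :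
    Tendsto (fun k => (_root_.trotterStep κ (b k))^[n k] u x) atTop (𝓝 (logLaplace κ s u x)) := by
  rw [tendsto_iff_norm_sub_tendsto_zero]
  set d : ℝ := (Module.finrank ℝ E : ℝ)
  set K : ℝ := (1 + c * (κ * 1)) / 2 * (κ * c ^ 2 * d) + κ / 8 * c ^ 2 * (d * (d + 2))
  have hK : Tendsto (fun k => s * K * b k) atTop (𝓝 0) := by
    have := hlim.const_mul (s * K)
    rwa [mul_zero] at this
  refine squeeze_zero' (Eventually.of_forall fun k => norm_nonneg _) ?_ hK
  filter_upwards [hb, hnb, hlim.eventually (ge_mem_nhds one_pos)] with k hbk hnk hbk1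
  have hn0 : n k ≠ 0 := by
    rintro h
    rw [h, Nat.cast_zero, zero_mul] at hnk
    exact hs.ne hnk
  obtain ⟨j, hj⟩ := Nat.exists_eq_succ_of_ne_zero hn0
  have h1 := hu.abs_trotterStep_iterate_sub_logLaplace_le hc hκ hbk j x
  rw [← Nat.succ_eq_add_one, ← hj, hnk] at h1
  rw [Real.norm_eq_abs]
  refine h1.trans ?_
  have h2 := commDefect_le (d := d) hc hκ hbk hbk1 (Nat.cast_nonneg _)
  have h3 : commDefect (κ * b k) (b k) c d + localDefect κ (b k) c d ≤ K * b k ^ 2 := by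
    rw [localDefect]
    simp only [K]
    linarith
  calc (n k : ℝ) * (commDefect (κ * b k) (b k) c d + localDefect κ (b k) c d)
      ≤ n k * (K * b k ^ 2) := by gcongr
    _ = n k * b k * K * b k := by ring
    _ = s * K * b k := by rw [hnk]

theorem tendsto_trotterStep_dyadic (hu : IsConvexSmooth c u) (hc : 0 < c) (hκ : 0 < κ)
    (hs : 0 < s) (x : E) :
    Tendsto (fun l : ℕ => (_root_.trotterStep κ (s / 2 ^ l))^[2 ^ l] u x) atTop
      (𝓝 (logLaplace κ s u x)) := by
  refine hu.tendsto_trotterStep_iterate hc hκ hs (Eventually.of_forall fun l => by positivity)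
    (Eventually.of_forall fun l => ?_) ?_ x
  · push_cast
    field_simp
  · have := (tendsto_pow_atTop_nhds_zero_of_lt_one (r := (1 / 2 : ℝ)) (by norm_num)
      (by norm_num)).const_mul s
    rw [mul_zero] at this
    refine this.congr fun l => ?_
    rw [div_pow, one_pow, mul_one_div]

/-- Convexity and smoothness pass to the pointwise limit of the splitting scheme, which takes the
place of the Prékopa-Leindler inequality. -/
theorem logLaplace (hu : IsConvexSmooth c u) (hc : 0 < c) (hκ : 0 < κ) (hs : 0 < s) :
    IsConvexSmooth c (logLaplace κ s u) :=
  of_tendsto (Eventually.of_forall fun l : ℕ => hu.trotterStep_iterate hc hκ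
    (show 0 < s / 2 ^ l by positivity) (2 ^ l)) (hu.tendsto_trotterStep_dyadic hc hκ hs)

/-- Refining the dyadic mesh increases the scheme, and adding `M * s ^ 2 / 2 ^ l` makes it decrease,
so the limit is caught between. Only `commDefect` enters the rate, hence the linear dependence on
the dimension; the local defect served just to identify the limit. -/
theorem abs_trotterStep_dyadic_sub_logLaplace_le (hu : IsConvexSmooth c u) (hc : 0 < c)
    (hκ : 0 < κ) (hs : 0 < s) (l : ℕ) (x : E) :
    |(_root_.trotterStep κ (s / 2 ^ l))^[2 ^ l] u x - _root_.logLaplace κ s u x| ≤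
      (1 + c * (κ * s)) / 2 * (κ * c ^ 2 * Module.finrank ℝ E) * s ^ 2 / 2 ^ l := by
  set M : ℝ := (1 + c * (κ * s)) / 2 * (κ * c ^ 2 * Module.finrank ℝ E) with hM
  have hM0 : 0 ≤ M := by positivity
  set A : ℕ → ℝ := fun l => (_root_.trotterStep κ (s / 2 ^ l))^[2 ^ l] u x with hA
  have hstep : ∀ l, A l ≤ A (l + 1) ∧ A (l + 1) ≤ A l + M * s ^ 2 / 2 ^ l - M * s ^ 2 / 2 ^ (l + 1) := by
    intro l
    have hb : 0 < s / 2 ^ (l + 1) := by positivity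
    have h := hu.trotterStep_double_iterate hc hκ hb (2 ^ l) x
    have e1 : 2 * (s / 2 ^ (l + 1)) = s / 2 ^ l := by
      rw [pow_succ]
      field_simp
    rw [e1, ← pow_succ'] at h
    refine ⟨h.1, h.2.trans ?_⟩
    have h2 : s / 2 ^ (l + 1) ≤ s := div_le_self hs.le (one_le_pow₀ (by norm_num))
    have h3 := commDefect_le (d := Module.finrank ℝ E) hc hκ hb h2 (Nat.cast_nonneg _)
    rw [← hM] at h3
    have h4 : ((2 ^ l : ℕ) : ℝ) * commDefect (κ * (s / 2 ^ (l + 1))) (s / 2 ^ (l + 1)) c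
        (Module.finrank ℝ E) ≤ 2 ^ l * (M * (s / 2 ^ (l + 1)) ^ 2) := by
      push_cast
      gcongr
    have h5 : 2 ^ l * (M * (s / 2 ^ (l + 1)) ^ 2) = M * s ^ 2 / 2 ^ l / 4 := by
      field_simp
      ring
    have h6 : M * s ^ 2 / 2 ^ (l + 1) = M * s ^ 2 / 2 ^ l / 2 := by
      field_simp
      ring
    have h7 : 0 ≤ M * s ^ 2 / 2 ^ l := by positivity
    linarith
  have hmono : Monotone A := monotone_nat_of_le_succ fun l => (hstep l).1
  have hanti : Antitone fun l => A l + M * s ^ 2 / 2 ^ l := by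
    refine antitone_nat_of_succ_le fun l => ?_
    linarith [(hstep l).2]
  have hlim := hu.tendsto_trotterStep_dyadic hc hκ hs x
  have hup : A l ≤ _root_.logLaplace κ s u x :=
    ge_of_tendsto hlim ((eventually_ge_atTop l).mono fun k hk => hmono hk)
  have hlow : _root_.logLaplace κ s u x ≤ A l + M * s ^ 2 / 2 ^ l := by
    refine le_of_tendsto hlim ((eventually_ge_atTop l).mono fun k hk => ?_)
    have h1 := hanti hk
    have h2 : 0 ≤ M * s ^ 2 / 2 ^ k := by positivity
    simp only at h1
    linarith
  have h0 : 0 ≤ M * s ^ 2 / 2 ^ l := by positivity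
  rw [abs_le]
  constructor <;> linarith

/-- Writing the Gaussian as `√s` times a standard one moves `s` into a continuous integrand, which
the affine minorant of `u` dominates for `s < t + 1`. -/
theorem tendsto_logLaplace (hu : IsConvexSmooth c u) (hκ : 0 < κ) (ht : 0 < t) (x : E) :
    Tendsto (fun s => _root_.logLaplace κ s u x) (𝓝 t) (𝓝 (_root_.logLaplace κ t u x)) := by
  have hcont := hu.continuous
  have key : ∀ s, 0 < s → ∫ y, Real.exp (-(κ * u (x + y))) ∂(isoGaussian s) =
      ∫ y, Real.exp (-(κ * u (x + √s • y))) ∂(isoGaussian 1) := fun s hs => by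
    rw [← isoGaussian_map_smul hs, integral_map (by fun_prop) (by fun_prop)]
  have h1 : Tendsto (fun s => ∫ y, Real.exp (-(κ * u (x + √s • y))) ∂(isoGaussian 1)) (𝓝 t)
      (𝓝 (∫ y, Real.exp (-(κ * u (x + √t • y))) ∂(isoGaussian 1))) := by
    refine tendsto_integral_filter_of_dominated_convergence
      (fun y => Real.exp (-(κ * u x)) * Real.exp (κ * ‖gradient u x‖ * √(t + 1) * ‖y‖))
      (Eventually.of_forall fun s => by fun_prop) ?_
      ((integrable_exp_mul_norm_isoGaussian one_pos _).const_mul _) ?_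
    · filter_upwards [Iio_mem_nhds (show t < t + 1 by linarith)] with s hs
      refine Eventually.of_forall fun y => ?_
      rw [Real.norm_eq_abs, Real.abs_exp]
      refine (hu.exp_neg_le hκ x _).trans ?_
      rw [norm_smul, Real.norm_eq_abs, abs_of_nonneg (Real.sqrt_nonneg s), ← mul_assoc]
      have : √s ≤ √(t + 1) := Real.sqrt_le_sqrt (le_of_lt hs)
      gcongr
    · refine Eventually.of_forall fun y => ?_
      have : Continuous fun s : ℝ => Real.exp (-(κ * u (x + √s • y))) := by fun_prop
      exact this.tendsto t
  have hpos : 0 < ∫ y, Real.exp (-(κ * u (x + √t • y))) ∂(isoGaussian 1) := by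
    have := isProbabilityMeasure_isoGaussian (E := E) ht
    rw [← key t ht]
    exact integral_exp_pos (hu.integrable_exp hκ ht x)
  have h2 := (h1.log hpos.ne').const_mul (-(1 / κ))
  rw [← key t ht] at h2
  refine h2.congr' ?_
  filter_upwards [Ioi_mem_nhds ht] with s hs
  rw [_root_.logLaplace, key s hs]

end IsConvexSmooth

end LogLaplace

/-! ### Convolution of a density with a Gaussian measure -/

section Convolution

variable {E : Type*} [NormedAddCommGroup E] [InnerProductSpace ℝ E] [FiniteDimensional ℝ E]
  [MeasurableSpace E] [BorelSpace E]

theorem isoGaussian_map_neg {s : ℝ} (hs : 0 < s) :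
    (isoGaussian s : Measure E).map (fun y => (-1 : ℝ) • y) = isoGaussian s := by
  have := isProbabilityMeasure_isoGaussian (E := E) hs
  have hm : Measurable fun y : E => (-1 : ℝ) • y := by fun_prop
  have := Measure.isProbabilityMeasure_map (μ := (isoGaussian s : Measure E)) hm.aemeasurable
  refine Measure.ext_of_charFun (funext fun w => ?_)
  rw [charFun_map_smul, charFun_isoGaussian hs, charFun_isoGaussian hs, norm_smul]
  simp

/-- Tonelli and translation invariance of the volume give the density with `x - y`; symmetry of the
Gaussian turns it into `x + y`. -/
theorem withDensity_conv_isoGaussian {s : ℝ} (hs : 0 < s) {f : E → ENNReal} (hf : Measurable f) :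
    ((volume : Measure E).withDensity f).conv (isoGaussian s) =
      volume.withDensity fun x => ∫⁻ y, f (x + y) ∂(isoGaussian s) := by
  have := isProbabilityMeasure_isoGaussian (E := E) hs
  have hneg : ∀ x, ∫⁻ y, f (x + y) ∂(isoGaussian s) = ∫⁻ y, f (x - y) ∂(isoGaussian s) := fun x => by
    conv_lhs => rw [← isoGaussian_map_neg hs]
    rw [lintegral_map (by fun_prop) (by fun_prop)]
    simp [sub_eq_add_neg]
  ext A hA
  have hI : Measurable (A.indicator (1 : E → ENNReal)) := measurable_one.indicator hA
  rw [withDensity_apply _ hA, ← lintegral_indicator_one hA, Measure.lintegral_conv hI,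
    lintegral_withDensity_eq_lintegral_mul _ hf (by fun_prop), ← lintegral_indicator hA]
  have h1 : ∀ x, (f * fun x => ∫⁻ y, A.indicator (1 : E → ENNReal) (x + y) ∂(isoGaussian s)) x =
      ∫⁻ y, f x * A.indicator (1 : E → ENNReal) (x + y) ∂(isoGaussian s) := fun x => by
    rw [Pi.mul_apply, lintegral_const_mul _ (by fun_prop)]
  have h2 : ∀ x, A.indicator (fun x => ∫⁻ y, f (x + y) ∂(isoGaussian s)) x =
      ∫⁻ y, f (x - y) * A.indicator (1 : E → ENNReal) x ∂(isoGaussian s) := fun x => by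
    rw [lintegral_mul_const _ (by fun_prop), ← hneg]
    by_cases hx : x ∈ A <;> simp [hx]
  simp_rw [h1, h2]
  refine (lintegral_lintegral_swap (by fun_prop)).trans
    (Eq.trans ?_ (lintegral_lintegral_swap (by fun_prop)).symm)
  congr 1
  funext y
  rw [← lintegral_sub_right_eq_self _ y]
  simp

end Convolution

/-! ### Translation to tuples of self-adjoint matrices -/

namespace SATuple

variable {m N : ℕ}

theorem norm_sq_eq (x : SATuple m N) :
    ‖x‖ ^ 2 = ∑ j, (Matrix.trace (x.mat j * x.mat j)).re := by
  rw [← real_inner_self_eq_norm_sq, inner_def]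

theorem norm2_mat_sq (x : SATuple m N) : norm2 x.mat ^ 2 = ‖x‖ ^ 2 / N := by
  have h : ∑ j, (1 / (N : ℝ)) * (Matrix.trace ((x.mat j).conjTranspose * x.mat j)).re =
      ‖x‖ ^ 2 / N := by
    rw [norm_sq_eq, ← Finset.mul_sum]
    simp_rw [mat_conjTranspose]
    ring
  rw [norm2, h, Real.sq_sqrt (by positivity)]

theorem norm2_mat (x : SATuple m N) : norm2 x.mat = ‖x‖ / √N := by
  have h := norm2_mat_sq x
  have h0 : 0 ≤ norm2 x.mat := Real.sqrt_nonneg _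
  rw [← Real.sqrt_sq h0, h, Real.sqrt_div (sq_nonneg _), Real.sqrt_sq (norm_nonneg _)]

/-- A crude bound through all complex matrices; only the order `N ^ 2` matters. -/
theorem finrank_le : Module.finrank ℝ (SATuple m N) ≤ 2 * m * N ^ 2 := by
  have : FiniteDimensional ℝ (Matrix (Fin N) (Fin N) ℂ) :=
    inferInstanceAs (FiniteDimensional ℝ (Fin N → Fin N → ℂ))
  refine (LinearMap.finrank_le_finrank_of_injective (f := matLin (m := m) (N := N))
    mat_injective).trans_eq ?_
  rw [Module.finrank_pi_fintype]
  simp only [Module.finrank_matrix, Complex.finrank_real_complex, Finset.sum_const,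
    Finset.card_univ, Fintype.card_fin, smul_eq_mul]
  ring

end SATuple

section Translation

variable {m N : ℕ}

theorem gue_eq_isoGaussian (hN : 1 ≤ N) (t : ℝ) :
    gue m N t = isoGaussian (E := SATuple m N) (t / N) := by
  have hN' : (N : ℝ) ≠ 0 := by positivity
  have h : ∀ x : SATuple m N, (N * ∑ j, (Matrix.trace (x.mat j * x.mat j)).re / (2 * t)) =
      ‖x‖ ^ 2 / (2 * (t / N)) := fun x => by
    rw [← Finset.sum_div, ← SATuple.norm_sq_eq]
    field_simp
  simp only [gue, isoGaussian, h]

theorem heatOp_eq_gaussAvg (hN : 1 ≤ N) (t : ℝ) (u : SATuple m N → ℝ) :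
    heatOp t u = gaussAvg (t / N) u := by
  funext x
  rw [heatOp, gaussAvg, gue_eq_isoGaussian hN]

theorem hopfLax_eq_infConv (t : ℝ) (u : SATuple m N → ℝ) :
    hopfLax t u = infConv (N * t) u := by
  funext x
  rw [hopfLax, infConv]
  congr 1
  funext y
  rw [SATuple.norm2_mat_sq]
  congr 1
  rw [one_div_mul_eq_div, one_div_mul_eq_div, div_div]
  congr 1
  ring

/-- The value `κ = N ^ 2` is forced: Gaussian variance `b / N` must be paired with inf-convolution
parameter `N * b`. -/
theorem trotter_eq_trotterStep (hN : 1 ≤ N) (l n : ℕ) (u : SATuple m N → ℝ) :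
    trotter l n u = (trotterStep ((N : ℝ) ^ 2) ((2 : ℝ)⁻¹ ^ l / N))^[n] u := by
  have hN' : (N : ℝ) ≠ 0 := by positivity
  rw [trotter]
  congr 1
  funext v
  rw [hopfLax_eq_infConv, heatOp_eq_gaussAvg hN, trotterStep]
  congr 2
  field_simp

theorem gaussPotential_eq_logLaplace (hN : 1 ≤ N) (t : ℝ) (u : SATuple m N → ℝ) :
    gaussPotential t u = logLaplace ((N : ℝ) ^ 2) (t / N) u := by
  funext x
  rw [gaussPotential, logLaplace, gue_eq_isoGaussian hN]

theorem isConvexSmooth_of_concaveOn {C : ℝ} {u : SATuple m N → ℝ} (h1 : ConvexOn ℝ univ u)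
    (h2 : ConcaveOn ℝ univ fun x => u x - C / 2 * norm2 x.mat ^ 2) :
    IsConvexSmooth (C / N) u := by
  refine ⟨h1, h2.neg.congr fun x _ => ?_⟩
  simp only [Pi.neg_apply, SATuple.norm2_mat_sq]
  ring

theorem gibbs_conv_gue (hN : 1 ≤ N) {t c : ℝ} (ht : 0 < t) {u : SATuple m N → ℝ}
    (hu : IsConvexSmooth c u) :
    (gibbs u).conv (gue m N t) = gibbs (gaussPotential t u) := by
  have hN' : (0 : ℝ) < N := by positivity
  have hs : 0 < t / N := by positivity
  have hκ : (0 : ℝ) < (N : ℝ) ^ 2 := by positivity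
  have hcont := hu.continuous
  have := isProbabilityMeasure_isoGaussian (E := SATuple m N) hs
  have h1 := withDensity_conv_isoGaussian (E := SATuple m N) hs
    (f := fun x => ENNReal.ofReal (Real.exp (-((N : ℝ) ^ 2 * u x)))) (by fun_prop)
  have h2 : ∀ x : SATuple m N, ∫⁻ y, ENNReal.ofReal (Real.exp (-((N : ℝ) ^ 2 * u (x + y))))
      ∂(isoGaussian (t / N)) =
      ENNReal.ofReal (Real.exp (-((N : ℝ) ^ 2 * gaussPotential t u x))) := fun x => by
    rw [gaussPotential_eq_logLaplace hN, exp_neg_mul_logLaplace hκ hs (hu.integrable_exp hκ hs x),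
      ofReal_integral_eq_lintegral_ofReal (hu.integrable_exp hκ hs x)
        (Eventually.of_forall fun _ => (Real.exp_pos _).le)]
  simp_rw [h2] at h1
  -- Evaluating the unnormalized identity on the whole space shows that the two normalizing
  -- constants agree, since convolution with a probability measure keeps the mass.
  have h3 := congrArg (fun μ => μ univ) h1
  simp only [withDensity_apply _ MeasurableSet.univ, Measure.restrict_univ] at h3
  rw [gibbs, gibbs, ← h3, ← h1, gue_eq_isoGaussian hN, Measure.conv, Measure.prod_smul_left,
    Measure.map_smul]
  congr 2
  rw [Measure.conv, Measure.map_apply (by fun_prop) MeasurableSet.univ, preimage_univ,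
    ← univ_prod_univ, Measure.prod_prod,
    measure_univ (μ := isoGaussian (t / N)), mul_one,
    withDensity_apply _ MeasurableSet.univ, Measure.restrict_univ]

end Translation

/-! ### The limit of the splitting scheme -/

section Evol

variable {m N : ℕ} {c t : ℝ} {u : SATuple m N → ℝ}

theorem tendsto_two_inv_pow : Tendsto (fun l : ℕ => (2 : ℝ)⁻¹ ^ l) atTop (𝓝 0) :=
  tendsto_pow_atTop_nhds_zero_of_lt_one (by norm_num) (by norm_num)

theorem exists_trotter_limit (hN : 1 ≤ N) (hu : IsConvexSmooth c u) (hc : 0 < c) {s : ℝ}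
    (hs : 0 < s) (hsd : s ∈ dyadics) (x : SATuple m N) :
    Tendsto (fun l : ℕ => trotter l ⌊(2 : ℝ) ^ l * s⌋₊ u x) atTop (𝓝 (gaussPotential s u x)) := by
  have hN' : (0 : ℝ) < N := by positivity
  obtain ⟨n, k, rfl⟩ := hsd
  rw [gaussPotential_eq_logLaplace hN]
  simp_rw [trotter_eq_trotterStep hN]
  refine hu.tendsto_trotterStep_iterate hc (by positivity) (by positivity)
    (Eventually.of_forall fun l => by positivity) ?_ ?_ x
  · filter_upwards [eventually_ge_atTop k] with l hl
    have h1 : (2 : ℝ) ^ l * (n / 2 ^ k) = ((2 ^ (l - k) * n : ℕ) : ℝ) := by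
      obtain ⟨j, rfl⟩ := Nat.exists_eq_add_of_le hl
      push_cast
      rw [add_tsub_cancel_left, pow_add]
      field_simp
    rw [h1, Nat.floor_natCast, ← h1, inv_pow]
    field_simp
  · have := tendsto_two_inv_pow.div_const (N : ℝ)
    rwa [zero_div] at this

theorem tendsto_trotter_evolDyadic (hN : 1 ≤ N) (hu : IsConvexSmooth c u) (hc : 0 < c)
    (x : SATuple m N) {s : ℝ} (hsd : s ∈ dyadics) :
    Tendsto (fun l : ℕ => trotter l ⌊(2 : ℝ) ^ l * s⌋₊ u x) atTop (𝓝 (evolDyadic s u x)) := by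
  have hs0 : 0 ≤ s := by
    obtain ⟨n, k, rfl⟩ := hsd
    positivity
  refine tendsto_nhds_limUnder ?_
  rcases hs0.eq_or_lt with rfl | hs
  · refine ⟨u x, ?_⟩
    simp [trotter]
  · exact ⟨_, exists_trotter_limit hN hu hc hs hsd x⟩

theorem evolDyadic_eq (hN : 1 ≤ N) (hu : IsConvexSmooth c u) (hc : 0 < c)
    (x : SATuple m N) {s : ℝ} (hs : 0 < s) (hsd : s ∈ dyadics) :
    evolDyadic s u x = gaussPotential s u x :=
  tendsto_nhds_unique (tendsto_trotter_evolDyadic hN hu hc x hsd)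
    (exists_trotter_limit hN hu hc hs hsd x)

/-- The dyadics `⌊t * 2 ^ k⌋₊ / 2 ^ k` tend to `t`. -/
theorem neBot_nhdsWithin_dyadics (ht : 0 < t) : (𝓝[dyadics] t).NeBot := by
  rw [← mem_closure_iff_nhdsWithin_neBot]
  have h := (tendsto_nat_floor_mul_div_atTop ht.le).comp
    (tendsto_pow_atTop_atTop_of_one_lt (show (1 : ℝ) < 2 by norm_num))
  exact mem_closure_of_tendsto h (Eventually.of_forall fun k => ⟨_, k, rfl⟩)

theorem tendsto_evolDyadic (hN : 1 ≤ N) (hu : IsConvexSmooth c u) (hc : 0 < c) (ht : 0 < t)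
    (x : SATuple m N) :
    Tendsto (fun s => evolDyadic s u x) (𝓝[dyadics] t) (𝓝 (gaussPotential t u x)) := by
  have hN' : (0 : ℝ) < N := by positivity
  have h1 : Tendsto (fun s => gaussPotential s u x) (𝓝 t) (𝓝 (gaussPotential t u x)) := by
    simp_rw [gaussPotential_eq_logLaplace hN]
    have h2 := hu.tendsto_logLaplace (κ := (N : ℝ) ^ 2) (by positivity)
      (show 0 < t / N by positivity) x
    exact h2.comp (tendsto_id.div_const (N : ℝ))
  refine (h1.mono_left nhdsWithin_le_nhds).congr' ?_
  filter_upwards [self_mem_nhdsWithin, nhdsWithin_le_nhds (Ioi_mem_nhds ht)] with s hsd hs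
  rw [evolDyadic_eq hN hu hc x hs hsd]

theorem evol_eq_gaussPotential (hN : 1 ≤ N) (hu : IsConvexSmooth c u) (hc : 0 < c) (ht : 0 < t) :
    evol t u = gaussPotential t u := by
  funext x
  have := neBot_nhdsWithin_dyadics ht
  exact (tendsto_evolDyadic hN hu hc ht x).limUnder_eq

theorem tendsto_evol (hN : 1 ≤ N) (hu : IsConvexSmooth c u) (hc : 0 < c) (ht : 0 < t)
    (x : SATuple m N) :
    Tendsto (fun s => evolDyadic s u x) (𝓝[dyadics] t) (𝓝 (evol t u x)) := by
  rw [evol_eq_gaussPotential hN hu hc ht]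
  exact tendsto_evolDyadic hN hu hc ht x

theorem isConvexSmooth_gaussPotential (hN : 1 ≤ N) (hu : IsConvexSmooth c u) (hc : 0 < c)
    (ht : 0 < t) : IsConvexSmooth c (gaussPotential t u) := by
  have hN' : (0 : ℝ) < N := by positivity
  rw [gaussPotential_eq_logLaplace hN]
  exact hu.logLaplace hc (by positivity) (by positivity)

theorem norm_normGrad_sub (u v : SATuple m N → ℝ) (x y : SATuple m N) :
    ‖normGrad u x - normGrad v y‖ = N * ‖gradient u x - gradient v y‖ := by
  rw [normGrad, normGrad, ← smul_sub, norm_smul, Real.norm_eq_abs, Nat.abs_cast]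

/-- The powers of `N` cancel: for `κ = N ^ 2`, `c = C / N`, total variance `t / N` and dimension
`O(N ^ 2)`, the potentials differ by `O(2 ^ (-l))` uniformly in `N`. Passing to gradients brings `C
/ N`, and squaring `D = N ∇` brings `N ^ 2`; the resulting factor `N` is absorbed by the normalized
norm. -/
theorem exists_uniform_trotter_bound (m : ℕ) {C t : ℝ} (hC : 0 < C) (ht : 0 < t) :
    ∃ K : ℝ, 0 ≤ K ∧ ∀ N : ℕ, 1 ≤ N → ∀ u : SATuple m N → ℝ, IsConvexSmooth (C / N) u →
      ∀ (l : ℕ) (x : SATuple m N),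
      ‖normGrad ((trotterStep ((N : ℝ) ^ 2) (t / N / 2 ^ l))^[2 ^ l] u) x -
        normGrad (gaussPotential t u) x‖ ^ 2 ≤ N * (K / 2 ^ l) := by
  refine ⟨4 * C * ((1 + C * t) / 2 * (C ^ 2 * (2 * m)) * t ^ 2), by positivity, ?_⟩
  intro N hN u hu l x
  have hN' : (0 : ℝ) < N := by positivity
  have hc : 0 < C / N := by positivity
  have hκ : (0 : ℝ) < (N : ℝ) ^ 2 := by positivity
  have hs : 0 < t / N := by positivity
  have h1 := hu.abs_trotterStep_dyadic_sub_logLaplace_le hc hκ hs l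
  rw [norm_normGrad_sub, mul_pow, gaussPotential_eq_logLaplace hN]
  have h2 := (hu.trotterStep_iterate hc hκ (show 0 < t / N / 2 ^ l by positivity)
    (2 ^ l)).norm_gradient_sub_sq_le (hu.logLaplace hc hκ hs) hc h1 x
  have hd : (Module.finrank ℝ (SATuple m N) : ℝ) ≤ 2 * m * (N : ℝ) ^ 2 := by
    exact_mod_cast SATuple.finrank_le
  calc _ ≤ (N : ℝ) ^ 2 * _ := mul_le_mul_of_nonneg_left h2 hκ.le
    _ ≤ (N : ℝ) ^ 2 * (4 * (C / N) * ((1 + C / N * ((N : ℝ) ^ 2 * (t / N))) / 2 *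
        ((N : ℝ) ^ 2 * (C / N) ^ 2 * (2 * m * (N : ℝ) ^ 2)) * (t / N) ^ 2 / 2 ^ l)) := by
      gcongr
    _ = _ := by
      field_simp

end Evol

/-! ### The operator norm of matrices -/

section OpNorm

variable {N : ℕ}

theorem opNorm_nonneg (A : Matrix (Fin N) (Fin N) ℂ) : 0 ≤ opNorm A := norm_nonneg _

theorem opNorm_add_le (A B : Matrix (Fin N) (Fin N) ℂ) : opNorm (A + B) ≤ opNorm A + opNorm B := by
  rw [opNorm, map_add]
  exact norm_add_le _ _

theorem opNorm_smul (c : ℂ) (A : Matrix (Fin N) (Fin N) ℂ) : opNorm (c • A) = ‖c‖ * opNorm A := by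
  rw [opNorm, map_smul, norm_smul, opNorm]

theorem opNorm_mul_le (A B : Matrix (Fin N) (Fin N) ℂ) : opNorm (A * B) ≤ opNorm A * opNorm B := by
  rw [opNorm, map_mul]
  exact norm_mul_le _ _

theorem opNorm_conjTranspose (A : Matrix (Fin N) (Fin N) ℂ) : opNorm A.conjTranspose = opNorm A := by
  rw [opNorm, ← Matrix.star_eq_conjTranspose, map_star, ContinuousLinearMap.star_eq_adjoint,
    LinearIsometryEquiv.norm_map, opNorm]

theorem opNorm_one_le : opNorm (1 : Matrix (Fin N) (Fin N) ℂ) ≤ 1 := by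
  rw [opNorm, map_one]
  exact ContinuousLinearMap.norm_id_le

theorem sum_norm_sq_col_le (A : Matrix (Fin N) (Fin N) ℂ) (j : Fin N) :
    ∑ i, ‖A i j‖ ^ 2 ≤ opNorm A ^ 2 := by
  have h1 := (Matrix.toEuclideanCLM (n := Fin N) (𝕜 := ℂ) A).le_opNorm (EuclideanSpace.single j 1)
  rw [PiLp.norm_single, norm_one, mul_one] at h1
  have h2 := pow_le_pow_left₀ (norm_nonneg _) h1 2
  rw [EuclideanSpace.norm_sq_eq] at h2
  refine le_trans (le_of_eq (Finset.sum_congr rfl fun i _ => ?_)) h2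
  congr 2
  simp [Matrix.ofLp_toEuclideanCLM]

theorem norm_entry_le_opNorm (A : Matrix (Fin N) (Fin N) ℂ) (i j : Fin N) : ‖A i j‖ ≤ opNorm A := by
  have h1 := sum_norm_sq_col_le A j
  have h2 := Finset.single_le_sum (f := fun i => ‖A i j‖ ^ 2) (fun i _ => sq_nonneg _)
    (Finset.mem_univ i)
  exact le_of_sq_le_sq (h2.trans h1) (opNorm_nonneg A)

/-- The normalized trace. -/
noncomputable def ntr (A : Matrix (Fin N) (Fin N) ℂ) : ℂ := (1 / (N : ℂ)) * A.trace

theorem norm_ntr_le (A : Matrix (Fin N) (Fin N) ℂ) : ‖ntr A‖ ≤ opNorm A := by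
  rcases Nat.eq_zero_or_pos N with rfl | hN
  · simpa [ntr] using opNorm_nonneg A
  · have hN' : (0 : ℝ) < N := by positivity
    rw [ntr, norm_mul, norm_div, norm_one, Complex.norm_natCast, one_div_mul_eq_div,
      div_le_iff₀ hN']
    refine (norm_sum_le _ _).trans ?_
    refine (Finset.sum_le_sum fun i _ => norm_entry_le_opNorm A i i).trans_eq ?_
    simp [mul_comm]

theorem ntr_add (A B : Matrix (Fin N) (Fin N) ℂ) : ntr (A + B) = ntr A + ntr B := by
  simp [ntr, mul_add]

theorem ntr_smul (c : ℂ) (A : Matrix (Fin N) (Fin N) ℂ) : ntr (c • A) = c * ntr A := by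
  simp [ntr, mul_left_comm]

theorem ntr_mul_comm (A B : Matrix (Fin N) (Fin N) ℂ) : ntr (A * B) = ntr (B * A) := by
  rw [ntr, ntr, Matrix.trace_mul_comm]

theorem ntr_conjTranspose (A : Matrix (Fin N) (Fin N) ℂ) :
    ntr A.conjTranspose = star (ntr A) := by
  simp [ntr, Matrix.trace_conjTranspose]

/-- The self-adjoint part of a tuple of matrices. -/
noncomputable def hermPart {m : ℕ} (A : Fin m → Matrix (Fin N) (Fin N) ℂ) : SATuple m N := fun j =>
  ⟨(1 / 2 : ℂ) • (A j + (A j).conjTranspose), by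
    rw [selfAdjoint.mem_iff, Matrix.star_eq_conjTranspose]
    simp [add_comm]⟩

variable {m : ℕ}

theorem hermPart_mat (A : Fin m → Matrix (Fin N) (Fin N) ℂ) (j : Fin m) :
    (hermPart A).mat j = (1 / 2 : ℂ) • (A j + (A j).conjTranspose) := rfl

theorem sub_hermPart_mat (x : SATuple m N) (A : Fin m → Matrix (Fin N) (Fin N) ℂ) (j : Fin m) :
    (x - hermPart A).mat j =
      (1 / 2 : ℂ) • ((x.mat j - A j) + (x.mat j - A j).conjTranspose) := by
  have h : (x - hermPart A).mat j = x.mat j - (hermPart A).mat j := rfl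
  rw [h, hermPart_mat, Matrix.conjTranspose_sub, SATuple.mat_conjTranspose]
  module

theorem opNorm_sub_hermPart_le (x : SATuple m N) (A : Fin m → Matrix (Fin N) (Fin N) ℂ)
    (j : Fin m) : opNorm ((x - hermPart A).mat j) ≤ opNorm (x.mat j - A j) := by
  rw [sub_hermPart_mat, opNorm_smul]
  have := opNorm_add_le (x.mat j - A j) (x.mat j - A j).conjTranspose
  rw [opNorm_conjTranspose] at this
  rw [show ‖(1 / 2 : ℂ)‖ = 1 / 2 by norm_num]
  linarith

/-- Taking the self-adjoint part contracts the Hilbert-Schmidt norm and fixes `x`. Approximants can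
therefore be given self-adjoint values, which makes them composable. -/
theorem norm_sub_hermPart_le (x : SATuple m N) (A : Fin m → Matrix (Fin N) (Fin N) ℂ) :
    ‖x - hermPart A‖ ≤ √N * norm2 (fun j => x.mat j - A j) := by
  rcases Nat.eq_zero_or_pos N with rfl | hN
  · have h : x - hermPart A = 0 := SATuple.mat_injective (funext fun j => Subsingleton.elim _ _)
    simp [h]
  have hN' : (0 : ℝ) < N := by positivity
  have h0 : 0 ≤ norm2 (fun j => x.mat j - A j) := Real.sqrt_nonneg _
  refine le_of_sq_le_sq ?_ (by positivity)
  have hnn : 0 ≤ ∑ j, (1 / (N : ℝ)) *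
      (Matrix.trace ((x.mat j - A j).conjTranspose * (x.mat j - A j))).re := by
    refine Finset.sum_nonneg fun j _ => mul_nonneg (by positivity) ?_
    rw [SATuple.re_trace_conjTranspose_mul]
    exact Finset.sum_nonneg fun _ _ => Finset.sum_nonneg fun _ _ => Complex.normSq_nonneg _
  rw [mul_pow, Real.sq_sqrt hN'.le, norm2, Real.sq_sqrt hnn, Finset.mul_sum,
    ← real_inner_self_eq_norm_sq]
  change SATuple.traceInner _ _ ≤ _
  rw [SATuple.traceInner_self]
  refine Finset.sum_le_sum fun j _ => ?_
  rw [← mul_assoc, mul_one_div_cancel hN'.ne', one_mul, SATuple.re_trace_conjTranspose_mul,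
    sub_hermPart_mat]
  set B := x.mat j - A j
  have h1 : ∀ i k, Complex.normSq (((1 / 2 : ℂ) • (B + B.conjTranspose)) k i) ≤
      1 / 2 * Complex.normSq (B k i) + 1 / 2 * Complex.normSq (B i k) := fun i k => by
    simp only [Matrix.smul_apply, Matrix.add_apply, Matrix.conjTranspose_apply, smul_eq_mul,
      Complex.normSq_apply]
    simp
    nlinarith [sq_nonneg ((B k i).re - (B i k).re), sq_nonneg ((B k i).im + (B i k).im)]
  refine (Finset.sum_le_sum fun i _ => Finset.sum_le_sum fun k _ => h1 i k).trans_eq ?_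
  simp_rw [Finset.sum_add_distrib, ← Finset.mul_sum]
  rw [Finset.sum_comm (f := fun i k => Complex.normSq (B i k))]
  ring

theorem SATuple.norm_sq_le_opNorm (x : SATuple m N) : ‖x‖ ^ 2 ≤ N * ∑ j, opNorm (x.mat j) ^ 2 := by
  rw [← real_inner_self_eq_norm_sq]
  change SATuple.traceInner _ _ ≤ _
  rw [SATuple.traceInner_self, Finset.mul_sum]
  refine Finset.sum_le_sum fun j _ => ?_
  refine (Finset.sum_le_sum fun i _ => ?_).trans_eq (b := ∑ _i : Fin N, opNorm (x.mat j) ^ 2) ?_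
  · simp_rw [Complex.normSq_eq_norm_sq]
    exact sum_norm_sq_col_le _ i
  · simp

theorem SATuple.norm_le_opNorm {x : SATuple m N} {r : ℝ} (hr : 0 ≤ r)
    (hx : ∑ j, opNorm (x.mat j) ≤ r) : ‖x‖ ≤ √N * r := by
  refine le_of_sq_le_sq (x.norm_sq_le_opNorm.trans ?_) (by positivity)
  rw [mul_pow, Real.sq_sqrt (Nat.cast_nonneg N)]
  gcongr
  refine (Finset.sum_sq_le_sq_sum_of_nonneg fun j _ => opNorm_nonneg _).trans ?_
  exact pow_le_pow_left₀ (Finset.sum_nonneg fun j _ => opNorm_nonneg _) hx 2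

end OpNorm

/-! ### Trace polynomials as functions -/

section TraceFun

variable {m : ℕ}

/-- The functions obtained by evaluating operator-valued trace polynomials on tuples of
self-adjoint matrices. -/
inductive IsTraceFun : (∀ N, SATuple m N → Matrix (Fin N) (Fin N) ℂ) → Prop
  | var (j : Fin m) : IsTraceFun fun _ x => x.mat j
  | one : IsTraceFun fun _ _ => 1
  | add {F G : ∀ N, SATuple m N → Matrix (Fin N) (Fin N) ℂ} : IsTraceFun F → IsTraceFun G →
      IsTraceFun fun N x => F N x + G N x
  | smul (c : ℂ) {F : ∀ N, SATuple m N → Matrix (Fin N) (Fin N) ℂ} : IsTraceFun F →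
      IsTraceFun fun N x => c • F N x
  | mul {F G : ∀ N, SATuple m N → Matrix (Fin N) (Fin N) ℂ} : IsTraceFun F → IsTraceFun G →
      IsTraceFun fun N x => F N x * G N x
  | traceMul {F G : ∀ N, SATuple m N → Matrix (Fin N) (Fin N) ℂ} : IsTraceFun F →
      IsTraceFun G → IsTraceFun fun N x => ntr (F N x) • G N x

theorem traceNC_eq {N : ℕ} (x : Fin m → Matrix (Fin N) (Fin N) ℂ) (p : NCPoly m) :
    traceNC x p = ntr (evalNC x p) := by
  simp [traceNC, ntr]

theorem evalTrP0_ι_mk {N : ℕ} (x : Fin m → Matrix (Fin N) (Fin N) ℂ) (p : NCPoly m) :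
    evalTrP0 x (SymmetricAlgebra.ι ℂ _ ((commSpan m).mkQ p)) = ntr (evalNC x p) := by
  rw [evalTrP0, SymmetricAlgebra.lift_ι_apply, Submodule.mkQ_apply, Submodule.liftQ_apply,
    traceNC_eq]

theorem evalTrP1_tmul {N : ℕ} (x : Fin m → Matrix (Fin N) (Fin N) ℂ) (a : TrP0 m)
    (p : NCPoly m) : evalTrP1 x (a ⊗ₜ[ℂ] p) = evalTrP0 x a • evalNC x p := by
  simp [evalTrP1]

theorem evalTrP1_mul {N : ℕ} (x : Fin m → Matrix (Fin N) (Fin N) ℂ) (f g : TrP1 m) :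
    evalTrP1 x (f * g) = evalTrP1 x f * evalTrP1 x g := by
  induction f using TensorProduct.induction_on with
  | zero => simp
  | add f₁ f₂ h₁ h₂ => simp [add_mul, h₁, h₂]
  | tmul a p =>
    induction g using TensorProduct.induction_on with
    | zero => simp
    | add g₁ g₂ h₁ h₂ => simp [mul_add, h₁, h₂]
    | tmul b q =>
      rw [Algebra.TensorProduct.tmul_mul_tmul, evalTrP1_tmul, evalTrP1_tmul, evalTrP1_tmul,
        map_mul, map_mul, smul_mul_smul_comm]

theorem exists_evalTrP0_eq_ntr (f : TrP1 m) :
    ∃ a : TrP0 m, ∀ (N : ℕ) (x : Fin m → Matrix (Fin N) (Fin N) ℂ),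
      evalTrP0 x a = ntr (evalTrP1 x f) := by
  induction f using TensorProduct.induction_on with
  | zero => exact ⟨0, fun N x => by simp [ntr]⟩
  | add f₁ f₂ h₁ h₂ =>
    obtain ⟨a, ha⟩ := h₁
    obtain ⟨b, hb⟩ := h₂
    exact ⟨a + b, fun N x => by rw [map_add, map_add, ntr_add, ha, hb]⟩
  | tmul a p =>
    exact ⟨a * SymmetricAlgebra.ι ℂ _ ((commSpan m).mkQ p), fun N x => by
      rw [map_mul, evalTrP0_ι_mk, evalTrP1_tmul, ntr_smul]⟩

theorem IsTraceFun.exists_eval {F : ∀ N, SATuple m N → Matrix (Fin N) (Fin N) ℂ}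
    (hF : IsTraceFun F) : ∃ f : TrP1 m, ∀ N x, F N x = evalTrP1 x.mat f := by
  induction hF with
  | var j => exact ⟨1 ⊗ₜ[ℂ] FreeAlgebra.ι ℂ j, fun N x => by
      rw [evalTrP1_tmul, map_one, one_smul, evalNC, FreeAlgebra.lift_ι_apply]⟩
  | one => exact ⟨1 ⊗ₜ[ℂ] 1, fun N x => by rw [evalTrP1_tmul, map_one, one_smul, map_one]⟩
  | add _ _ h₁ h₂ =>
    obtain ⟨f, hf⟩ := h₁
    obtain ⟨g, hg⟩ := h₂
    exact ⟨f + g, fun N x => by simp only [map_add, hf, hg]⟩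
  | smul c _ h =>
    obtain ⟨f, hf⟩ := h
    exact ⟨c • f, fun N x => by simp only [map_smul, hf]⟩
  | mul _ _ h₁ h₂ =>
    obtain ⟨f, hf⟩ := h₁
    obtain ⟨g, hg⟩ := h₂
    exact ⟨f * g, fun N x => by simp only [evalTrP1_mul, hf, hg]⟩
  | traceMul _ _ h₁ h₂ =>
    obtain ⟨f, hf⟩ := h₁
    obtain ⟨g, hg⟩ := h₂
    obtain ⟨a, ha⟩ := exists_evalTrP0_eq_ntr f
    exact ⟨(a ⊗ₜ[ℂ] 1) * g, fun N x => by
      simp only [evalTrP1_mul, evalTrP1_tmul, map_one, ha, hf, hg, smul_mul_assoc, one_mul]⟩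

theorem isTraceFun_zero : IsTraceFun fun N (_ : SATuple m N) => 0 := by
  have := IsTraceFun.smul 0 (IsTraceFun.one (m := m))
  simpa using this

theorem isTraceFun_evalNC (p : NCPoly m) :
    IsTraceFun fun N (x : SATuple m N) => evalNC x.mat p := by
  induction p using FreeAlgebra.induction with
  | grade0 c =>
    have := IsTraceFun.smul c (IsTraceFun.one (m := m))
    simpa [Algebra.algebraMap_eq_smul_one] using this
  | grade1 j =>
    have := IsTraceFun.var j
    simpa [evalNC] using this
  | mul p q hp hq => simpa using hp.mul hq
  | add p q hp hq => simpa using hp.add hq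

theorem isTraceFun_evalTrP0_smul (a : TrP0 m) {G : ∀ N, SATuple m N → Matrix (Fin N) (Fin N) ℂ}
    (hG : IsTraceFun G) : IsTraceFun fun N x => evalTrP0 x.mat a • G N x := by
  induction a using SymmetricAlgebra.induction generalizing G with
  | algebraMap c =>
    simpa using hG.smul c
  | ι q =>
    obtain ⟨p, rfl⟩ := (commSpan m).mkQ_surjective q
    simp_rw [evalTrP0_ι_mk]
    exact (isTraceFun_evalNC p).traceMul hG
  | mul a b ha hb => simpa [mul_smul] using ha (hb hG)
  | add a b ha hb => simpa [add_smul] using (ha hG).add (hb hG)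

/-- With `IsTraceFun.exists_eval`, this identifies `IsTraceFun` with the evaluations of `TrP1`, so
later arguments can induct on six constructors instead of handling tensors and the symmetric
algebra. -/
theorem isTraceFun_evalTrP1 (f : TrP1 m) :
    IsTraceFun fun N (x : SATuple m N) => evalTrP1 x.mat f := by
  induction f using TensorProduct.induction_on with
  | zero => simpa using isTraceFun_zero
  | add f g hf hg => simpa using hf.add hg
  | tmul a p =>
    simp_rw [evalTrP1_tmul]
    exact isTraceFun_evalTrP0_smul a (isTraceFun_evalNC p)

namespace IsTraceFun

variable {F : ∀ N, SATuple m N → Matrix (Fin N) (Fin N) ℂ}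

theorem conjTranspose (hF : IsTraceFun F) : IsTraceFun fun N x => (F N x).conjTranspose := by
  induction hF with
  | var j => simpa only [SATuple.mat_conjTranspose] using IsTraceFun.var j
  | one => simpa only [Matrix.conjTranspose_one] using IsTraceFun.one
  | add _ _ h₁ h₂ => simpa only [Matrix.conjTranspose_add] using h₁.add h₂
  | smul c _ h => simpa only [Matrix.conjTranspose_smul] using h.smul (star c)
  | mul _ _ h₁ h₂ => simpa only [Matrix.conjTranspose_mul] using h₂.mul h₁
  | traceMul _ _ h₁ h₂ =>
    simpa only [Matrix.conjTranspose_smul, ← ntr_conjTranspose] using h₁.traceMul h₂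

/-- The normalized trace is bounded by the operator norm, so the bound depends on the polynomial but
not on `N`. -/
theorem opNorm_le (hF : IsTraceFun F) : ∃ (K : ℝ) (n : ℕ), 0 ≤ K ∧
    ∀ (N : ℕ) (x : SATuple m N) (r : ℝ), 0 ≤ r → (∀ j, opNorm (x.mat j) ≤ r) →
      opNorm (F N x) ≤ K * (1 + r) ^ n := by
  have hmul : ∀ {K₁ K₂ r a b : ℝ} {n₁ n₂ : ℕ}, 0 ≤ K₁ → 0 ≤ r → 0 ≤ a → 0 ≤ b →
      a ≤ K₁ * (1 + r) ^ n₁ → b ≤ K₂ * (1 + r) ^ n₂ →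
      a * b ≤ K₁ * K₂ * (1 + r) ^ (n₁ + n₂) := by
    intro K₁ K₂ r a b n₁ n₂ hK hr ha hb h1 h2
    calc a * b ≤ (K₁ * (1 + r) ^ n₁) * (K₂ * (1 + r) ^ n₂) := by gcongr
      _ = _ := by ring
  induction hF with
  | var j => exact ⟨1, 1, zero_le_one, fun N x r hr hx => by linarith [hx j]⟩
  | one => exact ⟨1, 0, zero_le_one, fun N x r hr hx => by simpa using opNorm_one_le⟩
  | add _ _ h₁ h₂ =>
    obtain ⟨K₁, n₁, hK₁, h₁⟩ := h₁
    obtain ⟨K₂, n₂, hK₂, h₂⟩ := h₂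
    refine ⟨K₁ + K₂, max n₁ n₂, by positivity, fun N x r hr hx => ?_⟩
    have h1r : 1 ≤ 1 + r := by linarith
    calc _ ≤ _ := opNorm_add_le _ _
      _ ≤ K₁ * (1 + r) ^ n₁ + K₂ * (1 + r) ^ n₂ := add_le_add (h₁ N x r hr hx) (h₂ N x r hr hx)
      _ ≤ K₁ * (1 + r) ^ max n₁ n₂ + K₂ * (1 + r) ^ max n₁ n₂ := by
        gcongr
        · exact le_max_left _ _
        · exact le_max_right _ _
      _ = _ := by ring
  | smul c _ h =>
    obtain ⟨K, n, hK, h⟩ := h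
    refine ⟨‖c‖ * K, n, by positivity, fun N x r hr hx => ?_⟩
    rw [opNorm_smul, mul_assoc]
    gcongr
    exact h N x r hr hx
  | mul _ _ h₁ h₂ =>
    obtain ⟨K₁, n₁, hK₁, h₁⟩ := h₁
    obtain ⟨K₂, n₂, hK₂, h₂⟩ := h₂
    refine ⟨K₁ * K₂, n₁ + n₂, by positivity, fun N x r hr hx => ?_⟩
    exact (opNorm_mul_le _ _).trans (hmul hK₁ hr (opNorm_nonneg _) (opNorm_nonneg _)
      (h₁ N x r hr hx) (h₂ N x r hr hx))
  | traceMul _ _ h₁ h₂ =>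
    obtain ⟨K₁, n₁, hK₁, h₁⟩ := h₁
    obtain ⟨K₂, n₂, hK₂, h₂⟩ := h₂
    refine ⟨K₁ * K₂, n₁ + n₂, by positivity, fun N x r hr hx => ?_⟩
    rw [opNorm_smul]
    exact hmul hK₁ hr (norm_nonneg _) (opNorm_nonneg _)
      ((norm_ntr_le _).trans (h₁ N x r hr hx)) (h₂ N x r hr hx)

theorem comp (hF : IsTraceFun F) {Φ : ∀ N, SATuple m N → SATuple m N}
    (hΦ : ∀ j, IsTraceFun fun N x => (Φ N x).mat j) : IsTraceFun fun N x => F N (Φ N x) := by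
  induction hF with
  | var j => exact hΦ j
  | one => exact IsTraceFun.one
  | add _ _ h₁ h₂ => exact h₁.add h₂
  | smul c _ h => exact h.smul c
  | mul _ _ h₁ h₂ => exact h₁.mul h₂
  | traceMul _ _ h₁ h₂ => exact h₁.traceMul h₂

end IsTraceFun

end TraceFun

/-! ### Functions of polynomial growth -/

section PolyGrowth

variable {m N : ℕ}

/-- Continuous functions of polynomial growth. -/
def PolyGrowth (g : SATuple m N → ℂ) : Prop :=
  Continuous g ∧ ∃ (K : ℝ) (n : ℕ), 0 ≤ K ∧ ∀ y, ‖g y‖ ≤ K * (1 + ‖y‖) ^ n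

theorem polyGrowth_const (c : ℂ) : PolyGrowth fun _ : SATuple m N => c :=
  ⟨continuous_const, ‖c‖, 0, norm_nonneg c, fun y => by simp⟩

theorem PolyGrowth.add {f g : SATuple m N → ℂ} (hf : PolyGrowth f) (hg : PolyGrowth g) :
    PolyGrowth fun y => f y + g y := by
  obtain ⟨hfc, K₁, n₁, hK₁, h₁⟩ := hf
  obtain ⟨hgc, K₂, n₂, hK₂, h₂⟩ := hg
  refine ⟨hfc.add hgc, K₁ + K₂, max n₁ n₂, by positivity, fun y => ?_⟩
  have h1r : 1 ≤ 1 + ‖y‖ := by linarith [norm_nonneg y]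
  calc _ ≤ _ := norm_add_le _ _
    _ ≤ K₁ * (1 + ‖y‖) ^ n₁ + K₂ * (1 + ‖y‖) ^ n₂ := add_le_add (h₁ y) (h₂ y)
    _ ≤ K₁ * (1 + ‖y‖) ^ max n₁ n₂ + K₂ * (1 + ‖y‖) ^ max n₁ n₂ := by
      gcongr
      · exact le_max_left _ _
      · exact le_max_right _ _
    _ = _ := by ring

theorem PolyGrowth.mul {f g : SATuple m N → ℂ} (hf : PolyGrowth f) (hg : PolyGrowth g) :
    PolyGrowth fun y => f y * g y := by
  obtain ⟨hfc, K₁, n₁, hK₁, h₁⟩ := hf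
  obtain ⟨hgc, K₂, n₂, hK₂, h₂⟩ := hg
  refine ⟨hfc.mul hgc, K₁ * K₂, n₁ + n₂, by positivity, fun y => ?_⟩
  rw [norm_mul]
  calc _ ≤ (K₁ * (1 + ‖y‖) ^ n₁) * (K₂ * (1 + ‖y‖) ^ n₂) := by
        gcongr
        · exact h₁ y
        · exact h₂ y
    _ = _ := by ring

theorem PolyGrowth.sum {ι : Type*} (s : Finset ι) {f : ι → SATuple m N → ℂ}
    (hf : ∀ i ∈ s, PolyGrowth (f i)) : PolyGrowth fun y => ∑ i ∈ s, f i y := by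
  classical
  induction s using Finset.induction_on with
  | empty => simpa using polyGrowth_const 0
  | insert a s ha ih =>
    simp_rw [Finset.sum_insert ha]
    exact (hf a (Finset.mem_insert_self a s)).add
      (ih fun i hi => hf i (Finset.mem_insert_of_mem hi))

theorem PolyGrowth.list_sum {ι : Type*} (l : List ι) {f : ι → SATuple m N → ℂ}
    (hf : ∀ i, PolyGrowth (f i)) : PolyGrowth fun y => (l.map fun i => f i y).sum := by
  induction l with
  | nil => simpa using polyGrowth_const 0
  | cons a l ih => simpa using (hf a).add ih

theorem PolyGrowth.integrable {g : SATuple m N → ℂ} (hg : PolyGrowth g) {s : ℝ} (hs : 0 < s) :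
    Integrable g (isoGaussian s) := by
  obtain ⟨hgc, K, n, _, h⟩ := hg
  exact integrable_of_pow_bound hs hgc.aestronglyMeasurable K n h

theorem SATuple.norm_entry_le (y : SATuple m N) (k : Fin m) (i j : Fin N) :
    ‖y.mat k i j‖ ≤ ‖y‖ := by
  refine le_of_sq_le_sq ?_ (norm_nonneg y)
  rw [← real_inner_self_eq_norm_sq y]
  change _ ≤ SATuple.traceInner _ _
  rw [SATuple.traceInner_self, ← Complex.normSq_eq_norm_sq]
  refine le_trans ?_ (Finset.single_le_sum (fun k _ => Finset.sum_nonneg fun _ _ =>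
    Finset.sum_nonneg fun _ _ => Complex.normSq_nonneg _) (Finset.mem_univ k))
  refine le_trans ?_ (Finset.single_le_sum (fun _ _ =>
    Finset.sum_nonneg fun _ _ => Complex.normSq_nonneg _) (Finset.mem_univ j))
  exact Finset.single_le_sum (f := fun i => Complex.normSq (y.mat k i j))
    (fun _ _ => Complex.normSq_nonneg _) (Finset.mem_univ i)

/-- An entry of one of the matrices, as a linear map. -/
def SATuple.entry (k : Fin m) (i j : Fin N) : SATuple m N →ₗ[ℝ] ℂ where
  toFun y := y.mat k i j
  map_add' _ _ := rfl
  map_smul' _ _ := rfl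

theorem polyGrowth_entry (k : Fin m) (i j : Fin N) :
    PolyGrowth fun y : SATuple m N => y.mat k i j :=
  ⟨(SATuple.entry k i j).continuous_of_finiteDimensional, 1, 1, zero_le_one, fun y => by
    have := y.norm_entry_le k i j
    linarith⟩

/-! ### Gaussian integration by parts for matrix entries -/

/-- The tuple with a single non-zero self-adjoint matrix. -/
noncomputable def SATuple.single (k : Fin m) (Z : selfAdjoint (Matrix (Fin N) (Fin N) ℂ)) :
    SATuple m N := fun l => if l = k then Z else 0

theorem SATuple.single_mat (k l : Fin m) (Z : selfAdjoint (Matrix (Fin N) (Fin N) ℂ)) :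
    (SATuple.single k Z).mat l = if l = k then (Z : Matrix (Fin N) (Fin N) ℂ) else 0 := by
  by_cases h : l = k <;> simp [SATuple.mat, SATuple.single, h]

theorem SATuple.inner_single (k : Fin m) (Z : selfAdjoint (Matrix (Fin N) (Fin N) ℂ))
    (y : SATuple m N) : inner ℝ (SATuple.single k Z) y =
      (Matrix.trace ((Z : Matrix (Fin N) (Fin N) ℂ) * y.mat k)).re := by
  rw [SATuple.inner_def]
  simp [SATuple.single_mat, ite_mul, apply_ite]

/-- An entry is the trace pairing with a matrix unit, which need not be self-adjoint; its Hermitian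
and anti-Hermitian parts express the entry through two real directions. -/
theorem exists_matrix_unit_eq (i j : Fin N) :
    ∃ Z₁ Z₂ : selfAdjoint (Matrix (Fin N) (Fin N) ℂ),
      Matrix.single j i (1 : ℂ) = (Z₁ : Matrix (Fin N) (Fin N) ℂ) + Complex.I • (Z₂ : Matrix _ _ ℂ) ∧
      ∀ (m : ℕ) (k : Fin m) (y : SATuple m N),
        ((inner ℝ (SATuple.single k Z₁) y : ℝ) : ℂ) +
          Complex.I * ((inner ℝ (SATuple.single k Z₂) y : ℝ) : ℂ) = y.mat k i j := by
  have hI : (Complex.I : ℂ) ≠ 0 := Complex.I_ne_zero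
  refine ⟨⟨(1 / 2 : ℂ) • (Matrix.single j i 1 + Matrix.single i j 1), ?_⟩,
    ⟨(1 / (2 * Complex.I) : ℂ) • (Matrix.single j i 1 - Matrix.single i j 1), ?_⟩, ?_, ?_⟩
  · rw [selfAdjoint.mem_iff, Matrix.star_eq_conjTranspose]
    simp [Matrix.conjTranspose_single, add_comm]
  · rw [selfAdjoint.mem_iff, Matrix.star_eq_conjTranspose]
    simp [Matrix.conjTranspose_single]
    rw [← smul_neg, neg_sub]
  · simp only [smul_smul]
    rw [show Complex.I * (1 / (2 * Complex.I)) = 1 / 2 by field_simp]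
    module
  · intro m k y
    have hy : y.mat k j i = star (y.mat k i j) := by
      conv_lhs => rw [← y.mat_conjTranspose k]
      rfl
    rw [SATuple.inner_single, SATuple.inner_single]
    simp only [Matrix.smul_mul, Matrix.trace_smul, Matrix.add_mul, Matrix.sub_mul,
      Matrix.trace_add, Matrix.trace_sub, Matrix.trace_single_mul, smul_eq_mul, hy]
    apply Complex.ext
    · simp
      ring
    · simp
      ring

/-- Real integration by parts along the two Hermitian directions, recombined by the complex
linearity `hlin` into a derivative along the matrix unit. -/
theorem gue_integral_by_parts (hN : 1 ≤ N) {t : ℝ} (ht : 0 < t) (k : Fin m) (i j : Fin N)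
    {g : SATuple m N → ℂ} {g' : SATuple m N → Matrix (Fin N) (Fin N) ℂ → ℂ} (hg : PolyGrowth g)
    (hg' : ∀ Z, PolyGrowth fun y => g' y Z)
    (hlin : ∀ y Z₁ Z₂, g' y (Z₁ + Complex.I • Z₂) = g' y Z₁ + Complex.I * g' y Z₂)
    (hd : ∀ y (Z : selfAdjoint (Matrix (Fin N) (Fin N) ℂ)),
      HasLineDerivAt ℝ g (g' y Z) y (SATuple.single k Z)) :
    ∫ y, y.mat k i j * g y ∂(gue m N t) =
      (t / N : ℂ) * ∫ y, g' y (Matrix.single j i 1) ∂(gue m N t) := by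
  have hs : 0 < t / N := by positivity
  obtain ⟨Z₁, Z₂, hZ, hy⟩ := exists_matrix_unit_eq i j
  rw [gue_eq_isoGaussian hN]
  have hpg : ∀ Z : selfAdjoint (Matrix (Fin N) (Fin N) ℂ), PolyGrowth fun y : SATuple m N =>
      (((inner ℝ (SATuple.single k Z) y : ℝ)) : ℂ) * g y := fun Z => by
    refine PolyGrowth.mul ⟨by fun_prop, ‖SATuple.single k Z‖, 1, norm_nonneg _, fun y => ?_⟩ hg
    rw [Complex.norm_real]
    refine (norm_inner_le_norm _ _).trans ?_
    nlinarith [norm_nonneg (SATuple.single k Z), norm_nonneg y]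
  have key : ∀ Z : selfAdjoint (Matrix (Fin N) (Fin N) ℂ),
      ∫ y, (((inner ℝ (SATuple.single k Z) y : ℝ)) : ℂ) * g y ∂(isoGaussian (t / N)) =
      (t / N : ℂ) * ∫ y, g' y Z ∂(isoGaussian (t / N)) := fun Z => by
    have h := isoGaussian_integral_by_parts hs (SATuple.single k Z) (fun y => hd y Z)
      (hg.integrable hs) ((hg' Z).integrable hs) (by simpa using (hpg Z).integrable hs)
    simpa using h
  simp_rw [← hy, hZ, hlin, add_mul, mul_assoc]
  rw [integral_add ((hpg Z₁).integrable hs) (((hpg Z₂).integrable hs).const_mul _),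
    integral_add ((hg' Z₁).integrable hs) (((hg' Z₂).integrable hs).const_mul _),
    integral_const_mul, integral_const_mul, key, key]
  ring

end PolyGrowth

/-! ### Words in two families of matrices -/

section Words

variable {m N : ℕ}

/-- The value of a word in the letters `X_j` (left) and `Y_j` (right). -/
def wordVal (x y : Fin m → Matrix (Fin N) (Fin N) ℂ) (w : List (Fin m ⊕ Fin m)) :
    Matrix (Fin N) (Fin N) ℂ := (w.map (Sum.elim x y)).prod

/-- The product of the normalized traces of a list of words. -/
noncomputable def traceVal (x y : Fin m → Matrix (Fin N) (Fin N) ℂ)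
    (L : List (List (Fin m ⊕ Fin m))) : ℂ := (L.map fun u => ntr (wordVal x y u)).prod

/-- The value of a trace monomial. -/
noncomputable def monVal (x y : Fin m → Matrix (Fin N) (Fin N) ℂ)
    (L : List (List (Fin m ⊕ Fin m))) (w : List (Fin m ⊕ Fin m)) : Matrix (Fin N) (Fin N) ℂ :=
  traceVal x y L • wordVal x y w

theorem wordVal_nil (x y : Fin m → Matrix (Fin N) (Fin N) ℂ) : wordVal x y [] = 1 := rfl

theorem wordVal_cons (x y : Fin m → Matrix (Fin N) (Fin N) ℂ) (a : Fin m ⊕ Fin m)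
    (w : List (Fin m ⊕ Fin m)) : wordVal x y (a :: w) = Sum.elim x y a * wordVal x y w := by
  simp [wordVal]

theorem wordVal_append (x y : Fin m → Matrix (Fin N) (Fin N) ℂ) (w w' : List (Fin m ⊕ Fin m)) :
    wordVal x y (w ++ w') = wordVal x y w * wordVal x y w' := by
  simp [wordVal]

theorem traceVal_nil (x y : Fin m → Matrix (Fin N) (Fin N) ℂ) : traceVal x y [] = 1 := rfl

theorem traceVal_cons (x y : Fin m → Matrix (Fin N) (Fin N) ℂ) (u : List (Fin m ⊕ Fin m))
    (L : List (List (Fin m ⊕ Fin m))) :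
    traceVal x y (u :: L) = ntr (wordVal x y u) * traceVal x y L := by
  simp [traceVal]

theorem traceVal_append (x y : Fin m → Matrix (Fin N) (Fin N) ℂ)
    (L L' : List (List (Fin m ⊕ Fin m))) :
    traceVal x y (L ++ L') = traceVal x y L * traceVal x y L' := by
  simp [traceVal]

/-- All ways to split a word at an occurrence of the letter `Y_k`. -/
def wordSplits (k : Fin m) : List (Fin m ⊕ Fin m) →
    List (List (Fin m ⊕ Fin m) × List (Fin m ⊕ Fin m))
  | [] => []
  | a :: w => (if a = Sum.inr k then [([], w)] else []) ++
      (wordSplits k w).map fun p => (a :: p.1, p.2)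

/-- The cyclic derivatives of the factors of a product of traces. -/
def traceSplits (k : Fin m) : List (List (Fin m ⊕ Fin m)) →
    List (List (List (Fin m ⊕ Fin m)) × List (Fin m ⊕ Fin m))
  | [] => []
  | u :: L => (wordSplits k u).map (fun p => (L, p.2 ++ p.1)) ++
      (traceSplits k L).map fun p => (u :: p.1, p.2)

/-- The number of letters `Y_j` in a word. -/
def wordDeg (w : List (Fin m ⊕ Fin m)) : ℕ := w.countP Sum.isRight

/-- The number of letters `Y_j` in a list of words. -/
def traceDeg (L : List (List (Fin m ⊕ Fin m))) : ℕ := (L.map wordDeg).sum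

theorem wordDeg_append (w w' : List (Fin m ⊕ Fin m)) :
    wordDeg (w ++ w') = wordDeg w + wordDeg w' := by
  simp [wordDeg]

theorem wordDeg_cons (a : Fin m ⊕ Fin m) (w : List (Fin m ⊕ Fin m)) :
    wordDeg (a :: w) = wordDeg w + if a.isRight then 1 else 0 := by
  simp [wordDeg, List.countP_cons]

theorem traceDeg_cons (u : List (Fin m ⊕ Fin m)) (L : List (List (Fin m ⊕ Fin m))) :
    traceDeg (u :: L) = wordDeg u + traceDeg L := by
  simp [traceDeg]

theorem wordDeg_of_mem_wordSplits {k : Fin m} {w : List (Fin m ⊕ Fin m)}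
    {p : List (Fin m ⊕ Fin m) × List (Fin m ⊕ Fin m)} (hp : p ∈ wordSplits k w) :
    wordDeg p.1 + wordDeg p.2 + 1 = wordDeg w := by
  induction w generalizing p with
  | nil => simp [wordSplits] at hp
  | cons a w ih =>
    rw [wordSplits, List.mem_append] at hp
    rcases hp with hp | hp
    · split_ifs at hp with ha
      · simp only [List.mem_singleton] at hp
        subst hp ha
        simp [wordDeg, List.countP_cons]
      · simp at hp
    · obtain ⟨q, hq, rfl⟩ := List.mem_map.1 hp
      have := ih hq
      simp only [wordDeg_cons]
      omega

theorem traceDeg_of_mem_traceSplits {k : Fin m} {L : List (List (Fin m ⊕ Fin m))}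
    {p : List (List (Fin m ⊕ Fin m)) × List (Fin m ⊕ Fin m)} (hp : p ∈ traceSplits k L) :
    traceDeg p.1 + wordDeg p.2 + 1 = traceDeg L := by
  induction L generalizing p with
  | nil => simp [traceSplits] at hp
  | cons u L ih =>
    rw [traceSplits, List.mem_append] at hp
    rcases hp with hp | hp
    · obtain ⟨q, hq, rfl⟩ := List.mem_map.1 hp
      have := wordDeg_of_mem_wordSplits hq
      simp only [wordDeg_append, traceDeg_cons]
      omega
    · obtain ⟨q, hq, rfl⟩ := List.mem_map.1 hp
      have := ih hq
      simp only [traceDeg_cons]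
      omega

theorem polyGrowth_wordVal (x : Fin m → Matrix (Fin N) (Fin N) ℂ) (w : List (Fin m ⊕ Fin m))
    (i j : Fin N) : PolyGrowth fun y : SATuple m N => wordVal x y.mat w i j := by
  induction w generalizing i with
  | nil => exact polyGrowth_const _
  | cons a w ih =>
    simp_rw [wordVal_cons, Matrix.mul_apply]
    refine PolyGrowth.sum _ fun l _ => PolyGrowth.mul ?_ (ih l)
    cases a with
    | inl k => exact polyGrowth_const _
    | inr k => exact polyGrowth_entry k i l

theorem polyGrowth_ntr {F : SATuple m N → Matrix (Fin N) (Fin N) ℂ}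
    (hF : ∀ i j, PolyGrowth fun y => F y i j) : PolyGrowth fun y => ntr (F y) :=
  (polyGrowth_const _).mul (PolyGrowth.sum _ fun i _ => hF i i)

theorem polyGrowth_traceVal (x : Fin m → Matrix (Fin N) (Fin N) ℂ)
    (L : List (List (Fin m ⊕ Fin m))) : PolyGrowth fun y : SATuple m N => traceVal x y.mat L := by
  induction L with
  | nil => exact polyGrowth_const _
  | cons u L ih =>
    simp_rw [traceVal_cons]
    exact (polyGrowth_ntr (polyGrowth_wordVal x u)).mul ih

theorem polyGrowth_monVal (x : Fin m → Matrix (Fin N) (Fin N) ℂ)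
    (L : List (List (Fin m ⊕ Fin m))) (w : List (Fin m ⊕ Fin m)) (i j : Fin N) :
    PolyGrowth fun y : SATuple m N => monVal x y.mat L w i j :=
  (polyGrowth_traceVal x L).mul (polyGrowth_wordVal x w i j)

end Words

/-! ### Integration by parts for trace monomials -/

section WordDeriv

variable {m N : ℕ}

theorem hasLineDerivAt_mul {E : Type*} [AddCommGroup E] [Module ℝ E] {f g : E → ℂ} {f' g' : ℂ}
    {y v : E} (hf : HasLineDerivAt ℝ f f' y v) (hg : HasLineDerivAt ℝ g g' y v) :
    HasLineDerivAt ℝ (fun y => f y * g y) (f' * g y + f y * g') y v := by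
  have h := HasDerivAt.fun_mul hf hg
  rw [HasLineDerivAt]
  simpa using h

theorem hasLineDerivAt_sum {E ι : Type*} [AddCommGroup E] [Module ℝ E] {s : Finset ι}
    {f : ι → E → ℂ} {f' : ι → ℂ} {y v : E} (hf : ∀ i ∈ s, HasLineDerivAt ℝ (f i) (f' i) y v) :
    HasLineDerivAt ℝ (fun y => ∑ i ∈ s, f i y) (∑ i ∈ s, f' i) y v :=
  HasDerivAt.fun_sum hf

/-- The derivative of a word when `Y_k` moves in the direction `Z`. -/
def wordDeriv (x y : Fin m → Matrix (Fin N) (Fin N) ℂ) (k : Fin m)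
    (Z : Matrix (Fin N) (Fin N) ℂ) : List (Fin m ⊕ Fin m) → Matrix (Fin N) (Fin N) ℂ
  | [] => 0
  | a :: w => (if a = Sum.inr k then Z * wordVal x y w else 0) +
      Sum.elim x y a * wordDeriv x y k Z w

/-- The derivative of a product of traces when `Y_k` moves in the direction `Z`. -/
noncomputable def traceDeriv (x y : Fin m → Matrix (Fin N) (Fin N) ℂ) (k : Fin m)
    (Z : Matrix (Fin N) (Fin N) ℂ) : List (List (Fin m ⊕ Fin m)) → ℂ
  | [] => 0
  | u :: L => ntr (wordDeriv x y k Z u) * traceVal x y L +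
      ntr (wordVal x y u) * traceDeriv x y k Z L

theorem wordDeriv_eq_sum (x y : Fin m → Matrix (Fin N) (Fin N) ℂ) (k : Fin m)
    (Z : Matrix (Fin N) (Fin N) ℂ) (w : List (Fin m ⊕ Fin m)) :
    wordDeriv x y k Z w =
      ((wordSplits k w).map fun p => wordVal x y p.1 * Z * wordVal x y p.2).sum := by
  induction w with
  | nil => simp [wordDeriv, wordSplits]
  | cons a w ih =>
    rw [wordDeriv, wordSplits, List.map_append, List.sum_append, List.map_map, ih,
      ← List.sum_map_mul_left]
    congr 1
    · split_ifs <;> simp [wordVal_nil]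
    · congr 1
      refine List.map_congr_left fun p _ => ?_
      simp [wordVal_cons, mul_assoc]

theorem ntr_list_sum {ι : Type*} (l : List ι) (f : ι → Matrix (Fin N) (Fin N) ℂ) :
    ntr (l.map f).sum = (l.map fun i => ntr (f i)).sum := by
  induction l with
  | nil => simp [ntr]
  | cons a l ih => simp [ntr_add, ih]

theorem traceDeriv_eq_sum (x y : Fin m → Matrix (Fin N) (Fin N) ℂ) (k : Fin m)
    (Z : Matrix (Fin N) (Fin N) ℂ) (L : List (List (Fin m ⊕ Fin m))) :
    traceDeriv x y k Z L =
      ((traceSplits k L).map fun p => traceVal x y p.1 * ntr (wordVal x y p.2 * Z)).sum := by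
  induction L with
  | nil => simp [traceDeriv, traceSplits]
  | cons u L ih =>
    rw [traceDeriv, traceSplits, List.map_append, List.sum_append, List.map_map, List.map_map, ih,
      ← List.sum_map_mul_left, wordDeriv_eq_sum, ntr_list_sum, ← List.sum_map_mul_right]
    congr 1
    · congr 1
      refine List.map_congr_left fun p _ => ?_
      simp only [Function.comp_apply]
      rw [wordVal_append, mul_comm, mul_assoc, ntr_mul_comm, ntr_mul_comm _ Z, mul_assoc]
    · congr 1
      refine List.map_congr_left fun p _ => ?_
      simp [traceVal_cons, mul_assoc]

theorem hasLineDerivAt_wordVal (x : Fin m → Matrix (Fin N) (Fin N) ℂ) (y : SATuple m N)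
    (k : Fin m) (Z : selfAdjoint (Matrix (Fin N) (Fin N) ℂ)) (w : List (Fin m ⊕ Fin m))
    (i j : Fin N) :
    HasLineDerivAt ℝ (fun y : SATuple m N => wordVal x y.mat w i j)
      (wordDeriv x y.mat k Z w i j) y (SATuple.single k Z) := by
  induction w generalizing i with
  | nil => exact hasDerivAt_const _ _
  | cons a w ih =>
    have ha : ∀ l, HasLineDerivAt ℝ (fun y : SATuple m N => Sum.elim x y.mat a i l)
        ((if a = Sum.inr k then (Z : Matrix (Fin N) (Fin N) ℂ) else 0) i l) y
        (SATuple.single k Z) := fun l => by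
      cases a with
      | inl q => exact hasDerivAt_const _ _
      | inr q =>
        have h1 : (fun r : ℝ => (y + r • SATuple.single k Z).mat q i l) = fun r : ℝ =>
            y.mat q i l + r • (SATuple.single k Z).mat q i l := rfl
        rw [HasLineDerivAt]
        simp only [Sum.elim_inr]
        rw [h1, SATuple.single_mat]
        have h2 := ((hasDerivAt_id (0 : ℝ)).smul_const
          ((if q = k then (Z : Matrix (Fin N) (Fin N) ℂ) else 0) i l)).const_add (y.mat q i l)
        simpa using h2
    simp_rw [wordVal_cons, Matrix.mul_apply]
    have h := hasLineDerivAt_sum (s := Finset.univ) fun l _ => hasLineDerivAt_mul (ha l) (ih l)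
    convert h using 1
    rw [wordDeriv, Finset.sum_add_distrib, Matrix.add_apply, Matrix.mul_apply]
    congr 1
    split_ifs
    · rw [Matrix.mul_apply]
    · simp

theorem hasLineDerivAt_ntr {F : SATuple m N → Matrix (Fin N) (Fin N) ℂ}
    {F' : Matrix (Fin N) (Fin N) ℂ} {y v : SATuple m N}
    (hF : ∀ i j, HasLineDerivAt ℝ (fun y => F y i j) (F' i j) y v) :
    HasLineDerivAt ℝ (fun y => ntr (F y)) (ntr F') y v :=
  HasDerivAt.const_mul (1 / (N : ℂ)) (hasLineDerivAt_sum (s := Finset.univ) fun i _ => hF i i)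

theorem hasLineDerivAt_traceVal (x : Fin m → Matrix (Fin N) (Fin N) ℂ) (y : SATuple m N)
    (k : Fin m) (Z : selfAdjoint (Matrix (Fin N) (Fin N) ℂ)) (L : List (List (Fin m ⊕ Fin m))) :
    HasLineDerivAt ℝ (fun y : SATuple m N => traceVal x y.mat L)
      (traceDeriv x y.mat k Z L) y (SATuple.single k Z) := by
  induction L with
  | nil => exact hasDerivAt_const _ _
  | cons u L ih =>
    simp_rw [traceVal_cons]
    exact hasLineDerivAt_mul (hasLineDerivAt_ntr (hasLineDerivAt_wordVal x y k Z u)) ih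

theorem wordDeriv_add_smul (x y : Fin m → Matrix (Fin N) (Fin N) ℂ) (k : Fin m) (c : ℂ)
    (Z₁ Z₂ : Matrix (Fin N) (Fin N) ℂ) (w : List (Fin m ⊕ Fin m)) :
    wordDeriv x y k (Z₁ + c • Z₂) w = wordDeriv x y k Z₁ w + c • wordDeriv x y k Z₂ w := by
  induction w with
  | nil => simp [wordDeriv]
  | cons a w ih =>
    simp only [wordDeriv, ih]
    split_ifs
    · rw [add_mul, smul_mul_assoc, mul_add, mul_smul_comm, smul_add]
      abel
    · rw [mul_add, mul_smul_comm, smul_add, smul_zero]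
      abel

theorem traceDeriv_add_smul (x y : Fin m → Matrix (Fin N) (Fin N) ℂ) (k : Fin m) (c : ℂ)
    (Z₁ Z₂ : Matrix (Fin N) (Fin N) ℂ) (L : List (List (Fin m ⊕ Fin m))) :
    traceDeriv x y k (Z₁ + c • Z₂) L = traceDeriv x y k Z₁ L + c * traceDeriv x y k Z₂ L := by
  induction L with
  | nil => simp [traceDeriv]
  | cons u L ih =>
    simp only [traceDeriv, ih, wordDeriv_add_smul, ntr_add, ntr_smul]
    ring

theorem polyGrowth_wordDeriv (x : Fin m → Matrix (Fin N) (Fin N) ℂ) (k : Fin m)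
    (Z : Matrix (Fin N) (Fin N) ℂ) (w : List (Fin m ⊕ Fin m)) (i j : Fin N) :
    PolyGrowth fun y : SATuple m N => wordDeriv x y.mat k Z w i j := by
  induction w generalizing i with
  | nil => exact polyGrowth_const _
  | cons a w ih =>
    simp_rw [wordDeriv, Matrix.add_apply]
    refine PolyGrowth.add ?_ ?_
    · split_ifs
      · simp_rw [Matrix.mul_apply]
        exact PolyGrowth.sum _ fun l _ => (polyGrowth_const _).mul (polyGrowth_wordVal x w l j)
      · exact polyGrowth_const _
    · simp_rw [Matrix.mul_apply]
      refine PolyGrowth.sum _ fun l _ => PolyGrowth.mul ?_ (ih l)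
      cases a with
      | inl k => exact polyGrowth_const _
      | inr k => exact polyGrowth_entry k i l

theorem polyGrowth_traceDeriv (x : Fin m → Matrix (Fin N) (Fin N) ℂ) (k : Fin m)
    (Z : Matrix (Fin N) (Fin N) ℂ) (L : List (List (Fin m ⊕ Fin m))) :
    PolyGrowth fun y : SATuple m N => traceDeriv x y.mat k Z L := by
  induction L with
  | nil => exact polyGrowth_const _
  | cons u L ih =>
    exact ((polyGrowth_ntr (polyGrowth_wordDeriv x k Z u)).mul (polyGrowth_traceVal x L)).add
      ((polyGrowth_ntr (polyGrowth_wordVal x u)).mul ih)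

theorem sum_list_sum {ι κ : Type*} (s : Finset κ) (l : List ι) (f : κ → ι → ℂ) :
    ∑ j ∈ s, (l.map (f j)).sum = (l.map fun i => ∑ j ∈ s, f j i).sum := by
  induction l with
  | nil => simp
  | cons a l ih => simp [Finset.sum_add_distrib, ih]

theorem list_sum_apply {ι : Type*} (l : List ι) (f : ι → Matrix (Fin N) (Fin N) ℂ) (i j : Fin N) :
    (l.map f).sum i j = (l.map fun p => f p i j).sum := by
  induction l with
  | nil => simp
  | cons a l ih => simp [ih]

/-- A matrix unit inserted between two factors closes the first one into an unnormalized trace. This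
gains a factor `N` over `ntr` and produces the leading terms. -/
theorem sum_wordDeriv_single (x y : Fin m → Matrix (Fin N) (Fin N) ℂ) (k : Fin m)
    (w : List (Fin m ⊕ Fin m)) (i b : Fin N) :
    ∑ j, wordDeriv x y k (Matrix.single j i 1) w j b =
      ((wordSplits k w).map fun p => (wordVal x y p.1).trace * wordVal x y p.2 i b).sum := by
  simp_rw [wordDeriv_eq_sum, list_sum_apply, sum_list_sum]
  congr 1
  refine List.map_congr_left fun p _ => ?_
  rw [Matrix.trace, Finset.sum_mul]
  refine Finset.sum_congr rfl fun j _ => ?_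
  simp [Matrix.mul_apply, Matrix.single_apply, Finset.sum_ite_eq, ite_and]

/-- A matrix unit inserted in a normalized trace reconnects the opened cyclic word to `w`, with a
factor `1 / N` instead of a gain of `N`. -/
theorem sum_traceDeriv_single (x y : Fin m → Matrix (Fin N) (Fin N) ℂ) (k : Fin m)
    (L : List (List (Fin m ⊕ Fin m))) (w : List (Fin m ⊕ Fin m)) (i b : Fin N) :
    ∑ j, traceDeriv x y k (Matrix.single j i 1) L * wordVal x y w j b =
      1 / (N : ℂ) * ((traceSplits k L).map fun p => monVal x y p.1 (p.2 ++ w) i b).sum := by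
  simp_rw [traceDeriv_eq_sum, ← List.sum_map_mul_right, sum_list_sum, ← List.sum_map_mul_left]
  congr 1
  refine List.map_congr_left fun p _ => ?_
  rw [monVal, wordVal_append, Matrix.smul_apply, Matrix.mul_apply, smul_eq_mul, Finset.mul_sum,
    Finset.mul_sum]
  refine Finset.sum_congr rfl fun j _ => ?_
  rw [ntr, Matrix.trace_mul_single]
  simp
  ring

/-- The entrywise expectation of a function of a tuple of independent GUE matrices. -/
noncomputable def matExp (t : ℝ) (G : SATuple m N → Matrix (Fin N) (Fin N) ℂ) :
    Matrix (Fin N) (Fin N) ℂ := Matrix.of fun i j => ∫ y, G y i j ∂(gue m N t)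

/-- The loop (Schwinger-Dyson) equation: contracting `Y_k` with a letter of the word splits off a
new trace, while contracting it with a letter inside a trace merges that trace into the word, at
relative order `1 / N ^ 2`. -/
theorem matExp_letter_mul_monVal (hN : 1 ≤ N) {t : ℝ} (ht : 0 < t)
    (x : Fin m → Matrix (Fin N) (Fin N) ℂ) (k : Fin m) (L : List (List (Fin m ⊕ Fin m)))
    (w : List (Fin m ⊕ Fin m)) :
    matExp t (fun y : SATuple m N => y.mat k * monVal x y.mat L w) =
      (t : ℂ) • matExp t (fun y : SATuple m N =>
        ((wordSplits k w).map fun p => monVal x y.mat (p.1 :: L) p.2).sum) +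
      (1 / (N : ℂ) ^ 2) • (t : ℂ) • matExp t (fun y : SATuple m N =>
        ((traceSplits k L).map fun p => monVal x y.mat p.1 (p.2 ++ w)).sum) := by
  have hs : 0 < t / N := by positivity
  have hN' : (N : ℂ) ≠ 0 := by exact_mod_cast (by omega : N ≠ 0)
  ext i b
  simp only [matExp, Matrix.of_apply, Matrix.add_apply, Matrix.smul_apply, smul_eq_mul]
  set G' : Fin N → SATuple m N → Matrix (Fin N) (Fin N) ℂ → ℂ := fun j y Z =>
    traceDeriv x y.mat k Z L * wordVal x y.mat w j b +
      traceVal x y.mat L * wordDeriv x y.mat k Z w j b with hG'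
  have hGp : ∀ j Z, PolyGrowth fun y => G' j y Z := fun j Z =>
    ((polyGrowth_traceDeriv x k Z L).mul (polyGrowth_wordVal x w j b)).add
      ((polyGrowth_traceVal x L).mul (polyGrowth_wordDeriv x k Z w j b))
  have hmp := polyGrowth_monVal (N := N) x
  have h1 : ∀ j, ∫ y, y.mat k i j * monVal x y.mat L w j b ∂(gue m N t) =
      (t / N : ℂ) * ∫ y, G' j y (Matrix.single j i 1) ∂(gue m N t) := fun j => by
    refine gue_integral_by_parts hN ht k i j (hmp L w j b) (hGp j) (fun y Z₁ Z₂ => ?_)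
      fun y Z => ?_
    · simp only [hG', traceDeriv_add_smul, wordDeriv_add_smul, Matrix.add_apply,
        Matrix.smul_apply, smul_eq_mul]
      ring
    · exact hasLineDerivAt_mul (hasLineDerivAt_traceVal x y k Z L)
        (hasLineDerivAt_wordVal x y k Z w j b)
  have h2 : ∀ y : SATuple m N, ∑ j, G' j y (Matrix.single j i 1) =
      N * ((wordSplits k w).map fun p => monVal x y.mat (p.1 :: L) p.2 i b).sum +
      1 / (N : ℂ) * ((traceSplits k L).map fun p => monVal x y.mat p.1 (p.2 ++ w) i b).sum :=
      fun y => by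
    simp only [hG']
    rw [Finset.sum_add_distrib, sum_traceDeriv_single, ← Finset.mul_sum, sum_wordDeriv_single,
      add_comm, ← List.sum_map_mul_left, ← List.sum_map_mul_left (r := (N : ℂ))]
    congr 2
    refine List.map_congr_left fun p _ => ?_
    rw [monVal, traceVal_cons, ntr, Matrix.smul_apply, smul_eq_mul]
    field_simp
  have hA : PolyGrowth fun y : SATuple m N =>
      ((wordSplits k w).map fun p => monVal x y.mat (p.1 :: L) p.2 i b).sum :=
    PolyGrowth.list_sum _ fun p => hmp (p.1 :: L) p.2 i b
  have hB : PolyGrowth fun y : SATuple m N =>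
      ((traceSplits k L).map fun p => monVal x y.mat p.1 (p.2 ++ w) i b).sum :=
    PolyGrowth.list_sum _ fun p => hmp p.1 (p.2 ++ w) i b
  simp_rw [Matrix.mul_apply, list_sum_apply]
  have hi : ∀ g : SATuple m N → ℂ, PolyGrowth g → Integrable g (gue m N t) := fun g hg => by
    rw [gue_eq_isoGaussian hN]
    exact hg.integrable hs
  rw [integral_finsetSum _ fun j _ => hi _ ((polyGrowth_entry k i j).mul (hmp L w j b))]
  simp_rw [h1]
  rw [← Finset.mul_sum, ← integral_finsetSum _ fun j _ => hi _ (hGp j _)]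
  simp_rw [h2]
  rw [integral_add ((hi _ hA).const_mul _) ((hi _ hB).const_mul _), integral_const_mul,
    integral_const_mul]
  field_simp

end WordDeriv

/-! ### Gaussian expectations of trace polynomials -/

section NearTraceFun

variable {m : ℕ}

/-- A sequence of matrix-valued functions within `O(1/N²)` of a trace polynomial, uniformly on
operator-norm balls. -/
def IsNearTraceFun (H : ∀ N, SATuple m N → Matrix (Fin N) (Fin N) ℂ) : Prop :=
  ∃ g, IsTraceFun g ∧ ∀ R : ℝ, 0 ≤ R → ∃ K : ℝ, 0 ≤ K ∧ ∀ N : ℕ, 1 ≤ N → ∀ x ∈ opBall m N R,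
    opNorm (H N x - g N x) ≤ K / N ^ 2

theorem opNorm_zero {N : ℕ} : opNorm (0 : Matrix (Fin N) (Fin N) ℂ) = 0 := by simp [opNorm]

theorem opNorm_sub_le {N : ℕ} (A B : Matrix (Fin N) (Fin N) ℂ) :
    opNorm A ≤ opNorm (A - B) + opNorm B := by
  simpa using opNorm_add_le (A - B) B

namespace IsNearTraceFun

variable {H G : ∀ N, SATuple m N → Matrix (Fin N) (Fin N) ℂ}

theorem congr (hH : IsNearTraceFun H) (h : ∀ N, 1 ≤ N → ∀ x, G N x = H N x) :
    IsNearTraceFun G := by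
  obtain ⟨g, hg, hb⟩ := hH
  refine ⟨g, hg, fun R hR => ?_⟩
  obtain ⟨K, hK, hb⟩ := hb R hR
  exact ⟨K, hK, fun N hN x hx => by rw [h N hN x]; exact hb N hN x hx⟩

theorem of_isTraceFun (hH : IsTraceFun H) : IsNearTraceFun H :=
  ⟨H, hH, fun _ _ => ⟨0, le_rfl, fun N _ x _ => by simp [opNorm_zero]⟩⟩

theorem add (hH : IsNearTraceFun H) (hG : IsNearTraceFun G) :
    IsNearTraceFun fun N x => H N x + G N x := by
  obtain ⟨h, hh, hb⟩ := hH
  obtain ⟨g, hg, hc⟩ := hG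
  refine ⟨_, hh.add hg, fun R hR => ?_⟩
  obtain ⟨K, hK, hb⟩ := hb R hR
  obtain ⟨K', hK', hc⟩ := hc R hR
  refine ⟨K + K', by positivity, fun N hN x hx => ?_⟩
  rw [add_sub_add_comm, add_div]
  exact (opNorm_add_le _ _).trans (add_le_add (hb N hN x hx) (hc N hN x hx))

theorem mul_left {A : ∀ N, SATuple m N → Matrix (Fin N) (Fin N) ℂ} (hA : IsTraceFun A)
    (hH : IsNearTraceFun H) : IsNearTraceFun fun N x => A N x * H N x := by
  obtain ⟨h, hh, hb⟩ := hH
  refine ⟨_, hA.mul hh, fun R hR => ?_⟩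
  obtain ⟨K, hK, hb⟩ := hb R hR
  obtain ⟨K', n, hK', hc⟩ := hA.opNorm_le
  refine ⟨K' * (1 + R) ^ n * K, by positivity, fun N hN x hx => ?_⟩
  rw [← mul_sub, mul_div_assoc]
  have := hb N hN x hx
  refine (opNorm_mul_le _ _).trans ?_
  gcongr
  · exact opNorm_nonneg _
  · exact hc N x R hR hx

theorem smul (c : ℂ) (hH : IsNearTraceFun H) : IsNearTraceFun fun N x => c • H N x := by
  simpa using hH.mul_left (IsTraceFun.one.smul c)

theorem ntr_smul {A : ∀ N, SATuple m N → Matrix (Fin N) (Fin N) ℂ} (hH : IsNearTraceFun H)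
    (hA : IsTraceFun A) : IsNearTraceFun fun N x => ntr (H N x) • A N x := by
  obtain ⟨h, hh, hb⟩ := hH
  refine ⟨_, hh.traceMul hA, fun R hR => ?_⟩
  obtain ⟨K, hK, hb⟩ := hb R hR
  obtain ⟨K', n, hK', hc⟩ := hA.opNorm_le
  refine ⟨K * (K' * (1 + R) ^ n), by positivity, fun N hN x hx => ?_⟩
  have h1 : ntr (H N x) - ntr (h N x) = ntr (H N x - h N x) := by
    simp [ntr, mul_sub]
  rw [← sub_smul, h1, opNorm_smul, mul_div_right_comm]
  gcongr
  · exact opNorm_nonneg _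
  · exact (norm_ntr_le _).trans (hb N hN x hx)
  · exact hc N x R hR hx

/-- On operator-norm balls trace functions are bounded uniformly in `N`, so after division by `N ^
2` zero is already an admissible approximant. -/
theorem div_sq (hH : IsNearTraceFun H) : IsNearTraceFun fun N x => (1 / (N : ℂ) ^ 2) • H N x := by
  obtain ⟨h, hh, hb⟩ := hH
  refine ⟨_, isTraceFun_zero, fun R hR => ?_⟩
  obtain ⟨K, hK, hb⟩ := hb R hR
  obtain ⟨K', n, hK', hc⟩ := hh.opNorm_le
  refine ⟨K + K' * (1 + R) ^ n, by positivity, fun N hN x hx => ?_⟩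
  have hN' : (1 : ℝ) ≤ N := by exact_mod_cast hN
  rw [sub_zero, opNorm_smul, norm_div, norm_one, norm_pow, Complex.norm_natCast,
    one_div_mul_eq_div]
  gcongr
  refine (opNorm_sub_le _ (h N x)).trans (add_le_add ((hb N hN x hx).trans ?_) (hc N x R hR hx))
  exact div_le_self hK (one_le_pow₀ hN')

theorem list_sum {ι : Type*} (l : List ι)
    {f : ι → ∀ N, SATuple m N → Matrix (Fin N) (Fin N) ℂ} (hf : ∀ i ∈ l, IsNearTraceFun (f i)) :
    IsNearTraceFun fun N x => (l.map fun i => f i N x).sum := by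
  induction l with
  | nil => simpa using of_isTraceFun isTraceFun_zero
  | cons a l ih =>
    simpa using (hf a (by simp)).add (ih fun i hi => hf i (by simp [hi]))

end IsNearTraceFun

/-! ### Linearity of the entrywise Gaussian expectation. -/

section MatExp

variable {N : ℕ} {t : ℝ} {F G : SATuple m N → Matrix (Fin N) (Fin N) ℂ}

theorem matExp_const (hN : 1 ≤ N) (ht : 0 < t) (A : Matrix (Fin N) (Fin N) ℂ) :
    matExp t (fun _ : SATuple m N => A) = A := by
  have hs : 0 < t / N := by positivity
  have := isProbabilityMeasure_isoGaussian (E := SATuple m N) hs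
  ext i j
  simp [matExp, gue_eq_isoGaussian hN]

theorem integrable_gue_of_polyGrowth (hN : 1 ≤ N) (ht : 0 < t) {g : SATuple m N → ℂ}
    (hg : PolyGrowth g) : Integrable g (gue m N t) := by
  rw [gue_eq_isoGaussian hN]
  exact hg.integrable (by positivity)

theorem matExp_add (hN : 1 ≤ N) (ht : 0 < t) (hF : ∀ i j, PolyGrowth fun y => F y i j)
    (hG : ∀ i j, PolyGrowth fun y => G y i j) :
    matExp t (fun y => F y + G y) = matExp t F + matExp t G := by
  ext i j
  exact integral_add (integrable_gue_of_polyGrowth hN ht (hF i j))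
    (integrable_gue_of_polyGrowth hN ht (hG i j))

theorem matExp_smul (c : ℂ) : matExp t (fun y => c • F y) = c • matExp t F := by
  ext i j
  exact integral_const_mul c _

theorem matExp_mul_left (hN : 1 ≤ N) (ht : 0 < t) (hF : ∀ i j, PolyGrowth fun y => F y i j)
    (A : Matrix (Fin N) (Fin N) ℂ) : matExp t (fun y => A * F y) = A * matExp t F := by
  ext i j
  simp only [matExp, Matrix.of_apply, Matrix.mul_apply]
  rw [integral_finsetSum _ fun l _ =>
    (integrable_gue_of_polyGrowth hN ht (hF l j)).const_mul (A i l)]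
  simp_rw [integral_const_mul]

theorem matExp_ntr_smul (hN : 1 ≤ N) (ht : 0 < t) (hF : ∀ i j, PolyGrowth fun y => F y i j)
    (A : Matrix (Fin N) (Fin N) ℂ) :
    matExp t (fun y => ntr (F y) • A) = ntr (matExp t F) • A := by
  ext i j
  simp only [matExp, Matrix.of_apply, Matrix.smul_apply, ntr, Matrix.trace, Matrix.diag,
    smul_eq_mul]
  rw [integral_mul_const, integral_const_mul,
    integral_finsetSum _ fun l _ => integrable_gue_of_polyGrowth hN ht (hF l l)]

theorem matExp_list_sum (hN : 1 ≤ N) (ht : 0 < t) {ι : Type*} (l : List ι)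
    {f : ι → SATuple m N → Matrix (Fin N) (Fin N) ℂ}
    (hf : ∀ p i j, PolyGrowth fun y => f p y i j) :
    matExp t (fun y => (l.map fun p => f p y).sum) = (l.map fun p => matExp t (f p)).sum := by
  induction l with
  | nil => simpa using matExp_const hN ht 0
  | cons a l ih =>
    simp only [List.map_cons, List.sum_cons]
    rw [matExp_add hN ht (hf a) fun i j => ?_, ih]
    simp_rw [list_sum_apply]
    exact PolyGrowth.list_sum l fun p => hf p i j

end MatExp

theorem isTraceFun_wordVal (w : List (Fin m ⊕ Fin m)) :
    IsTraceFun fun N (x : SATuple m N) => wordVal x.mat x.mat w := by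
  induction w with
  | nil => exact IsTraceFun.one
  | cons a w ih =>
    simp_rw [wordVal_cons]
    refine IsTraceFun.mul ?_ ih
    cases a <;> exact IsTraceFun.var _

theorem isTraceFun_monVal (L : List (List (Fin m ⊕ Fin m))) (w : List (Fin m ⊕ Fin m)) :
    IsTraceFun fun N (x : SATuple m N) => monVal x.mat x.mat L w := by
  induction L with
  | nil => simpa [monVal, traceVal_nil] using isTraceFun_wordVal w
  | cons u L ih =>
    simp_rw [monVal, traceVal_cons, mul_smul]
    exact (isTraceFun_wordVal u).traceMul ih

theorem wordVal_eq_of_wordDeg_eq_zero {N : ℕ} {w : List (Fin m ⊕ Fin m)} (hw : wordDeg w = 0)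
    (x y : Fin m → Matrix (Fin N) (Fin N) ℂ) : wordVal x y w = wordVal x x w := by
  induction w with
  | nil => rfl
  | cons a w ih =>
    rw [wordDeg_cons] at hw
    rw [wordVal_cons, wordVal_cons, ih (by omega)]
    cases a with
    | inl k => rfl
    | inr k => simp at hw

theorem traceVal_eq_of_traceDeg_eq_zero {N : ℕ} {L : List (List (Fin m ⊕ Fin m))}
    (hL : traceDeg L = 0) (x y : Fin m → Matrix (Fin N) (Fin N) ℂ) :
    traceVal x y L = traceVal x x L := by
  induction L with
  | nil => rfl
  | cons u L ih =>
    rw [traceDeg_cons] at hL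
    rw [traceVal_cons, traceVal_cons, ih (by omega),
      wordVal_eq_of_wordDeg_eq_zero (by omega) x y]

theorem exists_first_letter {w : List (Fin m ⊕ Fin m)} (hw : wordDeg w ≠ 0) :
    ∃ a k b, w = a ++ Sum.inr k :: b ∧ wordDeg a = 0 := by
  induction w with
  | nil => simp [wordDeg] at hw
  | cons c w ih =>
    cases c with
    | inr k => exact ⟨[], k, w, rfl, rfl⟩
    | inl k =>
      rw [wordDeg_cons] at hw
      obtain ⟨a, k', b, rfl, ha⟩ := ih (by simpa using hw)
      exact ⟨Sum.inl k :: a, k', b, rfl, by simp [wordDeg_cons, ha]⟩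

theorem exists_word_of_traceDeg_ne_zero {L : List (List (Fin m ⊕ Fin m))} (hL : traceDeg L ≠ 0) :
    ∃ L₁ u L₂, L = L₁ ++ u :: L₂ ∧ wordDeg u ≠ 0 := by
  induction L with
  | nil => simp [traceDeg] at hL
  | cons u L ih =>
    by_cases hu : wordDeg u = 0
    · rw [traceDeg_cons, hu, zero_add] at hL
      obtain ⟨L₁, v, L₂, rfl, hv⟩ := ih hL
      exact ⟨u :: L₁, v, L₂, rfl, hv⟩
    · exact ⟨[], u, L, rfl, hu⟩

theorem traceDeg_append (L L' : List (List (Fin m ⊕ Fin m))) :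
    traceDeg (L ++ L') = traceDeg L + traceDeg L' := by
  simp [traceDeg]

variable {t : ℝ}

/-- The letters before the first `Y_k` are deterministic and leave the expectation; the loop
equation then removes two random letters from every term. The inductive hypothesis is an argument
because it is also used after a word has been moved out of a trace, at unchanged degree. -/
theorem isNearTraceFun_matExp_of_splits (ht : 0 < t) {L : List (List (Fin m ⊕ Fin m))}
    {a b : List (Fin m ⊕ Fin m)} {k : Fin m} (ha : wordDeg a = 0)
    (ih : ∀ L' w', traceDeg L' + wordDeg w' < traceDeg L + wordDeg (a ++ Sum.inr k :: b) →
      IsNearTraceFun fun N (x : SATuple m N) =>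
        matExp t fun y : SATuple m N => monVal x.mat y.mat L' w') :
    IsNearTraceFun fun N (x : SATuple m N) =>
      matExp t fun y : SATuple m N => monVal x.mat y.mat L (a ++ Sum.inr k :: b) := by
  rw [wordDeg_append, wordDeg_cons, ha] at ih
  simp only [Sum.isRight_inr, if_true] at ih
  have h1 : IsNearTraceFun fun N (x : SATuple m N) =>
      matExp t fun y : SATuple m N => y.mat k * monVal x.mat y.mat L b := by
    have hA := IsNearTraceFun.list_sum (wordSplits k b) (f := fun p N (x : SATuple m N) =>
        matExp t fun y : SATuple m N => monVal x.mat y.mat (p.1 :: L) p.2) fun p hp => ih _ _ (by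
      have := wordDeg_of_mem_wordSplits hp
      rw [traceDeg_cons]
      omega)
    have hB := IsNearTraceFun.list_sum (traceSplits k L) (f := fun p N (x : SATuple m N) =>
        matExp t fun y : SATuple m N => monVal x.mat y.mat p.1 (p.2 ++ b)) fun p hp => ih _ _ (by
      have := traceDeg_of_mem_traceSplits hp
      rw [wordDeg_append]
      omega)
    refine ((hA.smul (t : ℂ)).add (hB.smul (t : ℂ)).div_sq).congr fun N hN x => ?_
    rw [matExp_letter_mul_monVal hN ht x.mat k L b]
    congr 2
    · exact matExp_list_sum hN ht _ fun p => polyGrowth_monVal x.mat (p.1 :: L) p.2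
    · congr 1
      exact matExp_list_sum hN ht _ fun p => polyGrowth_monVal x.mat p.1 (p.2 ++ b)
  refine (h1.mul_left (isTraceFun_wordVal a)).congr fun N hN x => ?_
  rw [← matExp_mul_left hN ht fun i j => ?_]
  · congr 1
    funext y
    rw [monVal, wordVal_append, wordVal_cons, wordVal_eq_of_wordDeg_eq_zero ha, monVal,
      Matrix.mul_smul, Matrix.mul_smul]
    rfl
  · simp_rw [Matrix.mul_apply]
    exact PolyGrowth.sum _ fun l _ => (polyGrowth_entry k i l).mul (polyGrowth_monVal x.mat L b l j)

theorem isNearTraceFun_matExp_monVal (ht : 0 < t) (L : List (List (Fin m ⊕ Fin m)))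
    (w : List (Fin m ⊕ Fin m)) :
    IsNearTraceFun fun N (x : SATuple m N) =>
      matExp t fun y : SATuple m N => monVal x.mat y.mat L w := by
  induction hn : traceDeg L + wordDeg w using Nat.strong_induction_on generalizing L w with
  | _ n ih =>
    subst hn
    by_cases hw : wordDeg w = 0
    · by_cases hL : traceDeg L = 0
      · refine (IsNearTraceFun.of_isTraceFun (isTraceFun_monVal L w)).congr fun N hN x => ?_
        simp_rw [monVal, wordVal_eq_of_wordDeg_eq_zero hw x.mat,
          traceVal_eq_of_traceDeg_eq_zero hL x.mat]
        exact matExp_const hN ht _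
      · obtain ⟨L₁, u, L₂, rfl, hu⟩ := exists_word_of_traceDeg_ne_zero hL
        obtain ⟨a, k, b, rfl, ha⟩ := exists_first_letter hu
        -- A trace factor containing a random letter is treated as the trace of a matrix-valued
        -- monomial, its word rotated cyclically so that `Y_k` comes first. The number of random
        -- letters is unchanged.
        have hdeg : traceDeg (L₁ ++ L₂) + wordDeg ([] ++ Sum.inr k :: (b ++ a)) =
            traceDeg (L₁ ++ (a ++ Sum.inr k :: b) :: L₂) + wordDeg w := by
          simp only [traceDeg_append, traceDeg_cons, wordDeg_append, wordDeg_cons,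
            List.nil_append]
          omega
        have h1 := isNearTraceFun_matExp_of_splits (L := L₁ ++ L₂) (a := []) (b := b ++ a) (k := k)
          ht rfl fun L' w' h => ih _ (by rwa [hdeg] at h) L' w' rfl
        refine (h1.ntr_smul (isTraceFun_wordVal w)).congr fun N hN x => ?_
        rw [← matExp_ntr_smul hN ht (polyGrowth_monVal x.mat _ _)]
        congr 1
        funext y
        rw [monVal, wordVal_eq_of_wordDeg_eq_zero hw, monVal, ntr_smul, traceVal_append,
          traceVal_append, traceVal_cons, wordVal_append, List.nil_append, ← List.cons_append,
          wordVal_append, ntr_mul_comm]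
        congr 1
        ring
    · obtain ⟨a, k, b, rfl, ha⟩ := exists_first_letter hw
      exact isNearTraceFun_matExp_of_splits ht ha fun L' w' h => ih _ h L' w' rfl

/-- Linear combinations of trace monomials in two families of matrices. -/
inductive IsMonSum : (∀ N, SATuple m N → SATuple m N → Matrix (Fin N) (Fin N) ℂ) → Prop
  | mon (L : List (List (Fin m ⊕ Fin m))) (w : List (Fin m ⊕ Fin m)) :
      IsMonSum fun _ x y => monVal x.mat y.mat L w
  | add {F G : ∀ N, SATuple m N → SATuple m N → Matrix (Fin N) (Fin N) ℂ} : IsMonSum F →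
      IsMonSum G → IsMonSum fun N x y => F N x y + G N x y
  | smul (c : ℂ) {F : ∀ N, SATuple m N → SATuple m N → Matrix (Fin N) (Fin N) ℂ} : IsMonSum F →
      IsMonSum fun N x y => c • F N x y

namespace IsMonSum

variable {F G : ∀ N, SATuple m N → SATuple m N → Matrix (Fin N) (Fin N) ℂ}

theorem mul (hF : IsMonSum F) (hG : IsMonSum G) : IsMonSum fun N x y => F N x y * G N x y := by
  induction hF with
  | add _ _ h₁ h₂ => simpa only [add_mul] using h₁.add h₂
  | smul c _ h => simpa only [smul_mul_assoc] using h.smul c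
  | mon L w =>
    induction hG with
    | add _ _ h₁ h₂ => simpa only [mul_add] using h₁.add h₂
    | smul c _ h => simpa only [mul_smul_comm] using h.smul c
    | mon L' w' =>
      have h := IsMonSum.mon (L ++ L') (w ++ w')
      simpa only [monVal, traceVal_append, wordVal_append, smul_mul_smul_comm] using h

theorem traceMul (hF : IsMonSum F) (hG : IsMonSum G) :
    IsMonSum fun N x y => ntr (F N x y) • G N x y := by
  induction hF with
  | add _ _ h₁ h₂ => simpa only [ntr_add, add_smul] using h₁.add h₂
  | smul c _ h => simpa only [ntr_smul, mul_smul] using h.smul c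
  | mon L w =>
    induction hG with
    | add _ _ h₁ h₂ => simpa only [smul_add] using h₁.add h₂
    | smul c _ h => simpa only [smul_comm _ c] using h.smul c
    | mon L' w' =>
      have h := IsMonSum.mon (w :: (L ++ L')) w'
      simp only [monVal, ntr_smul, smul_smul]
      simp only [monVal, traceVal_cons, traceVal_append] at h
      convert h using 5
      ring

theorem polyGrowth (hF : IsMonSum F) (N : ℕ) (x : SATuple m N) (i j : Fin N) :
    PolyGrowth fun y => F N x y i j := by
  induction hF with
  | mon L w => exact polyGrowth_monVal x.mat L w i j
  | add _ _ h₁ h₂ => exact h₁.add h₂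
  | smul c _ h => exact (polyGrowth_const c).mul h

theorem isNearTraceFun (hF : IsMonSum F) (ht : 0 < t) :
    IsNearTraceFun fun N x => matExp t (F N x) := by
  induction hF with
  | mon L w => exact isNearTraceFun_matExp_monVal ht L w
  | add hF hG h₁ h₂ =>
    exact (h₁.add h₂).congr fun N hN x => matExp_add hN ht (hF.polyGrowth N x) (hG.polyGrowth N x)
  | smul c _ h => exact (h.smul c).congr fun N hN x => matExp_smul c

end IsMonSum

theorem IsTraceFun.isMonSum_add {F : ∀ N, SATuple m N → Matrix (Fin N) (Fin N) ℂ}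
    (hF : IsTraceFun F) : IsMonSum fun N x y => F N (x + y) := by
  induction hF with
  | var j =>
    have h := (IsMonSum.mon [] [Sum.inl j]).add (IsMonSum.mon (m := m) [] [Sum.inr j])
    simpa [monVal, traceVal_nil, wordVal, SATuple.mat_add] using h
  | one => simpa [monVal, traceVal_nil, wordVal_nil] using IsMonSum.mon (m := m) [] []
  | add _ _ h₁ h₂ => exact h₁.add h₂
  | smul c _ h => exact h.smul c
  | mul _ _ h₁ h₂ => exact h₁.mul h₂
  | traceMul _ _ h₁ h₂ => exact h₁.traceMul h₂

end NearTraceFun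

/-! ### Exponential moments of the operator norm of a GUE matrix -/

section ExpMoment

/-- The norm of a symmetric operator is the supremum of its Rayleigh quotients, so some unit vector
`v` reaches `15 / 16` of it. Moving `v` by `1 / 4` changes the quadratic form by at most `1 / 4 + 1
/ 4 + 1 / 16 = 9 / 16` of the norm. -/
theorem exists_ball_le_abs_reApplyInnerSelf {E : Type*} [NormedAddCommGroup E]
    [InnerProductSpace ℂ E] [Nontrivial E] (T : E →L[ℂ] E) (hT : T.IsSymmetric) :
    ∃ v : E, ‖v‖ = 1 ∧ ∀ w : E, ‖w - v‖ ≤ 1 / 4 → ‖T‖ / 4 ≤ |T.reApplyInnerSelf w| := by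
  obtain ⟨v₀, hv₀⟩ := exists_norm_eq E zero_le_one
  rcases (norm_nonneg T).eq_or_lt with h0 | h0
  · exact ⟨v₀, hv₀, fun w _ => by rw [← h0, zero_div]; exact abs_nonneg _⟩
  obtain ⟨x, hx⟩ : ∃ x, 15 / 16 * ‖T‖ < |T.rayleighQuotient x| := by
    refine exists_lt_of_lt_ciSup ?_
    rw [← T.norm_eq_iSup_rayleighQuotient hT]
    linarith
  have hx0 : x ≠ 0 := by
    rintro rfl
    rw [T.rayleighQuotient_apply_zero, abs_zero] at hx
    linarith
  have hnx : 0 < ‖x‖ := norm_pos_iff.2 hx0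
  set v : E := ((‖x‖⁻¹ : ℝ) : ℂ) • x with hv
  have hv1 : ‖v‖ = 1 := by
    rw [hv, norm_smul, Complex.norm_real, norm_inv, norm_norm, inv_mul_cancel₀ hnx.ne']
  have hvT : 15 / 16 * ‖T‖ < |T.reApplyInnerSelf v| := by
    have hc : ((‖x‖⁻¹ : ℝ) : ℂ) ≠ 0 := by
      exact_mod_cast (inv_pos.2 hnx).ne'
    rw [← T.rayleigh_smul x hc] at hx
    simpa only [ContinuousLinearMap.rayleighQuotient, ← hv, hv1, one_pow, div_one] using hx
  refine ⟨v, hv1, fun w hw => ?_⟩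
  obtain ⟨d, rfl⟩ : ∃ d, w = v + d := ⟨w - v, by abel⟩
  rw [add_sub_cancel_left] at hw
  simp only [ContinuousLinearMap.reApplyInnerSelf_apply] at hvT ⊢
  have h1 : RCLike.re (inner ℂ (T (v + d)) (v + d)) = RCLike.re (inner ℂ (T v) v) +
      (RCLike.re (inner ℂ (T v) d) + RCLike.re (inner ℂ (T d) v) +
        RCLike.re (inner ℂ (T d) d)) := by
    simp only [map_add, inner_add_left, inner_add_right]
    ring
  have hb : ∀ a b : E, |RCLike.re (inner ℂ (T a) b)| ≤ ‖T‖ * ‖a‖ * ‖b‖ := fun a b =>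
    (RCLike.abs_re_le_norm _).trans <| (norm_inner_le_norm _ _).trans <| by
      gcongr
      exact T.le_opNorm a
  have h2 := hb v d
  have h3 := hb d v
  have h4 := hb d d
  rw [hv1] at h2 h3
  have h5 : ‖T‖ * ‖d‖ ≤ ‖T‖ * (1 / 4) := by gcongr
  have h6 : ‖T‖ * ‖d‖ * ‖d‖ ≤ ‖T‖ * (1 / 4) * (1 / 4) := by gcongr
  have h7 := abs_add_three (RCLike.re (inner ℂ (T v) d)) (RCLike.re (inner ℂ (T d) v))
    (RCLike.re (inner ℂ (T d) d))
  rw [h1]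
  have h8 := abs_sub_abs_le_abs_sub (RCLike.re (inner ℂ (T v) v))
    (-(RCLike.re (inner ℂ (T v) d) + RCLike.re (inner ℂ (T d) v) + RCLike.re (inner ℂ (T d) d)))
  rw [abs_neg, sub_neg_eq_add] at h8
  linarith

variable {m N : ℕ}

/-- The rank-one tuple representing `y ↦ ⟨y_k w, w⟩`. -/
noncomputable def SATuple.rankOne (k : Fin m) (w : EuclideanSpace ℂ (Fin N)) : SATuple m N :=
  SATuple.single k ⟨Matrix.vecMulVec w (star w.ofLp), by
    rw [selfAdjoint.mem_iff, Matrix.star_eq_conjTranspose, Matrix.conjTranspose_vecMulVec,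
      star_star]⟩

theorem SATuple.inner_rankOne (k : Fin m) (w : EuclideanSpace ℂ (Fin N)) (y : SATuple m N) :
    inner ℝ (SATuple.rankOne k w) y =
      (Matrix.toEuclideanCLM (n := Fin N) (𝕜 := ℂ) (y.mat k)).reApplyInnerSelf w := by
  rw [SATuple.rankOne, SATuple.inner_single, ContinuousLinearMap.reApplyInnerSelf_apply,
    ← inner_re_symm, PiLp.inner_apply, Matrix.vecMulVec_mul, Matrix.trace_vecMulVec]
  simp only [Matrix.ofLp_toEuclideanCLM]
  change Complex.re _ = Complex.re _
  rw [dotProduct_comm, ← Matrix.dotProduct_mulVec, dotProduct]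
  congr 1
  refine Finset.sum_congr rfl fun i _ => ?_
  simp [mul_comm]

theorem SATuple.norm_rankOne_sq (k : Fin m) (w : EuclideanSpace ℂ (Fin N)) :
    ‖SATuple.rankOne k w‖ ^ 2 = ‖w‖ ^ 4 := by
  have h : w.ofLp ⬝ᵥ star w.ofLp = ((‖w‖ ^ 2 : ℝ) : ℂ) := by
    rw [← EuclideanSpace.inner_eq_star_dotProduct, inner_self_eq_norm_sq_to_K]
    norm_cast
  rw [← real_inner_self_eq_norm_sq]
  conv_lhs => rw [SATuple.rankOne, SATuple.inner_single, SATuple.single_mat, if_pos rfl]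
  rw [Matrix.vecMulVec_mul_vecMulVec, Matrix.trace_vecMulVec, dotProduct_smul,
    dotProduct_comm (star _), h, smul_eq_mul, ← Complex.ofReal_mul, Complex.ofReal_re]
  ring

theorem continuous_toEuclideanCLM_mat (k : Fin m) : Continuous fun y : SATuple m N =>
    Matrix.toEuclideanCLM (n := Fin N) (𝕜 := ℂ) (y.mat k) :=
  LinearMap.continuous_of_finiteDimensional
    ({ toFun := fun y => Matrix.toEuclideanCLM (n := Fin N) (𝕜 := ℂ) (y.mat k)
       map_add' := fun y z => by rw [SATuple.mat_add, map_add]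
       map_smul' := fun c y => by
        rw [SATuple.mat_smul, ← Complex.coe_smul, map_smul]
        rfl } :
      SATuple m N →ₗ[ℝ] _)

theorem continuous_opNorm_mat (k : Fin m) : Continuous fun y : SATuple m N => opNorm (y.mat k) :=
  (continuous_toEuclideanCLM_mat k).norm

theorem isSymmetric_toEuclideanCLM_mat (y : SATuple m N) (k : Fin m) :
    (Matrix.toEuclideanCLM (n := Fin N) (𝕜 := ℂ) (y.mat k)).IsSymmetric := by
  refine ContinuousLinearMap.isSelfAdjoint_iff_isSymmetric.1 ?_
  rw [isSelfAdjoint_iff, ← map_star, Matrix.star_eq_conjTranspose, SATuple.mat_conjTranspose]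

theorem continuous_inner_rankOne (k : Fin m) :
    Continuous fun p : SATuple m N × EuclideanSpace ℂ (Fin N) =>
      (inner ℝ (SATuple.rankOne k p.2) p.1 : ℝ) := by
  simp only [SATuple.inner_rankOne, ContinuousLinearMap.reApplyInnerSelf_apply]
  have h2 : Continuous fun p : SATuple m N × EuclideanSpace ℂ (Fin N) =>
      (Matrix.toEuclideanCLM (n := Fin N) (𝕜 := ℂ) (p.1.mat k)) p.2 :=
    ((continuous_toEuclideanCLM_mat k).comp continuous_fst).clm_apply continuous_snd
  exact RCLike.continuous_re.comp (h2.inner continuous_snd)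

theorem continuous_exp_inner_rankOne (k : Fin m) (c : ℝ) :
    Continuous fun p : SATuple m N × EuclideanSpace ℂ (Fin N) =>
      ENNReal.ofReal (Real.exp (c * inner ℝ (SATuple.rankOne k p.2) p.1)) :=
  ENNReal.continuous_ofReal.comp
    (Real.continuous_exp.comp (continuous_const.mul (continuous_inner_rankOne k)))

theorem lintegral_exp_rankOne (hN : 1 ≤ N) {t : ℝ} (ht : 0 < t) (k : Fin m) (c : ℝ)
    (w : EuclideanSpace ℂ (Fin N)) :
    ∫⁻ y : SATuple m N, ENNReal.ofReal (Real.exp (c * inner ℝ (SATuple.rankOne k w) y))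
      ∂(gue m N t) = ENNReal.ofReal (Real.exp (t / N / 2 * (c ^ 2 * ‖w‖ ^ 4))) := by
  have hs : 0 < t / N := by positivity
  rw [gue_eq_isoGaussian hN]
  have h := integral_exp_inner_isoGaussian hs (c • SATuple.rankOne k w)
  rw [norm_smul, mul_pow, SATuple.norm_rankOne_sq, Real.norm_eq_abs, sq_abs] at h
  simp_rw [real_inner_smul_left] at h
  rw [← h, ofReal_integral_eq_lintegral_ofReal (Integrable.of_integral_ne_zero (by
    rw [h]; positivity)) (ae_of_all _ fun y => (Real.exp_pos _).le)]

theorem lintegral_exp_rankOne_add_le (hN : 1 ≤ N) {t : ℝ} (ht : 0 < t) (k : Fin m) (θ : ℝ)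
    {w : EuclideanSpace ℂ (Fin N)} (hw : ‖w‖ ≤ 5 / 4) :
    ∫⁻ y : SATuple m N, (ENNReal.ofReal (Real.exp (4 * θ * N * inner ℝ (SATuple.rankOne k w) y)) +
      ENNReal.ofReal (Real.exp (-(4 * θ * N) * inner ℝ (SATuple.rankOne k w) y))) ∂(gue m N t) ≤
      ENNReal.ofReal (2 * Real.exp (20 * t * θ ^ 2 * N)) := by
  have hN0 : (0 : ℝ) < N := by positivity
  have hw' : ‖w‖ ^ 4 ≤ (5 / 4) ^ 4 := pow_le_pow_left₀ (norm_nonneg w) hw 4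
  have hmeas : Measurable fun y : SATuple m N =>
      ENNReal.ofReal (Real.exp (4 * θ * N * inner ℝ (SATuple.rankOne k w) y)) :=
    ((continuous_exp_inner_rankOne k _).comp (continuous_id.prodMk continuous_const)).measurable
  have hle : Real.exp (t / N / 2 * ((4 * θ * N) ^ 2 * ‖w‖ ^ 4)) ≤
      Real.exp (20 * t * θ ^ 2 * N) := by
    refine Real.exp_le_exp.2 ?_
    calc t / N / 2 * ((4 * θ * N) ^ 2 * ‖w‖ ^ 4)
        ≤ t / N / 2 * ((4 * θ * N) ^ 2 * (5 / 4) ^ 4) := by gcongr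
      _ = 8 * (5 / 4) ^ 4 * (t * θ ^ 2 * N) := by field_simp; ring
      -- The constant `20` is a round bound for `8 * (5 / 4) ^ 4`, about `19.53`.
      _ ≤ 20 * (t * θ ^ 2 * N) := by
        gcongr
        norm_num
      _ = _ := by ring
  rw [lintegral_add_left hmeas, lintegral_exp_rankOne hN ht, lintegral_exp_rankOne hN ht, neg_sq,
    ← ENNReal.ofReal_add (Real.exp_pos _).le (Real.exp_pos _).le]
  exact ENNReal.ofReal_le_ofReal (by linarith)

/-- Integration over a ball replaces a union bound over a net: the quadratic form dominates a
quarter of the operator norm on a whole ball of radius `1 / 4`. The two exponentials account for its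
sign. -/
theorem exp_opNorm_mul_le_lintegral (hN : 1 ≤ N) (μ : Measure (EuclideanSpace ℂ (Fin N)))
    [μ.IsAddHaarMeasure] (k : Fin m) {θ : ℝ} (hθ : 0 ≤ θ) (y : SATuple m N) :
    ENNReal.ofReal (Real.exp (θ * N * opNorm (y.mat k))) * μ (Metric.ball 0 (1 / 4)) ≤
      ∫⁻ w in Metric.ball 0 (5 / 4),
        (ENNReal.ofReal (Real.exp (4 * θ * N * inner ℝ (SATuple.rankOne k w) y)) +
        ENNReal.ofReal (Real.exp (-(4 * θ * N) * inner ℝ (SATuple.rankOne k w) y))) ∂μ := by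
  have : Nonempty (Fin N) := ⟨⟨0, hN⟩⟩
  obtain ⟨v, hv, hw⟩ := exists_ball_le_abs_reApplyInnerSelf _ (isSymmetric_toEuclideanCLM_mat y k)
  have hsub : Metric.ball v (1 / 4) ⊆ Metric.ball (0 : EuclideanSpace ℂ (Fin N)) (5 / 4) := by
    refine Metric.ball_subset_ball' ?_
    rw [dist_zero_right, hv]
    norm_num
  refine le_trans ?_ (lintegral_mono_set hsub)
  rw [← Measure.addHaar_ball_center μ v, ← setLIntegral_const]
  refine setLIntegral_mono' measurableSet_ball fun w hwb => ?_
  have h1 := hw w (by rw [← dist_eq_norm]; exact (Metric.mem_ball.1 hwb).le)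
  rw [← SATuple.inner_rankOne] at h1
  set q : ℝ := inner ℝ (SATuple.rankOne k w) y
  have h2 : θ * N * opNorm (y.mat k) ≤ 4 * θ * N * |q| := by
    have := mul_le_mul_of_nonneg_left h1 (by positivity : 0 ≤ 4 * θ * N)
    refine le_trans (le_of_eq ?_) this
    rw [opNorm]
    ring
  rcases abs_cases q with ⟨h3, _⟩ | ⟨h3, _⟩ <;> rw [h3] at h2
  · exact le_add_right (ENNReal.ofReal_le_ofReal (Real.exp_le_exp.2 h2))
  · refine le_add_left (ENNReal.ofReal_le_ofReal (Real.exp_le_exp.2 (h2.trans_eq ?_)))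
    ring

theorem addHaar_ball_five_quarters (μ : Measure (EuclideanSpace ℂ (Fin N))) [μ.IsAddHaarMeasure] :
    μ (Metric.ball 0 (5 / 4)) = ENNReal.ofReal (25 ^ N) * μ (Metric.ball 0 (1 / 4)) := by
  have h := Measure.addHaar_ball_mul_of_pos μ (0 : EuclideanSpace ℂ (Fin N)) (r := 5)
    (by norm_num) (1 / 4)
  have hd : Module.finrank ℝ (EuclideanSpace ℂ (Fin N)) = 2 * N := by
    rw [finrank_real_of_complex, finrank_euclideanSpace, Fintype.card_fin]
  rw [show (5 : ℝ) * (1 / 4) = 5 / 4 by norm_num, hd, pow_mul] at h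
  rw [h]
  norm_num

/-- After Tonelli each quadratic form is a Gaussian variable with explicit exponential moment, and
the ratio of ball volumes in real dimension `2 * N` is `5 ^ (2 * N) = 25 ^ N`. -/
theorem lintegral_exp_opNorm_le (hN : 1 ≤ N) {t : ℝ} (ht : 0 < t) (k : Fin m) {θ : ℝ}
    (hθ : 0 ≤ θ) :
    ∫⁻ y : SATuple m N, ENNReal.ofReal (Real.exp (θ * N * opNorm (y.mat k))) ∂(gue m N t) ≤
      ENNReal.ofReal (2 * 25 ^ N * Real.exp (20 * t * θ ^ 2 * N)) := by
  have hs : 0 < t / N := by positivity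
  have := isProbabilityMeasure_isoGaussian (E := SATuple m N) hs
  rw [← gue_eq_isoGaussian hN] at this
  let μ : Measure (EuclideanSpace ℂ (Fin N)) := Measure.addHaar
  have hpos : μ (Metric.ball 0 (1 / 4)) ≠ 0 := (Metric.measure_ball_pos μ 0 (by norm_num)).ne'
  have hfin : μ (Metric.ball 0 (1 / 4)) ≠ ⊤ := measure_ball_lt_top.ne
  refine (ENNReal.mul_le_mul_iff_left hpos hfin).1 ?_
  rw [← lintegral_mul_const' _ _ hfin]
  refine (lintegral_mono fun y => exp_opNorm_mul_le_lintegral hN μ k hθ y).trans ?_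
  rw [lintegral_lintegral_swap ((continuous_exp_inner_rankOne k _).add
    (continuous_exp_inner_rankOne k _)).measurable.aemeasurable]
  refine (setLIntegral_mono' measurableSet_ball fun w hw =>
    lintegral_exp_rankOne_add_le hN ht k θ (mem_ball_zero_iff.1 hw).le).trans_eq ?_
  rw [setLIntegral_const, addHaar_ball_five_quarters, ← mul_assoc,
    ← ENNReal.ofReal_mul (by positivity)]
  congr 2
  ring

/-- The sum of the operator norms of the matrices of a tuple. -/
noncomputable def SATuple.opSum (y : SATuple m N) : ℝ := ∑ j, opNorm (y.mat j)

theorem SATuple.opSum_nonneg (y : SATuple m N) : 0 ≤ y.opSum :=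
  Finset.sum_nonneg fun _ _ => opNorm_nonneg _

theorem continuous_opSum : Continuous (SATuple.opSum : SATuple m N → ℝ) :=
  continuous_finsetSum _ fun k _ => continuous_opNorm_mat k

theorem exp_opSum_le (y : SATuple m N) : Real.exp (2 * N * y.opSum) ≤
    1 + ∑ k, Real.exp (2 * m * N * opNorm (y.mat k)) := by
  rcases Nat.eq_zero_or_pos m with rfl | hm
  · simp [SATuple.opSum]
  have : Nonempty (Fin m) := ⟨⟨0, hm⟩⟩
  obtain ⟨k, -, hk⟩ := Finset.exists_max_image Finset.univ (fun k => opNorm (y.mat k))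
    Finset.univ_nonempty
  have h1 : y.opSum ≤ m * opNorm (y.mat k) := by
    refine (Finset.sum_le_sum fun j hj => hk j hj).trans_eq ?_
    simp
  calc Real.exp (2 * N * y.opSum) ≤ Real.exp (2 * N * (m * opNorm (y.mat k))) := by gcongr
    _ = Real.exp (2 * m * N * opNorm (y.mat k)) := by ring_nf
    _ ≤ ∑ k, Real.exp (2 * m * N * opNorm (y.mat k)) :=
      Finset.single_le_sum (f := fun k => Real.exp (2 * m * N * opNorm (y.mat k)))
        (fun _ _ => (Real.exp_pos _).le) (Finset.mem_univ k)
    _ ≤ _ := by linarith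

theorem exists_integral_exp_opSum_le (m : ℕ) {t : ℝ} (ht : 0 < t) :
    ∃ K : ℝ, 0 ≤ K ∧ ∀ N : ℕ, 1 ≤ N →
      Integrable (fun y : SATuple m N => Real.exp (2 * N * y.opSum)) (gue m N t) ∧
      ∫ y : SATuple m N, Real.exp (2 * N * y.opSum) ∂(gue m N t) ≤ Real.exp (K * N) := by
  -- The rate collects `25 ^ N`, the prefactor `1 + 2 * m` (at most its `N`-th power) and the
  -- Gaussian exponent at `θ = 2 * m`.
  refine ⟨Real.log (25 * (1 + 2 * m)) + 20 * t * (2 * m) ^ 2, ?_, fun N hN => ?_⟩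
  · have : 0 ≤ Real.log (25 * (1 + 2 * m)) := Real.log_nonneg (by
      have : (0 : ℝ) ≤ m := Nat.cast_nonneg m
      linarith)
    positivity
  have hs : 0 < t / N := by positivity
  have := isProbabilityMeasure_isoGaussian (E := SATuple m N) hs
  rw [← gue_eq_isoGaussian hN] at this
  set b : ℝ := 2 * 25 ^ N * Real.exp (20 * t * (2 * m) ^ 2 * N) with hb
  have hb0 : 0 ≤ b := by positivity
  have hcont : Continuous fun y : SATuple m N => Real.exp (2 * N * y.opSum) :=
    Real.continuous_exp.comp (continuous_const.mul continuous_opSum)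
  have hle : ∫⁻ y : SATuple m N, ENNReal.ofReal (Real.exp (2 * N * y.opSum)) ∂(gue m N t) ≤
      ENNReal.ofReal (1 + m * b) := by
    calc _ ≤ ∫⁻ y : SATuple m N, (1 + ∑ k, ENNReal.ofReal
          (Real.exp (2 * m * N * opNorm (y.mat k)))) ∂(gue m N t) := by
          refine lintegral_mono fun y => ?_
          refine (ENNReal.ofReal_le_ofReal (exp_opSum_le y)).trans_eq ?_
          rw [ENNReal.ofReal_add zero_le_one (Finset.sum_nonneg fun _ _ => (Real.exp_pos _).le),
            ENNReal.ofReal_one, ENNReal.ofReal_sum_of_nonneg fun _ _ => (Real.exp_pos _).le]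
      _ = 1 + ∑ k, ∫⁻ y : SATuple m N, ENNReal.ofReal
          (Real.exp (2 * m * N * opNorm (y.mat k))) ∂(gue m N t) := by
          rw [lintegral_add_left measurable_const, lintegral_const, measure_univ, mul_one,
            lintegral_finsetSum _ fun k _ => ?_]
          exact (ENNReal.continuous_ofReal.comp (Real.continuous_exp.comp
            (continuous_const.mul (continuous_opNorm_mat k)))).measurable
      _ ≤ 1 + ∑ _k : Fin m, ENNReal.ofReal b := by
          gcongr with k
          exact lintegral_exp_opNorm_le hN ht k (by positivity)
      _ = _ := by
          rw [Finset.sum_const, Finset.card_univ, Fintype.card_fin, nsmul_eq_mul,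
            ENNReal.ofReal_add zero_le_one (by positivity), ENNReal.ofReal_one,
            ENNReal.ofReal_mul (Nat.cast_nonneg m), ENNReal.ofReal_natCast]
  have hint : Integrable (fun y : SATuple m N => Real.exp (2 * N * y.opSum)) (gue m N t) := by
    refine ⟨hcont.aestronglyMeasurable, ?_⟩
    rw [hasFiniteIntegral_iff_ofReal (ae_of_all _ fun y => (Real.exp_pos _).le)]
    exact hle.trans_lt ENNReal.ofReal_lt_top
  refine ⟨hint, ?_⟩
  rw [integral_eq_lintegral_of_nonneg_ae (ae_of_all _ fun y => (Real.exp_pos _).le)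
    hcont.aestronglyMeasurable]
  refine (ENNReal.toReal_le_of_le_ofReal (by positivity) hle).trans ?_
  have h25 : (1 : ℝ) ≤ 25 ^ N := one_le_pow₀ (by norm_num)
  have hexp : 1 ≤ Real.exp (20 * t * (2 * m) ^ 2 * N) := Real.one_le_exp (by positivity)
  have hm1 : (1 : ℝ) + 2 * m ≤ (1 + 2 * m) ^ N :=
    le_self_pow₀ (by linarith [(Nat.cast_nonneg m : (0 : ℝ) ≤ m)]) (by omega)
  rw [add_mul, Real.exp_add, mul_comm (Real.log _), ← Real.log_pow, Real.exp_log (by positivity),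
    mul_pow]
  calc 1 + m * b ≤ 25 ^ N * Real.exp (20 * t * (2 * m) ^ 2 * N) + m * b := by
        gcongr
        exact one_le_mul_of_one_le_of_one_le h25 hexp
    _ = 25 ^ N * (1 + 2 * m) * Real.exp (20 * t * (2 * m) ^ 2 * N) := by rw [hb]; ring
    _ ≤ _ := by gcongr

end ExpMoment

/-! ### Approximable sequences of maps on self-adjoint tuples -/

section SAApprox

variable {m : ℕ}

/-- Tuples of trace polynomials with self-adjoint values. -/
def IsTraceMap (F : ∀ N, SATuple m N → SATuple m N) : Prop :=
  ∀ j, IsTraceFun fun N x => (F N x).mat j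

/-- Sequences of maps with self-adjoint values which are asymptotically approximable by trace
polynomials with self-adjoint values. -/
def SAApprox (Φ : ∀ N, SATuple m N → SATuple m N) : Prop :=
  ∀ ε : ℝ, 0 < ε → ∀ R : ℝ, 0 < R → ∃ F, IsTraceMap F ∧
    ∀ᶠ N : ℕ in atTop, ∀ x ∈ opBall m N R, ‖Φ N x - F N x‖ ≤ ε * √N

theorem isTraceMap_hermPart {f : Fin m → ∀ N, SATuple m N → Matrix (Fin N) (Fin N) ℂ}
    (hf : ∀ j, IsTraceFun (f j)) : IsTraceMap fun N x => hermPart fun j => f j N x := fun j => by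
  simp_rw [hermPart_mat]
  exact ((hf j).add (hf j).conjTranspose).smul _

theorem asympApprox_mat_iff {Φ : ∀ N, SATuple m N → SATuple m N} :
    AsympApprox (fun N x => (Φ N x).mat) ↔ SAApprox Φ := by
  constructor
  · intro h ε hε R hR
    -- Half of `ε` makes the limsup bound strict, so that it gives an eventual bound by `ε`.
    obtain ⟨f, hf⟩ := h (ε / 2) (by positivity) R hR
    refine ⟨_, isTraceMap_hermPart fun j => isTraceFun_evalTrP1 (f j), ?_⟩
    have hlt := hf.trans_lt (ENNReal.ofReal_lt_ofReal_iff hε |>.2 (half_lt_self hε))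
    filter_upwards [eventually_lt_of_limsup_lt hlt] with N hN x hx
    refine (norm_sub_hermPart_le _ _).trans ?_
    rw [mul_comm]
    gcongr
    have h1 := (le_iSup₂ (f := fun x (_ : x ∈ opBall m N R) => ENNReal.ofReal
      (norm2 fun j => (Φ N x).mat j - evalTrP1 x.mat (f j))) x hx).trans hN.le
    exact (ENNReal.ofReal_le_ofReal_iff hε.le).1 h1
  · intro h ε hε R hR
    obtain ⟨F, hF, hb⟩ := h ε hε R hR
    choose f hf using fun j => (hF j).exists_eval
    refine ⟨f, limsup_le_of_le (by isBoundedDefault) ?_⟩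
    filter_upwards [hb, eventually_ge_atTop 1] with N hN hN1
    refine iSup₂_le fun x hx => ENNReal.ofReal_le_ofReal ?_
    have h1 : (fun j => (Φ N x).mat j - evalTrP1 x.mat (f j)) = (Φ N x - F N x).mat := by
      funext j
      rw [← hf j]
      rfl
    have hN0 : 0 < √(N : ℝ) := Real.sqrt_pos.2 (by exact_mod_cast hN1)
    rw [h1, SATuple.norm2_mat, div_le_iff₀ hN0]
    exact hN x hx

theorem IsTraceMap.opSum_le {F : ∀ N, SATuple m N → SATuple m N} (hF : IsTraceMap F) :
    ∃ (K : ℝ) (n : ℕ), 0 ≤ K ∧ ∀ (N : ℕ) (x : SATuple m N) (r : ℝ), 0 ≤ r →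
      (∀ j, opNorm (x.mat j) ≤ r) → (F N x).opSum ≤ K * (1 + r) ^ n := by
  choose K n hK hb using fun j => (hF j).opNorm_le
  refine ⟨∑ j, K j, ∑ j, n j, Finset.sum_nonneg fun j _ => hK j, fun N x r hr hx => ?_⟩
  rw [Finset.sum_mul]
  refine Finset.sum_le_sum fun j _ => (hb j N x r hr hx).trans ?_
  have := hK j
  gcongr
  · linarith
  · exact Finset.single_le_sum (f := n) (fun _ _ => Nat.zero_le _) (Finset.mem_univ j)

theorem SATuple.opNorm_le_opSum {N : ℕ} (x : SATuple m N) (j : Fin m) :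
    opNorm (x.mat j) ≤ x.opSum :=
  Finset.single_le_sum (f := fun j => opNorm (x.mat j)) (fun _ _ => opNorm_nonneg _)
    (Finset.mem_univ j)

theorem SATuple.norm_le_opSum {N : ℕ} (x : SATuple m N) : ‖x‖ ≤ √N * x.opSum :=
  SATuple.norm_le_opNorm x.opSum_nonneg le_rfl

namespace SAApprox

variable {Φ Ψ : ∀ N, SATuple m N → SATuple m N}

theorem of_isTraceMap (hΦ : IsTraceMap Φ) : SAApprox Φ := fun ε hε R _ =>
  ⟨Φ, hΦ, Eventually.of_forall fun N x _ => by rw [sub_self, norm_zero]; positivity⟩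

theorem of_approx (h : ∀ ε : ℝ, 0 < ε → ∀ R : ℝ, 0 < R → ∃ Ψ, SAApprox Ψ ∧
    ∀ᶠ N : ℕ in atTop, ∀ x ∈ opBall m N R, ‖Φ N x - Ψ N x‖ ≤ ε * √N) : SAApprox Φ := by
  intro ε hε R hR
  obtain ⟨Ψ, hΨ, hb⟩ := h (ε / 2) (by positivity) R hR
  obtain ⟨F, hF, hc⟩ := hΨ (ε / 2) (by positivity) R hR
  refine ⟨F, hF, ?_⟩
  filter_upwards [hb, hc] with N h1 h2 x hx
  have := norm_sub_le_norm_sub_add_norm_sub (Φ N x) (Ψ N x) (F N x)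
  linarith [h1 x hx, h2 x hx]

theorem congr (hΦ : SAApprox Φ) (h : ∀ N, 1 ≤ N → ∀ x, Ψ N x = Φ N x) : SAApprox Ψ :=
  of_approx fun ε hε R _ => ⟨Φ, hΦ, by
    filter_upwards [eventually_ge_atTop 1] with N hN x _
    rw [h N hN, sub_self, norm_zero]
    positivity⟩

theorem add (hΦ : SAApprox Φ) (hΨ : SAApprox Ψ) : SAApprox fun N x => Φ N x + Ψ N x := by
  intro ε hε R hR
  obtain ⟨F, hF, hb⟩ := hΦ (ε / 2) (by positivity) R hR
  obtain ⟨G, hG, hc⟩ := hΨ (ε / 2) (by positivity) R hR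
  refine ⟨fun N x => F N x + G N x, fun j => (hF j).add (hG j), ?_⟩
  filter_upwards [hb, hc] with N h1 h2 x hx
  rw [add_sub_add_comm]
  have := norm_add_le (Φ N x - F N x) (Ψ N x - G N x)
  linarith [h1 x hx, h2 x hx]

theorem exists_bound (hΦ : SAApprox Φ) {R : ℝ} (hR : 0 < R) : ∃ B : ℝ, 0 ≤ B ∧
    ∀ᶠ N : ℕ in atTop, ∀ x ∈ opBall m N R, ‖Φ N x‖ ≤ B * √N := by
  obtain ⟨F, hF, hb⟩ := hΦ 1 one_pos R hR
  obtain ⟨K, n, hK, hc⟩ := hF.opSum_le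
  refine ⟨1 + K * (1 + R) ^ n, by positivity, ?_⟩
  filter_upwards [hb] with N h1 x hx
  have h2 := (F N x).norm_le_opSum
  have h3 := mul_le_mul_of_nonneg_left (hc N x R hR.le hx) (Real.sqrt_nonneg N)
  have h4 := norm_le_norm_sub_add (Φ N x) (F N x)
  linarith [h1 x hx]

/-- The inner error passes through the Lipschitz bound. The outer approximant is then needed only at
values of the trace map `G`, which stay in an operator-norm ball of `N`-independent radius; `Ψ`
itself need not. -/
theorem comp {L : ℝ} (hL0 : 0 ≤ L) (hΦ : SAApprox Φ)
    (hL : ∀ N, 1 ≤ N → ∀ x y, ‖Φ N x - Φ N y‖ ≤ L * ‖x - y‖) (hΨ : SAApprox Ψ) :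
    SAApprox fun N x => Φ N (Ψ N x) := by
  intro ε hε R hR
  obtain ⟨G, hG, hb⟩ := hΨ (ε / (2 * (L + 1))) (by positivity) R hR
  obtain ⟨K, n, hK, hGb⟩ := hG.opSum_le
  obtain ⟨F, hF, hc⟩ := hΦ (ε / 2) (by positivity) (K * (1 + R) ^ n + 1) (by positivity)
  refine ⟨fun N x => F N (G N x), fun j => (hF j).comp hG, ?_⟩
  filter_upwards [hb, hc, eventually_ge_atTop 1] with N h1 h2 hN x hx
  have h3 : G N x ∈ opBall m N (K * (1 + R) ^ n + 1) := fun j => by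
    linarith [(G N x).opNorm_le_opSum j, hGb N x R hR.le hx]
  have h4 := norm_sub_le_norm_sub_add_norm_sub (Φ N (Ψ N x)) (Φ N (G N x)) (F N (G N x))
  have h5 : L * ‖Ψ N x - G N x‖ ≤ (L + 1) * (ε / (2 * (L + 1)) * √N) :=
    mul_le_mul (by linarith) (h1 x hx) (norm_nonneg _) (by linarith)
  have h6 : (L + 1) * (ε / (2 * (L + 1)) * √N) = ε / 2 * √N := by field_simp
  linarith [hL N hN (Ψ N x) (G N x), h2 _ h3]

theorem smul (c : ℝ) (hΦ : SAApprox Φ) : SAApprox fun N x => c • Φ N x := by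
  refine comp (Φ := fun N x => c • x) (abs_nonneg c) (of_isTraceMap fun j => ?_)
    (fun N _ x y => ?_) hΦ
  · simp_rw [SATuple.mat_smul, ← Complex.coe_smul]
    exact (IsTraceFun.var j).smul _
  · rw [← smul_sub, norm_smul, Real.norm_eq_abs]

theorem id : SAApprox fun N (x : SATuple m N) => x := of_isTraceMap IsTraceFun.var

theorem sub (hΦ : SAApprox Φ) (hΨ : SAApprox Ψ) : SAApprox fun N x => Φ N x - Ψ N x := by
  simpa [sub_eq_add_neg] using hΦ.add (hΨ.smul (-1))

end SAApprox

theorem continuous_of_entries {N : ℕ} {E : Type*} [TopologicalSpace E] {F : E → SATuple m N}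
    (hF : ∀ k i j, Continuous fun y => (F y).mat k i j) : Continuous F := by
  have h := LinearMap.isClosedEmbedding_of_injective (f := SATuple.matLin (m := m) (N := N))
    (LinearMap.ker_eq_bot.2 SATuple.mat_injective)
  rw [h.isInducing.continuous_iff]
  exact continuous_pi fun k => continuous_matrix fun i j => hF k i j

theorem IsTraceMap.continuous_add {F : ∀ N, SATuple m N → SATuple m N} (hF : IsTraceMap F)
    (N : ℕ) (x : SATuple m N) : Continuous fun y => F N (x + y) :=
  continuous_of_entries fun k i j => ((hF k).isMonSum_add.polyGrowth N x i j).1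

theorem integral_mat {N : ℕ} {t : ℝ} {F : SATuple m N → SATuple m N}
    (hF : Integrable F (gue m N t)) (j : Fin m) :
    (∫ y, F y ∂(gue m N t)).mat j = matExp t fun y => (F y).mat j := by
  ext i k
  exact ((SATuple.entry j i k).toContinuousLinearMap.integral_comp_comm hF).symm

theorem opSum_add_le {N : ℕ} (x y : SATuple m N) : (x + y).opSum ≤ x.opSum + y.opSum := by
  rw [SATuple.opSum, SATuple.opSum, SATuple.opSum, ← Finset.sum_add_distrib]
  exact Finset.sum_le_sum fun j _ => opNorm_add_le _ _

theorem opSum_le_of_mem_opBall {N : ℕ} {R : ℝ} {x : SATuple m N} (hx : x ∈ opBall m N R) :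
    x.opSum ≤ m * R := by
  refine (Finset.sum_le_sum fun j _ => hx j).trans_eq ?_
  simp

theorem one_add_pow_le_exp {r : ℝ} (hr : 0 ≤ r) (n : ℕ) :
    (1 + r) ^ n ≤ n.factorial * Real.exp 1 * Real.exp r := by
  have h := Real.pow_div_factorial_le_exp (x := 1 + r) (by linarith) n
  rw [div_le_iff₀ (by positivity), Real.exp_add] at h
  linarith

/-- The pointwise truncation estimate behind the stability of approximability under Gaussian
averages. -/
theorem exists_truncation_bound {Φ F : ∀ N, SATuple m N → SATuple m N} {L ε R R₀ : ℝ}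
    (hL0 : 0 ≤ L) (hε : 0 < ε) (hR : 0 < R) (hR₀ : 0 < R₀) (hF : IsTraceMap F)
    (hL : ∀ N, 1 ≤ N → ∀ x y, ‖Φ N x - Φ N y‖ ≤ L * ‖x - y‖)
    (hb : ∀ᶠ N : ℕ in atTop, ∀ x ∈ opBall m N (R + R₀), ‖Φ N x - F N x‖ ≤ ε * √N) :
    ∃ K : ℝ, 0 ≤ K ∧ ∀ᶠ N : ℕ in atTop, ∀ x ∈ opBall m N R, ∀ y : SATuple m N,
      ‖Φ N (x + y) - F N (x + y)‖ ≤
        √N * (ε + K * Real.exp (-(R₀ * N)) * Real.exp (2 * N * y.opSum)) := by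
  obtain ⟨K, n, hK, hFb⟩ := hF.opSum_le
  refine ⟨(K + ε + L * m * R + L) + K * (1 + R) ^ n * (n.factorial * Real.exp 1), by positivity, ?_⟩
  filter_upwards [hb, eventually_ge_atTop 1] with N h1 hN x hx y
  have hN1 : (1 : ℝ) ≤ N := by exact_mod_cast hN
  have hr := y.opSum_nonneg
  set r := y.opSum with hrdef
  set K' := (K + ε + L * m * R + L) + K * (1 + R) ^ n * (n.factorial * Real.exp 1)
  have hK' : 0 ≤ K' := by positivity
  have hy : ∀ j, opNorm ((x + y).mat j) ≤ R + r := fun j =>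
    (opNorm_add_le _ _).trans (add_le_add (hx j) (y.opNorm_le_opSum j))
  rcases le_or_gt r R₀ with hr0 | hr0
  · refine (h1 (x + y) fun j => (hy j).trans (by linarith)).trans ?_
    rw [mul_comm]
    gcongr
    have : 0 ≤ K' * Real.exp (-(R₀ * N)) * Real.exp (2 * N * r) := by positivity
    linarith
  -- For `r > R₀` and `N ≥ 1`, `r ≤ N * r ≤ 2 * N * r - R₀ * N`.
  · have hexp : Real.exp r ≤ Real.exp (-(R₀ * N)) * Real.exp (2 * N * r) := by
      rw [← Real.exp_add]
      refine Real.exp_le_exp.2 ?_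
      nlinarith
    have h0mem : (0 : SATuple m N) ∈ opBall m N 0 := fun j => by
      have : (0 : SATuple m N).mat j = 0 := rfl
      rw [this, opNorm_zero]
    have hF0 : ‖F N 0‖ ≤ √N * K := by
      refine (F N 0).norm_le_opSum.trans ?_
      gcongr
      simpa using hFb N 0 0 le_rfl h0mem
    have hΦ0 := h1 0 fun j => (h0mem j).trans (by positivity)
    have hxy : ‖x + y‖ ≤ √N * (m * R + r) := by
      refine (x + y).norm_le_opSum.trans ?_
      gcongr
      exact (opSum_add_le x y).trans (add_le_add_left (opSum_le_of_mem_opBall hx) _)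
    have hFx : ‖F N (x + y)‖ ≤ √N * (K * (1 + R) ^ n * (n.factorial * Real.exp 1) * Real.exp r) := by
      refine (F N (x + y)).norm_le_opSum.trans ?_
      gcongr
      refine (hFb N (x + y) (R + r) (by positivity) hy).trans ?_
      calc K * (1 + (R + r)) ^ n ≤ K * ((1 + R) * (1 + r)) ^ n := by
            gcongr
            nlinarith
        _ = K * (1 + R) ^ n * (1 + r) ^ n := by rw [mul_pow]; ring
        _ ≤ K * (1 + R) ^ n * (n.factorial * Real.exp 1 * Real.exp r) := by
            gcongr
            exact one_add_pow_le_exp hr n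
        _ = _ := by ring
    have hΦx : ‖Φ N (x + y)‖ ≤ √N * ((K + ε + L * m * R + L) * Real.exp r) := by
      have h2 := norm_le_norm_sub_add (Φ N (x + y)) (Φ N 0)
      have h3 := norm_le_norm_sub_add (Φ N 0) (F N 0)
      have h4 := hL N hN (x + y) 0
      rw [sub_zero] at h4
      have h5 := mul_le_mul_of_nonneg_left hxy hL0
      have h6 : (K + ε + L * m * R + L * r) ≤ (K + ε + L * m * R + L) * Real.exp r := by
        have he : 1 + r ≤ Real.exp r := by linarith [Real.add_one_le_exp r]
        have h7 : (K + ε + L * m * R + L * r) ≤ (K + ε + L * m * R + L) * (1 + r) := by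
          have : 0 ≤ (K + ε + L * m * R) * r := by positivity
          nlinarith
        exact h7.trans (mul_le_mul_of_nonneg_left he (by positivity))
      have h8 := mul_le_mul_of_nonneg_left h6 (Real.sqrt_nonneg N)
      linarith
    calc ‖Φ N (x + y) - F N (x + y)‖ ≤ ‖Φ N (x + y)‖ + ‖F N (x + y)‖ := norm_sub_le _ _
      _ ≤ √N * (K' * Real.exp r) := by
        have : K' * Real.exp r = (K + ε + L * m * R + L) * Real.exp r +
          K * (1 + R) ^ n * (n.factorial * Real.exp 1) * Real.exp r := by ring
        rw [this]
        linarith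
      _ ≤ √N * (ε + K' * Real.exp (-(R₀ * N)) * Real.exp (2 * N * r)) := by
        gcongr
        have := mul_le_mul_of_nonneg_left hexp hK'
        linarith

/-- Truncation allows a trace polynomial to replace `Φ` under the integral, the Lipschitz bound
controlling growth where the approximation says nothing. The loop equations then turn the average
into a trace polynomial in `x`. -/
theorem SAApprox.integral_add {Φ : ∀ N, SATuple m N → SATuple m N} (hΦ : SAApprox Φ) {L t : ℝ}
    (hL0 : 0 ≤ L) (hL : ∀ N, 1 ≤ N → ∀ x y, ‖Φ N x - Φ N y‖ ≤ L * ‖x - y‖) (ht : 0 < t) :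
    SAApprox fun N x => ∫ y, Φ N (x + y) ∂(gue m N t) := by
  intro ε hε R hR
  obtain ⟨K₀, hK₀, hexp⟩ := exists_integral_exp_opSum_le m ht
  -- The truncation radius `K₀ + 1` beats the exponential moment: `exp (-(K₀ + 1) * N) * exp (K₀ *
  -- N) = exp (-N)`.
  obtain ⟨F, hF, hb⟩ := hΦ (ε / 3) (by positivity) (R + (K₀ + 1)) (by positivity)
  obtain ⟨K, hK, hbound⟩ := exists_truncation_bound hL0 (by positivity : 0 < ε / 3) hR
    (by positivity : 0 < K₀ + 1) hF hL hb
  choose g hg hgb using fun j => (hF j).isMonSum_add.isNearTraceFun ht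
  choose B hB hgB using fun j => hgb j R hR.le
  refine ⟨_, isTraceMap_hermPart hg, ?_⟩
  have hlim1 : ∀ᶠ N : ℕ in atTop, K * Real.exp (-(N : ℝ)) ≤ ε / 3 := by
    have : Tendsto (fun N : ℕ => K * Real.exp (-(N : ℝ))) atTop (𝓝 (K * 0)) :=
      (Real.tendsto_exp_neg_atTop_nhds_zero.comp tendsto_natCast_atTop_atTop).const_mul K
    rw [mul_zero] at this
    exact this.eventually_le_const (by positivity)
  have hlim2 : ∀ᶠ N : ℕ in atTop, (∑ j, B j) / (N : ℝ) ≤ ε / 3 :=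
    (tendsto_const_div_atTop_nhds_zero_nat (∑ j, B j)).eventually_le_const (by positivity)
  filter_upwards [hbound, hlim1, hlim2, eventually_ge_atTop 1] with N h1 h2 h3 hN x hx
  have hN1 : (1 : ℝ) ≤ N := by exact_mod_cast hN
  have hs : 0 < t / N := by positivity
  obtain ⟨hei, hev⟩ := hexp N hN
  have hprob := isProbabilityMeasure_isoGaussian (E := SATuple m N) hs
  rw [← gue_eq_isoGaussian hN] at hprob
  have hΦc : Continuous (Φ N) :=
    (LipschitzWith.of_dist_le_mul (K := ⟨L, hL0⟩) fun x y => by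
      rw [dist_eq_norm, dist_eq_norm]
      exact hL N hN x y).continuous
  have hΦi : Integrable (fun y => Φ N (x + y)) (gue m N t) := by
    rw [gue_eq_isoGaussian hN]
    refine integrable_of_pow_bound hs
      (hΦc.comp (continuous_const.add continuous_id)).aestronglyMeasurable (‖Φ N x‖ + L) 1
      fun y => ?_
    have h4 := norm_le_norm_sub_add (Φ N (x + y)) (Φ N x)
    have h5 := hL N hN (x + y) x
    rw [add_sub_cancel_left] at h5
    nlinarith [norm_nonneg y, norm_nonneg (Φ N x)]
  have hbi : Integrable (fun y : SATuple m N => √N * (ε / 3 + K * Real.exp (-((K₀ + 1) * N)) *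
      Real.exp (2 * N * y.opSum))) (gue m N t) :=
    ((integrable_const _).add (hei.const_mul _)).const_mul _
  have hdi : Integrable (fun y => Φ N (x + y) - F N (x + y)) (gue m N t) :=
    hbi.mono' ((hΦc.comp (continuous_const.add continuous_id)).sub
      (hF.continuous_add N x)).aestronglyMeasurable (ae_of_all _ (h1 x hx))
  have hFi : Integrable (fun y => F N (x + y)) (gue m N t) :=
    (hΦi.sub hdi).congr (ae_of_all _ fun y => sub_sub_cancel _ _)
  have hfirst : ‖∫ y, Φ N (x + y) ∂(gue m N t) - ∫ y, F N (x + y) ∂(gue m N t)‖ ≤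
      √N * (ε / 3 + ε / 3) := by
    rw [← integral_sub hΦi hFi]
    refine (norm_integral_le_of_norm_le hbi (ae_of_all _ (h1 x hx))).trans ?_
    rw [integral_const_mul, MeasureTheory.integral_add (integrable_const _) (hei.const_mul _),
      integral_const_mul, integral_const, probReal_univ, one_smul]
    gcongr
    calc K * Real.exp (-((K₀ + 1) * N)) * ∫ y : SATuple m N, Real.exp (2 * N * y.opSum) ∂(gue m N t)
        ≤ K * Real.exp (-((K₀ + 1) * N)) * Real.exp (K₀ * N) := by gcongr
      _ = K * Real.exp (-(N : ℝ)) := by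
        rw [mul_assoc, ← Real.exp_add]
        congr 2
        ring
      _ ≤ ε / 3 := h2
  have hsecond : ‖∫ y, F N (x + y) ∂(gue m N t) - hermPart fun j => g j N x‖ ≤ √N * (ε / 3) := by
    refine SATuple.norm_le_opNorm (by positivity) ?_
    calc _ ≤ ∑ j, B j / (N : ℝ) ^ 2 := by
          refine Finset.sum_le_sum fun j _ => (opNorm_sub_hermPart_le _ _ _).trans ?_
          rw [integral_mat hFi]
          exact hgB j N hN x hx
      _ = (∑ j, B j) / (N : ℝ) ^ 2 := (Finset.sum_div _ _ _).symm
      _ ≤ (∑ j, B j) / (N : ℝ) := by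
          have : 0 ≤ ∑ j, B j := Finset.sum_nonneg fun j _ => hB j
          gcongr
          exact le_self_pow₀ hN1 two_ne_zero
      _ ≤ ε / 3 := h3
  have h4 := norm_sub_le_norm_sub_add_norm_sub (∫ y, Φ N (x + y) ∂(gue m N t))
    (∫ y, F N (x + y) ∂(gue m N t)) (hermPart fun j => g j N x)
  linarith

end SAApprox

/-! ### Resolvents of monotone maps -/

section Resolvent

/-- The step size minimizes `1 - 2 * η + η ^ 2 * M ^ 2`, the factor obtained from strong
monotonicity with constant one and Lipschitz constant `M`; no smallness of `M` is required. -/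
theorem norm_sq_damped_step_le {E : Type*} [NormedAddCommGroup E] [InnerProductSpace ℝ E]
    {e d : E} {M : ℝ} (hM : 0 < M) (h1 : ‖e‖ ^ 2 ≤ inner ℝ e d) (h2 : ‖d‖ ≤ M * ‖e‖) :
    ‖e - (1 / M ^ 2) • d‖ ^ 2 ≤ (1 - 1 / M ^ 2) * ‖e‖ ^ 2 := by
  rw [norm_sub_sq_real, real_inner_smul_right, norm_smul, mul_pow, Real.norm_eq_abs, sq_abs]
  have h3 : ‖d‖ ^ 2 ≤ (M * ‖e‖) ^ 2 := pow_le_pow_left₀ (norm_nonneg d) h2 2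
  have hM2 : 0 < 1 / M ^ 2 := by positivity
  have h4 : (1 / M ^ 2) ^ 2 * ‖d‖ ^ 2 ≤ (1 / M ^ 2) ^ 2 * (M * ‖e‖) ^ 2 := by gcongr
  have h5 : (1 / M ^ 2) ^ 2 * (M * ‖e‖) ^ 2 = 1 / M ^ 2 * ‖e‖ ^ 2 := by field_simp
  have h6 := mul_le_mul_of_nonneg_left h1 hM2.le
  linarith

variable {m : ℕ} {Φ J : ∀ N, SATuple m N → SATuple m N} {L s : ℝ}

/-- The damped fixed point iteration for the equation `z + s Φ(z) = x`. -/
noncomputable def resolventIter (Φ : ∀ N, SATuple m N → SATuple m N) (L s : ℝ) :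
    ℕ → ∀ N, SATuple m N → SATuple m N
  | 0 => fun _ x => x
  | k + 1 => fun N x => resolventIter Φ L s k N x - (1 / (1 + s * L) ^ 2) •
      (resolventIter Φ L s k N x + s • Φ N (resolventIter Φ L s k N x) - x)

theorem SAApprox.resolventIter (hL0 : 0 ≤ L) (hΦ : SAApprox Φ)
    (hL : ∀ N, 1 ≤ N → ∀ x y, ‖Φ N x - Φ N y‖ ≤ L * ‖x - y‖) (k : ℕ) :
    SAApprox (resolventIter Φ L s k) := by
  induction k with
  | zero => exact SAApprox.id
  | succ k ih => exact ih.sub (((ih.add ((hΦ.comp hL0 hL ih).smul s)).sub SAApprox.id).smul _)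

theorem norm_sq_le_inner_resolvent (hs : 0 < s) {N : ℕ}
    (hmono : ∀ x y, 0 ≤ inner ℝ (Φ N x - Φ N y) (x - y)) (z w : SATuple m N) :
    ‖z - w‖ ^ 2 ≤ inner ℝ (z - w) ((z + s • Φ N z) - (w + s • Φ N w)) := by
  have h : (z + s • Φ N z) - (w + s • Φ N w) = (z - w) + s • (Φ N z - Φ N w) := by module
  rw [h, inner_add_right, real_inner_self_eq_norm_sq, real_inner_smul_right, real_inner_comm]
  have := mul_nonneg hs.le (hmono z w)
  linarith

theorem norm_resolventIter_sub_sq_le (hL0 : 0 ≤ L) (hs : 0 < s) {N : ℕ}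
    (hL : ∀ x y, ‖Φ N x - Φ N y‖ ≤ L * ‖x - y‖)
    (hmono : ∀ x y, 0 ≤ inner ℝ (Φ N x - Φ N y) (x - y))
    (hJ : ∀ x, J N x + s • Φ N (J N x) = x) (k : ℕ) (x : SATuple m N) :
    ‖resolventIter Φ L s k N x - J N x‖ ^ 2 ≤
      (1 - 1 / (1 + s * L) ^ 2) ^ k * (s * ‖Φ N x‖) ^ 2 := by
  have hM : 1 ≤ 1 + s * L := by
    have := mul_nonneg hs.le hL0
    linarith
  have hq : 0 ≤ 1 - 1 / (1 + s * L) ^ 2 := by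
    rw [sub_nonneg, div_le_one (by positivity)]
    exact one_le_pow₀ hM
  induction k with
  | zero =>
    have h1 := norm_sq_le_inner_resolvent hs hmono x (J N x)
    rw [hJ, add_sub_cancel_left] at h1
    have h2 := h1.trans (real_inner_le_norm _ _)
    rw [norm_smul, Real.norm_eq_abs, abs_of_pos hs] at h2
    have h3 : ‖x - J N x‖ ≤ s * ‖Φ N x‖ := by
      by_contra! hlt
      have : 0 ≤ s * ‖Φ N x‖ := by positivity
      nlinarith
    rw [pow_zero, one_mul]
    exact pow_le_pow_left₀ (norm_nonneg _) h3 2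
  | succ k ih =>
    set z := resolventIter Φ L s k N x with hz
    have h1 := norm_sq_le_inner_resolvent hs hmono z (J N x)
    have h2 : ‖(z + s • Φ N z) - (J N x + s • Φ N (J N x))‖ ≤ (1 + s * L) * ‖z - J N x‖ := by
      have h3 : (z + s • Φ N z) - (J N x + s • Φ N (J N x)) =
          (z - J N x) + s • (Φ N z - Φ N (J N x)) := by module
      rw [h3]
      refine (norm_add_le _ _).trans ?_
      rw [norm_smul, Real.norm_eq_abs, abs_of_pos hs]
      have := mul_le_mul_of_nonneg_left (hL z (J N x)) hs.le
      linarith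
    have h3 := norm_sq_damped_step_le (by linarith) h1 h2
    rw [hJ] at h3
    have h4 : resolventIter Φ L s (k + 1) N x - J N x =
        (z - J N x) - (1 / (1 + s * L) ^ 2) • (z + s • Φ N z - x) := by
      simp only [resolventIter, ← hz]
      abel
    rw [h4, pow_succ' (1 - 1 / (1 + s * L) ^ 2), mul_assoc]
    exact h3.trans (mul_le_mul_of_nonneg_left ih hq)

/-- The contraction factor does not depend on `N` and the initial error is `O(√N)` on operator-norm
balls, so a fixed number of iterations serves all large `N`; every iterate is approximable by
composition. -/
theorem SAApprox.resolvent (hL0 : 0 ≤ L) (hs : 0 < s) (hΦ : SAApprox Φ)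
    (hL : ∀ N, 1 ≤ N → ∀ x y, ‖Φ N x - Φ N y‖ ≤ L * ‖x - y‖)
    (hmono : ∀ N, 1 ≤ N → ∀ x y, 0 ≤ inner ℝ (Φ N x - Φ N y) (x - y))
    (hJ : ∀ N, 1 ≤ N → ∀ x, J N x + s • Φ N (J N x) = x) : SAApprox J := by
  refine SAApprox.of_approx fun ε hε R hR => ?_
  obtain ⟨B, hB, hb⟩ := hΦ.exists_bound hR
  have hM : 1 ≤ 1 + s * L := by
    have := mul_nonneg hs.le hL0
    linarith
  have hq : 0 ≤ 1 - 1 / (1 + s * L) ^ 2 := by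
    rw [sub_nonneg, div_le_one (by positivity)]
    exact one_le_pow₀ hM
  have hq1 : 1 - 1 / (1 + s * L) ^ 2 < 1 := by
    have : 0 < 1 / (1 + s * L) ^ 2 := by positivity
    linarith
  have hlim := (tendsto_pow_atTop_nhds_zero_of_lt_one hq hq1).mul_const ((s * B) ^ 2)
  rw [zero_mul] at hlim
  obtain ⟨k, hk⟩ := (hlim.eventually_le_const (show 0 < ε ^ 2 by positivity)).exists
  refine ⟨_, hΦ.resolventIter (s := s) hL0 hL k, ?_⟩
  filter_upwards [hb, eventually_ge_atTop 1] with N h1 hN x hx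
  rw [norm_sub_rev]
  refine le_of_sq_le_sq ?_ (by positivity)
  refine (norm_resolventIter_sub_sq_le hL0 hs (hL N hN) (hmono N hN) (hJ N hN) k x).trans ?_
  calc (1 - 1 / (1 + s * L) ^ 2) ^ k * (s * ‖Φ N x‖) ^ 2
      ≤ (1 - 1 / (1 + s * L) ^ 2) ^ k * (s * (B * √N)) ^ 2 := by
        gcongr
        exact h1 x hx
    _ = (1 - 1 / (1 + s * L) ^ 2) ^ k * (s * B) ^ 2 * √N ^ 2 := by ring
    _ ≤ ε ^ 2 * √N ^ 2 := by gcongr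
    _ = _ := by ring

end Resolvent

/-! ### Approximability of the gradients along the semigroups -/

section Potentials

variable {m : ℕ} {C t : ℝ} {u : ∀ N, SATuple m N → ℝ}

/-- Uniformly convex-smooth potentials whose normalized gradients are approximable. -/
def IsApproxPotential (C : ℝ) (u : ∀ N, SATuple m N → ℝ) : Prop :=
  (∀ N : ℕ, 1 ≤ N → IsConvexSmooth (C / N) (u N)) ∧ SAApprox fun N => normGrad (u N)

namespace IsApproxPotential

theorem congr {v : ∀ N, SATuple m N → ℝ} (hu : IsApproxPotential C u)
    (h : ∀ N : ℕ, 1 ≤ N → v N = u N) : IsApproxPotential C v :=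
  ⟨fun N hN => h N hN ▸ hu.1 N hN, hu.2.congr fun N hN x => by rw [h N hN]⟩

theorem norm_normGrad_sub_le (hu : IsApproxPotential C u) (hC : 0 < C) (N : ℕ) (hN : 1 ≤ N)
    (x y : SATuple m N) : ‖normGrad (u N) x - normGrad (u N) y‖ ≤ C * ‖x - y‖ := by
  have hN' : (0 : ℝ) < N := by positivity
  have h := (hu.1 N hN).gradient_lipschitz (by positivity) y x
  rw [norm_normGrad_sub]
  calc N * ‖gradient (u N) x - gradient (u N) y‖ ≤ N * (C / N * ‖x - y‖) := by gcongr
    _ = C * ‖x - y‖ := by field_simp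

theorem gaussAvg (hu : IsApproxPotential C u) (hC : 0 < C) (ht : 0 < t) :
    IsApproxPotential C fun N => gaussAvg (t / N) (u N) := by
  refine ⟨fun N hN => (hu.1 N hN).gaussAvg (div_pos hC (Nat.cast_pos.2 hN)) (div_pos ht (Nat.cast_pos.2 hN)),
    (hu.2.integral_add hC.le (hu.norm_normGrad_sub_le hC) ht).congr fun N hN x => ?_⟩
  have hN' : (0 : ℝ) < N := by positivity
  simp only [normGrad]
  rw [(hu.1 N hN).gradient_gaussAvg (by positivity) (by positivity),
    gue_eq_isoGaussian hN]
  exact (integral_smul _ _).symm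

/-- The slope equation says that `x - t D(Q_t u)(x)` is the resolvent of `Du` at `x`. It is
approximable, and `D(Q_t u)` is `Du` composed with it. -/
theorem infConv (hu : IsApproxPotential C u) (hC : 0 < C) (ht : 0 < t) :
    IsApproxPotential C fun N => infConv (N * t) (u N) := by
  have hfix : ∀ N : ℕ, 1 ≤ N → ∀ x : SATuple m N,
      normGrad (u N) (x - t • normGrad (_root_.infConv (N * t) (u N)) x) =
        normGrad (_root_.infConv (N * t) (u N)) x := fun N hN x => by
    have hN' : (0 : ℝ) < N := by positivity
    have h := (hu.1 N hN).gradient_infConv (mul_pos hN' ht) x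
    rw [normGrad, normGrad, smul_smul, mul_comm t, h]
  have hJ : SAApprox fun N (x : SATuple m N) =>
      x - t • normGrad (_root_.infConv (N * t) (u N)) x := by
    refine hu.2.resolvent hC.le ht (hu.norm_normGrad_sub_le hC) (fun N hN x y => ?_)
      fun N hN x => ?_
    · rw [normGrad, normGrad, ← smul_sub, real_inner_smul_left]
      exact mul_nonneg (Nat.cast_nonneg N) ((hu.1 N hN).gradient_monotone y x)
    · rw [hfix N hN, sub_add_cancel]
  refine ⟨fun N hN => (hu.1 N hN).infConv (mul_pos (Nat.cast_pos.2 hN) ht),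
    (hu.2.comp hC.le (hu.norm_normGrad_sub_le hC) hJ).congr fun N hN x => (hfix N hN x).symm⟩

theorem trotterStep_iterate (hu : IsApproxPotential C u) (hC : 0 < C) (ht : 0 < t) (n : ℕ) :
    IsApproxPotential C fun N => (trotterStep ((N : ℝ) ^ 2) (t / N))^[n] (u N) := by
  induction n with
  | zero => exact hu
  | succ n ih =>
    refine ((ih.infConv hC ht).gaussAvg hC ht).congr fun N hN => ?_
    have hN' : (N : ℝ) ≠ 0 := by positivity
    rw [Function.iterate_succ_apply', trotterStep]
    congr 2
    field_simp

/-- For a fixed level `l` the iterated scheme is approximable, and its normalized gradient is within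
`ε * √N` of the limit, uniformly in `N` and `x`. -/
theorem gaussPotential (hu : IsApproxPotential C u) (hC : 0 < C) (ht : 0 < t) :
    IsApproxPotential C fun N => gaussPotential t (u N) := by
  refine ⟨fun N hN => isConvexSmooth_gaussPotential hN (hu.1 N hN) (by positivity) ht,
    SAApprox.of_approx fun ε hε R _ => ?_⟩
  obtain ⟨K, hK, hb⟩ := exists_uniform_trotter_bound m hC ht
  have hlim : Tendsto (fun l : ℕ => K / 2 ^ l) atTop (𝓝 0) :=
    tendsto_const_nhds.div_atTop (tendsto_pow_atTop_atTop_of_one_lt one_lt_two)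
  obtain ⟨l, hl⟩ := (hlim.eventually_le_const (show 0 < ε ^ 2 by positivity)).exists
  refine ⟨_, (hu.trotterStep_iterate hC (show 0 < t / 2 ^ l by positivity) (2 ^ l)).2, ?_⟩
  filter_upwards [eventually_ge_atTop 1] with N hN x _
  have h := hb N hN (u N) (hu.1 N hN) l x
  rw [norm_sub_rev]
  refine le_of_sq_le_sq ?_ (by positivity)
  rw [div_right_comm]
  refine h.trans ?_
  rw [mul_pow, Real.sq_sqrt (Nat.cast_nonneg N), mul_comm]
  gcongr

end IsApproxPotential

end Potentials

/-! ### The main theorem. -/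

theorem mainTheorem7 (m : ℕ) (C : ℝ) (V : ∀ N : ℕ, SATuple m N → ℝ)
    (hconvex : ∀ N : ℕ, 1 ≤ N → ConvexOn ℝ univ (V N))
    (hconcave : ∀ N : ℕ, 1 ≤ N → ConcaveOn ℝ univ (fun x => V N x - C / 2 * norm2 x.mat ^ 2))
    (happrox : GradAsympApprox V)
    (t : ℝ) (ht : 0 < t) :
    -- the heat semigroup
    ((∀ N : ℕ, 1 ≤ N →
        (∀ x : SATuple m N, Integrable (fun y => V N (x + y)) (gue m N t)) ∧
        Differentiable ℝ (heatOp t (V N))) ∧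
      GradAsympApprox (fun N => heatOp t (V N))) ∧
    -- the Hopf-Lax semigroup
    ((∀ N : ℕ, 1 ≤ N →
        (∀ x : SATuple m N, BddBelow (Set.range fun y : SATuple m N =>
          V N (x + y) + 1 / (2 * t) * norm2 y.mat ^ 2)) ∧
        Differentiable ℝ (hopfLax t (V N))) ∧
      GradAsympApprox (fun N => hopfLax t (V N))) ∧
    -- the semigroup obtained by iterating the two previous ones
    ((∀ N : ℕ, 1 ≤ N →
        (∀ x : SATuple m N, ∀ s ∈ dyadics,
          Tendsto (fun ℓ : ℕ => trotter ℓ ⌊(2 : ℝ) ^ ℓ * s⌋₊ (V N) x) atTop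
            (𝓝 (evolDyadic s (V N) x))) ∧
        (∀ x : SATuple m N,
          Tendsto (fun s => evolDyadic s (V N) x) (𝓝[dyadics] t) (𝓝 (evol t (V N) x))) ∧
        Differentiable ℝ (evol t (V N))) ∧
      GradAsympApprox (fun N => evol t (V N))) ∧
    -- the potential of the convolution of the Gibbs measure with the Gaussian measure
    ((∀ N : ℕ, 1 ≤ N →
        (∀ x : SATuple m N,
          Integrable (fun y => Real.exp (-((N : ℝ) ^ 2 * V N (x + y)))) (gue m N t)) ∧
        Differentiable ℝ (gaussPotential t (V N)) ∧
        (Integrable (fun x : SATuple m N => Real.exp (-((N : ℝ) ^ 2 * V N x))) →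
          (gibbs (V N)).conv (gue m N t) = gibbs (gaussPotential t (V N)))) ∧
      GradAsympApprox (fun N => gaussPotential t (V N))) := by
  -- Enlarging the smoothness constant is harmless and makes it positive, as the gradient estimates
  -- require.
  set c : ℝ := max C 1 with hcdef
  have hc : 0 < c := lt_max_of_lt_right one_pos
  have hV : IsApproxPotential c V := by
    refine ⟨fun (N : ℕ) hN => (isConvexSmooth_of_concaveOn (hconvex N hN)
      (hconcave N hN)).mono_const ?_, asympApprox_mat_iff.1 happrox⟩
    gcongr
    exact le_max_left _ _
  have hgrad : ∀ {u : ∀ N, SATuple m N → ℝ}, IsApproxPotential c u → GradAsympApprox u :=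
    fun hu => asympApprox_mat_iff.2 hu.2
  have hheat : IsApproxPotential c fun N => heatOp t (V N) :=
    (hV.gaussAvg hc ht).congr fun N hN => heatOp_eq_gaussAvg hN t (V N)
  have hhopf : IsApproxPotential c fun N => hopfLax t (V N) :=
    (hV.infConv hc ht).congr fun N _ => hopfLax_eq_infConv t (V N)
  have hpot := hV.gaussPotential hc ht
  have hcN : ∀ N : ℕ, 1 ≤ N → 0 < c / N := fun N hN => by positivity
  have hevol : IsApproxPotential c fun N => evol t (V N) :=
    hpot.congr fun N hN => evol_eq_gaussPotential hN (hV.1 N hN) (hcN N hN) ht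
  refine ⟨⟨fun N hN => ⟨fun x => ?_, (hheat.1 N hN).differentiable⟩, hgrad hheat⟩,
    ⟨fun N hN => ⟨fun x => ?_, (hhopf.1 N hN).differentiable⟩, hgrad hhopf⟩,
    ⟨fun N hN => ⟨fun x s hs => tendsto_trotter_evolDyadic hN (hV.1 N hN) (hcN N hN) x hs,
      tendsto_evol hN (hV.1 N hN) (hcN N hN) ht, (hevol.1 N hN).differentiable⟩, hgrad hevol⟩,
    ⟨fun N hN => ⟨fun x => ?_, (hpot.1 N hN).differentiable,
      fun _ => gibbs_conv_gue hN ht (hV.1 N hN)⟩, hgrad hpot⟩⟩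
  · rw [gue_eq_isoGaussian hN]
    exact (hV.1 N hN).integrable_add (hcN N hN).le (by positivity) x
  · have hN' : (0 : ℝ) < N := by positivity
    have h := (hV.1 N hN).bddBelow_infConv (mul_pos hN' ht) x
    convert h using 3
    rw [SATuple.norm2_mat_sq]
    field_simp
  · rw [gue_eq_isoGaussian hN]
    have h := (hV.1 N hN).integrable_exp (κ := (N : ℝ) ^ 2) (by positivity)
      (show 0 < t / N by positivity) x
    simpa using h
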